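/- **Setting.** For each $n$ let $R=R_n$ be a symmetric $n\times n$ matrix with entries $R(u,v)\ge 0$, indexed by $V=[n]$. Write $d_R(u)=\sum_v R(u,v)$, $d_R(A)=\sum_{u\in A}d_R(u)$, $\sigma(A)=d_R(A)/d_R(V)$, $M(u,v)=R(u,v)/d_R(u)$, and $\|X\|=\max_{u,v}X(u,v)$ for a matrix $X$. Let $1=\lambda_1\ge\lambda_2\ge\dots\ge\lambda_n\ge-1$ be the eigenvalues of $M$ and $\lambda(R)=\max\{|\lambda_2|,|\lambda_n|\}$. We write $R\in\mathrm{RM}$ if there are constants $\alpha\in[0,1/2)$, $\gamma>0$, $b>0$ and a function $d=d(n)>0$ such that $\lambda(R)\to 0$ as $n\to\infty$ and, for all sufficiently large $n$, - $\lambda(R)\le (n\|M\|)^{-\alpha-\gamma}$; - $d_R(u)\ge d$ for all $u\in V$, and $d_R(V)\le b\,d\,n$; - $\sigma(A)\le b\,(|A|/n)^{1-2\alpha}$ for all $A\subseteq V$; - $\|R\|\le d\,n^{-\gamma}$. Assign to the unordered pairs $\{u,v\}$, $u\neq v$, independent random times $E(u,v)$, exponentially distributed with rate $R(u,v)$ (and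 $E(u,v)=\infty$ if $R(u,v)=0$). Let $G_{n,R}(t)$ be the graph on $V$ with edge set $\{uv: E(u,v)\le t\}$, and let $\tau_k$ be the first time $t$ at which $G_{n,R}(t)$ has minimum degree at least $k$. For an integer $D\ge k$ let $T_D(u)$ be the first time at which $u$ has degree at least $D$ in $G_{n,R}(t)$, and let $H\subseteq G_{n,R}(\tau_k)$ be the graph consisting of the edges $uv$ with $E(u,v)\le\tau_k$ and $E(u,v)\le\max\{T_D(u),T_D(v)\}$. (That is, an edge of $G_{n,R}(\tau_k)$ is kept if it is among the first $D$ edges at one of its endpoints.) For a graph $G$ on $V$ and $A\subseteq V$ let $N_G(A)$ be the set of vertices outside $A$ that have a neighbour in $A$, and $\widehat N_G(A)=A\cup N_G(A)$. "With high probability" (whp) means with probability tending to $1$ as $n\to\infty$. **Lemma.** Let $R\in\mathrm{RM}$ and let $k\ge1$ be a fixed integer. There are constants $D_0\ge k$ and $\beta>0$, depending only on the sequence $R$ and on $k$, such that for every fixed integer $D\ge D_0$ the following hold. 1. (Light tail) Let $d=d(n)$ be any function as in the definition of $R\in\mathrm{RM}$, and let $\theta=\theta(n)\to\infty$. Let $S_\theta$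 be the set of vertices $u$ with $d_H(u)\ge\theta$ or $d_R(u)\ge\theta d$. Then $|\widehat N_H(S_\theta)|=o(n)$ whp, i.e. for every $\varepsilon>0$, $|\widehat N_H(S_\theta)|\le\varepsilon n$ whp. 2. (Expansion) Whp, every $A\subseteq V$ with $|A|<\beta n$ satisfies $|N_H(A)|\ge k|A|$. -/

import Mathlib

open MeasureTheory ProbabilityTheory Filter Topology
open scoped ENNReal

namespace RateProcess

/-- A rate matrix on `V = Fin n`: a symmetric matrix with nonnegative real entries. -/
structure RateMatrix (n : ℕ) where
  rate : Matrix (Fin n) (Fin n) ℝ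
  symm : ∀ u v, rate u v = rate v u
  nonneg : ∀ u v, 0 ≤ rate u v

noncomputable section

/-- The largest entry `max_{u,v} A(u,v)` of a matrix, written `‖A‖`. -/
def maxEntry {n : ℕ} (A : Matrix (Fin n) (Fin n) ℝ) : ℝ :=
  ⨆ p : Fin n × Fin n, A p.1 p.2

namespace RateMatrix

variable {n : ℕ} (R : RateMatrix n)

/-- The weighted degree `d_R(u) = ∑_v R(u,v)`. -/
def deg (u : Fin n) : ℝ := ∑ v, R.rate u v

/-- `d_R(A) = ∑_{u ∈ A} d_R(u)`. -/
def degSet (A : Finset (Fin n)) : ℝ := ∑ u ∈ A, R.deg u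

/-- The total weight `d_R(V)`. -/
def total : ℝ := R.degSet Finset.univ

/-- The stationary weight `σ(A) = d_R(A) / d_R(V)`. -/
def stationary (A : Finset (Fin n)) : ℝ := R.degSet A / R.total

/-- The transition matrix `M(u,v) = R(u,v) / d_R(u)`. -/
def transition : Matrix (Fin n) (Fin n) ℝ := fun u v => R.rate u v / R.deg u

/-- The eigenvalues `λ₁ ≥ λ₂ ≥ … ≥ λₙ` of the transition matrix, with multiplicity. -/
def eigenvalues : List ℝ := R.transition.charpoly.roots.sort (· ≥ ·)

/-- `λ(R) = max {|λ₂|, |λₙ|}`. The list positions start at `0`; the default value `0` is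
irrelevant for `n ≥ 2`. -/
def lam : ℝ := max |R.eigenvalues.getD 1 0| |R.eigenvalues.getD (n - 1) 0|

/-- The rate attached to an unordered pair. -/
def pairRate : Sym2 (Fin n) → ℝ := Sym2.lift ⟨fun u v => R.rate u v, R.symm⟩

end RateMatrix

/-- The sequence `R = (R_n)` of rate matrices satisfies the conditions of the class `RM` with
constants `α, γ, b` and scale `d = d(n)`. As these are asymptotic conditions, they are only
required for all sufficiently large `n`. -/
structure IsRM (R : (n : ℕ) → RateMatrix n) (α γ b : ℝ) (d : ℕ → ℝ) : Prop where
  alpha_nonneg : 0 ≤ α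
  alpha_lt : α < 1 / 2
  gamma_pos : 0 < γ
  b_pos : 0 < b
  d_pos : ∀ᶠ n in atTop, 0 < d n
  lam_tendsto : Tendsto (fun n => (R n).lam) atTop (𝓝 0)
  lam_le : ∀ᶠ n : ℕ in atTop,
    (R n).lam ≤ ((n : ℝ) * maxEntry (R n).transition) ^ (-α - γ)
  le_deg : ∀ᶠ n in atTop, ∀ u, d n ≤ (R n).deg u
  total_le : ∀ᶠ n : ℕ in atTop, (R n).total ≤ b * d n * n
  stationary_le : ∀ᶠ n : ℕ in atTop, ∀ A : Finset (Fin n),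
    (R n).stationary A ≤ b * ((A.card : ℝ) / n) ^ (1 - 2 * α)
  entry_le : ∀ᶠ n : ℕ in atTop, maxEntry (R n).rate ≤ d n * (n : ℝ) ^ (-γ)

/-- The class `RM` of sequences of rate matrices. -/
def RM (R : (n : ℕ) → RateMatrix n) : Prop :=
  ∃ (α γ b : ℝ) (d : ℕ → ℝ), IsRM R α γ b d

/-- The law of a clock of rate `r`: the exponential distribution of rate `r` if `r > 0`, and the
constant `∞` if `r = 0`. -/
def clockLaw (r : ℝ) : Measure ℝ≥0∞ :=
  if 0 < r then (expMeasure r).map ENNReal.ofReal else Measure.dirac ⊤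

instance (r : ℝ) : IsProbabilityMeasure (clockLaw r) := by
  unfold clockLaw
  split_ifs with h
  · have := isProbabilityMeasure_expMeasure h
    exact Measure.isProbabilityMeasure_map ENNReal.measurable_ofReal.aemeasurable
  · infer_instance

/-- An assignment of times `E(u,v) = E(v,u) ∈ [0,∞]` to the unordered pairs. The value at a
diagonal pair is never used. -/
abbrev Clocks (n : ℕ) := Sym2 (Fin n) → ℝ≥0∞

/-- The joint law of the clocks: independent, with `E(u,v)` exponential of rate `R(u,v)`. -/
def clocksLaw {n : ℕ} (R : RateMatrix n) : Measure (Clocks n) :=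
  Measure.pi fun e => clockLaw (R.pairRate e)

instance {n : ℕ} (R : RateMatrix n) : IsProbabilityMeasure (clocksLaw R) := by
  unfold clocksLaw
  infer_instance

/-- The number of neighbours of `u` in `G`. -/
def degree {n : ℕ} (G : SimpleGraph (Fin n)) (u : Fin n) : ℕ := (G.neighborSet u).ncard

/-- The graph `G_{n,R}(t)` with the edges `{u,v}` such that `E(u,v) ≤ t`. For `t = ∞` it has the
edges with `E(u,v) < ∞`. -/
def processGraph {n : ℕ} (E : Clocks n) (t : ℝ≥0∞) : SimpleGraph (Fin n) where
  Adj u v := u ≠ v ∧ E s(u, v) ≤ t ∧ E s(u, v) < ⊤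
  symm := ⟨fun u v h => ⟨h.1.symm, by simpa only [Sym2.eq_swap] using h.2⟩⟩
  loopless := ⟨fun _ h => h.1 rfl⟩

/-- `T_D(u)`: the time at which `u` attains degree `D` (`∞` if this never happens). -/
def degreeTime {n : ℕ} (E : Clocks n) (D : ℕ) (u : Fin n) : ℝ≥0∞ :=
  sInf {t | 0 < t ∧ D ≤ degree (processGraph E t) u}

/-- `τ_k`: the time at which the minimum degree becomes at least `k`. -/
def minDegreeTime {n : ℕ} (E : Clocks n) (k : ℕ) : ℝ≥0∞ :=
  sInf {t | 0 < t ∧ ∀ u, k ≤ degree (processGraph E t) u}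

/-- `H(t)`: the edges `{u,v}` of `G_{n,R}(t)` with `E(u,v) ≤ max {T_D(u), T_D(v)}`. -/
def sparseGraphAt {n : ℕ} (E : Clocks n) (D : ℕ) (t : ℝ≥0∞) : SimpleGraph (Fin n) where
  Adj u v := (processGraph E t).Adj u v ∧
    E s(u, v) ≤ max (degreeTime E D u) (degreeTime E D v)
  symm := ⟨fun u v h => ⟨h.1.symm, by
    rw [Sym2.eq_swap, max_comm]
    exact h.2⟩⟩
  loopless := ⟨fun _ h => h.1.1 rfl⟩

/-- `H = H(τ_k)`. -/
def sparseGraph {n : ℕ} (E : Clocks n) (D k : ℕ) : SimpleGraph (Fin n) :=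
  sparseGraphAt E D (minDegreeTime E k)

/-- `N_G(A)`: the vertices outside `A` with a neighbour in `A`. -/
def nbhd {n : ℕ} (G : SimpleGraph (Fin n)) (A : Set (Fin n)) : Set (Fin n) :=
  {u | u ∉ A ∧ ∃ v ∈ A, G.Adj u v}

/-- The closed neighbourhood `A ∪ N_G(A)`. -/
def closedNbhd {n : ℕ} (G : SimpleGraph (Fin n)) (A : Set (Fin n)) : Set (Fin n) :=
  A ∪ nbhd G A

/-- `S_θ`: the vertices `u` with `d_G(u) ≥ θ` or `d_R(u) ≥ θ d`. -/
def highDegree {n : ℕ} (R : RateMatrix n) (d θ : ℝ) (G : SimpleGraph (Fin n)) : Set (Fin n) :=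
  {u | θ ≤ degree G u ∨ θ * d ≤ R.deg u}

/-- A property of the clocks holds with high probability: the probability that it fails tends to
`0` as `n → ∞`. -/
def Whp (R : (n : ℕ) → RateMatrix n) (p : (n : ℕ) → Clocks n → Prop) : Prop :=
  Tendsto (fun n => clocksLaw (R n) {E | ¬ p n E}) atTop (𝓝 0)

end

end RateProcess

/-! Both statements rest on one consequence of the spectral condition, `exists_card_exceptional_le`:
if `x = |W|/n` is small, then at most `x^δ |W|` vertices `u` have `M(u,W) > x^δ`. For very small `W`
the trivial bound `M(u,W) ≤ |W|‖M‖` leaves no such vertex. Otherwise the variance form of the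
expander mixing lemma applies: `λ(R)² ≤ x^(2α+γ)` and `σ(W) ≤ b x^(1-2α)` multiply to `b x^(1+γ)`,
so that `α` cancels and a power of `x` is gained.

Expansion. Call a vertex small if its degree at `τ_k` is below `D`, and large otherwise. Choose a
deterministic time `t` with `∑ exp(-t d_R(u)) = n^ε`. By the second moment method some vertex is
still isolated at `t`, so whp `t ≤ τ_k ≤ t₁ = 2 log n / d`. The vertices of degree below `D` at time
`t` have total expected weight `n^(2ε)` up to logarithms, while a prescribed edge appears before
`t₁` with probability at most `n^(-γ)` up to logarithms. First moments then show that small vertices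
are not adjacent, have no common neighbours, and that no large vertex reaches `c` of them by
disjoint paths of length two (`exists_times_smallBad`). A large vertex `u` normally has `D` edges by
a time of order `log(n/|W|) / d_R(u)`, and unless `u` is exceptional for `W`, few of them end in
`W`. The failure probability is so large a power of `|W|/n` that it beats the number of choices of
sets (`exists_tendsto_largeBad`). The two are combined in `mul_card_le_ncard_nbhd`. If `|N(A)| <
k|A|`, remove from `N(A)` the disjoint stars of `k` neighbours at the small vertices of `A`. The
rest of `N(A)` and the set `L` of large vertices of `A` form a set `W` with `|W| ≤ (k+2)|L|`. The
early edges of a suitable vertex of `L` all end in small vertices of `A`, in the stars or in `W`,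
and these have room for fewer than `D₂ + 1 + k c` of them.

Light tail. Each vertex chooses its first `D` edges, so `H` has at most `Dn` edges, `S_θ` has
`O(n/θ)` vertices, and it chooses at most `D|S_θ|` neighbours. Any other neighbour `v` chose a
vertex of `S_θ` itself. Up to a few late vertices, `v` makes its choices by time `T / d_R(v)`, and
up to a few exceptional vertices it is unlikely to hit `S_θ` by then. As `S_θ` depends on the
clocks, the number of hits is bounded for all `2^n` sets at once, each failing with probability at
most `2 exp(-n)`. -/

namespace RateProcess

/-! ### The law of a single clock. -/

lemma clockLaw_Iic {r t : ℝ} (hr : 0 ≤ r) (ht : 0 ≤ t) :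
    clockLaw r (Set.Iic (ENNReal.ofReal t)) = ENNReal.ofReal (1 - Real.exp (-(r * t))) := by
  unfold clockLaw
  split_ifs with h
  · have := isProbabilityMeasure_expMeasure h
    rw [Measure.map_apply ENNReal.measurable_ofReal measurableSet_Iic]
    have hpre : ENNReal.ofReal ⁻¹' Set.Iic (ENNReal.ofReal t) = Set.Iic t := by
      ext x
      simp [ENNReal.ofReal_le_ofReal_iff ht]
    rw [hpre, ← ofReal_cdf, cdf_expMeasure_eq h, if_pos ht]
  · have : r = 0 := le_antisymm (not_lt.1 h) hr
    simp [this]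

/-- Only `⊤` can be an atom; this is what excludes ties between finite clocks. -/
lemma clockLaw_singleton (r : ℝ) {x : ℝ≥0∞} (hx : x ≠ ⊤) : clockLaw r {x} = 0 := by
  unfold clockLaw
  split_ifs with h
  · have := isProbabilityMeasure_expMeasure h
    rw [Measure.map_apply ENNReal.measurable_ofReal (measurableSet_singleton x)]
    have hpos : expMeasure r (Set.Iic 0) = 0 := by
      rw [← ofReal_cdf, cdf_expMeasure_eq h]
      simp
    have hna : ∀ y : ℝ, expMeasure r {y} = 0 := by
      intro y
      have hac : expMeasure r ≪ volume := by
        unfold expMeasure gammaMeasure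
        exact withDensity_absolutelyContinuous _ _
      exact hac (by simp)
    -- `ENNReal.ofReal` collapses all nonpositive reals to `0`, so the preimage of a point need not
    -- be a point; the extra half-line is null.
    refine measure_mono_null (t := Set.Iic 0 ∪ {x.toReal}) ?_ (measure_union_null hpos (hna _))
    intro y hy
    simp only [Set.mem_preimage, Set.mem_singleton_iff] at hy
    rcases le_or_gt y 0 with h0 | h0
    · exact Or.inl h0
    · right
      simp [← hy, ENNReal.toReal_ofReal h0.le]
  · simp [hx.symm]

/-! ### Product functionals of the clocks and Chernoff bounds. -/

section Clocks

variable {n : ℕ} (R : RateMatrix n)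

lemma iIndepFun_clocks : iIndepFun (fun (e : Sym2 (Fin n)) (E : Clocks n) => E e) (clocksLaw R) := by
  unfold clocksLaw
  exact iIndepFun_pi (X := fun _ x => x) fun _ => aemeasurable_id

lemma map_clocks (e : Sym2 (Fin n)) :
    (clocksLaw R).map (fun E => E e) = clockLaw (R.pairRate e) :=
  (measurePreserving_eval (fun e => clockLaw (R.pairRate e)) e).map_eq

/-- The pairs are ordered while clocks belong to unordered pairs. Injectivity into `Sym2` makes the
clocks distinct, hence independent. -/
lemma lintegral_prod_pairs {P : Finset (Fin n × Fin n)}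
    (hP : Set.InjOn (fun p : Fin n × Fin n => s(p.1, p.2)) P)
    (g : Fin n × Fin n → ℝ≥0∞ → ℝ≥0∞) (hg : ∀ p, Measurable (g p)) :
    ∫⁻ E, ∏ p ∈ P, g p (E s(p.1, p.2)) ∂clocksLaw R
      = ∏ p ∈ P, ∫⁻ x, g p x ∂clockLaw (R.rate p.1 p.2) := by
  have hinj : Function.Injective (fun p : P => s(p.1.1, p.1.2)) := by
    intro p q h
    exact Subtype.ext (hP p.2 q.2 h)
  have hind := ((iIndepFun_clocks R).precomp hinj).comp (fun p : P => g p.1) fun p => hg p.1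
  have := lintegral_prod_eq_prod_lintegral_of_indepFun (μ := clocksLaw R) Finset.univ _ hind
    fun p => (hg p.1).comp (measurable_pi_apply _)
  simp only [Function.comp_def] at this
  rw [Finset.univ_eq_attach] at this
  calc _ = ∫⁻ E, ∏ p ∈ P.attach, g p (E s(p.1.1, p.1.2)) ∂clocksLaw R := by
        congr 1; ext E
        exact (Finset.prod_attach P fun p => g p (E s(p.1, p.2))).symm
    _ = _ := this
    _ = ∏ p ∈ P.attach, ∫⁻ x, g p x ∂clockLaw (R.rate p.1.1 p.1.2) := by
        refine Finset.prod_congr rfl fun p _ => ?_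
        rw [← lintegral_map (hg p.1) (measurable_pi_apply _), map_clocks]
        rfl
    _ = _ := Finset.prod_attach P fun p => ∫⁻ x, g p x ∂clockLaw (R.rate p.1 p.2)

lemma lintegral_two_valued {r t a b : ℝ} (hr : 0 ≤ r) (ht : 0 ≤ t) (ha : 0 ≤ a) (hb : 0 ≤ b) :
    ∫⁻ x, (if x ≤ ENNReal.ofReal t then ENNReal.ofReal a else ENNReal.ofReal b) ∂clockLaw r
      = ENNReal.ofReal (a * (1 - Real.exp (-(r * t))) + b * Real.exp (-(r * t))) := by
  have hm : MeasurableSet (Set.Iic (ENNReal.ofReal t)) := measurableSet_Iic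
  have he : Real.exp (-(r * t)) ≤ 1 := by
    rw [Real.exp_le_one_iff]; have := mul_nonneg hr ht; linarith
  have hf : (fun x : ℝ≥0∞ => if x ≤ ENNReal.ofReal t then ENNReal.ofReal a else ENNReal.ofReal b)
      = fun x => (Set.Iic (ENNReal.ofReal t)).indicator (fun _ => ENNReal.ofReal a) x
        + (Set.Iic (ENNReal.ofReal t))ᶜ.indicator (fun _ => ENNReal.ofReal b) x := by
    ext x
    by_cases h : x ≤ ENNReal.ofReal t <;> simp [Set.indicator, h, not_lt.2, not_le.1]
  rw [hf, lintegral_add_left (measurable_const.indicator hm), lintegral_indicator_const hm,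
    lintegral_indicator_const hm.compl, prob_compl_eq_one_sub hm, clockLaw_Iic hr ht,
    ← ENNReal.ofReal_one, ← ENNReal.ofReal_sub _ (by linarith), ← ENNReal.ofReal_mul ha,
    ← ENNReal.ofReal_mul hb, ← ENNReal.ofReal_add]
  · congr 1; ring
  · exact mul_nonneg ha (by linarith)
  · exact mul_nonneg hb (by linarith [Real.exp_pos (-(r * t))])

lemma lintegral_prod_two_valued {P : Finset (Fin n × Fin n)}
    (hP : Set.InjOn (fun p : Fin n × Fin n => s(p.1, p.2)) P)
    {t a b : Fin n × Fin n → ℝ} (ht : ∀ p, 0 ≤ t p) (ha : ∀ p, 0 ≤ a p) (hb : ∀ p, 0 ≤ b p) :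
    ∫⁻ E, ENNReal.ofReal (∏ p ∈ P, if E s(p.1, p.2) ≤ ENNReal.ofReal (t p) then a p else b p)
        ∂clocksLaw R
      = ENNReal.ofReal (∏ p ∈ P, (a p * (1 - Real.exp (-(R.rate p.1 p.2 * t p)))
          + b p * Real.exp (-(R.rate p.1 p.2 * t p)))) := by
  have h1 : ∀ p, 0 ≤ a p * (1 - Real.exp (-(R.rate p.1 p.2 * t p)))
          + b p * Real.exp (-(R.rate p.1 p.2 * t p)) := by
    intro p
    have : Real.exp (-(R.rate p.1 p.2 * t p)) ≤ 1 := by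
      rw [Real.exp_le_one_iff]; have := mul_nonneg (R.nonneg p.1 p.2) (ht p); linarith
    have := mul_nonneg (ha p) (sub_nonneg.2 this)
    have := mul_nonneg (hb p) (Real.exp_pos (-(R.rate p.1 p.2 * t p))).le
    linarith
  rw [ENNReal.ofReal_prod_of_nonneg fun p _ => h1 p]
  have h2 := lintegral_prod_pairs R hP
    (fun p x => if x ≤ ENNReal.ofReal (t p) then ENNReal.ofReal (a p) else ENNReal.ofReal (b p))
    (fun p => Measurable.ite measurableSet_Iic measurable_const measurable_const)
  simp_rw [lintegral_two_valued (R.nonneg _ _) (ht _) (ha _) (hb _)] at h2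
  rw [← h2]
  congr 1; ext E
  rw [ENNReal.ofReal_prod_of_nonneg]
  · refine Finset.prod_congr rfl fun p _ => ?_
    split_ifs <;> rfl
  · intro p _
    split_ifs
    exacts [ha p, hb p]

/-- The exponential Markov inequality for functionals that are products over distinct pairs. -/
lemma measureReal_le_prod {P : Finset (Fin n × Fin n)}
    (hP : Set.InjOn (fun p : Fin n × Fin n => s(p.1, p.2)) P)
    {t a b : Fin n × Fin n → ℝ} (ht : ∀ p, 0 ≤ t p) (ha : ∀ p, 0 ≤ a p) (hb : ∀ p, 0 ≤ b p)
    {c : ℝ} (hc : 0 ≤ c) {A : Set (Clocks n)}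
    (hA : ∀ E ∈ A, 1 ≤ c * ∏ p ∈ P,
      if E s(p.1, p.2) ≤ ENNReal.ofReal (t p) then a p else b p) :
    (clocksLaw R).real A ≤ c * ∏ p ∈ P, (a p * (1 - Real.exp (-(R.rate p.1 p.2 * t p)))
          + b p * Real.exp (-(R.rate p.1 p.2 * t p))) := by
  have hnn : 0 ≤ c * ∏ p ∈ P, (a p * (1 - Real.exp (-(R.rate p.1 p.2 * t p)))
          + b p * Real.exp (-(R.rate p.1 p.2 * t p))) := by
    refine mul_nonneg hc (Finset.prod_nonneg fun p _ => ?_)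
    have : Real.exp (-(R.rate p.1 p.2 * t p)) ≤ 1 := by
      rw [Real.exp_le_one_iff]; have := mul_nonneg (R.nonneg p.1 p.2) (ht p); linarith
    have := mul_nonneg (ha p) (sub_nonneg.2 this)
    have := mul_nonneg (hb p) (Real.exp_pos (-(R.rate p.1 p.2 * t p))).le
    linarith
  have hmeas : Measurable fun E : Clocks n => ENNReal.ofReal (c * ∏ p ∈ P,
      if E s(p.1, p.2) ≤ ENNReal.ofReal (t p) then a p else b p) := by
    refine ENNReal.measurable_ofReal.comp (Measurable.const_mul ?_ _)
    refine Finset.measurable_prod _ fun p _ => ?_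
    exact Measurable.ite (measurableSet_Iic.preimage (measurable_pi_apply _))
      measurable_const measurable_const
  refine ENNReal.toReal_le_of_le_ofReal hnn ?_
  calc clocksLaw R A ≤ ∫⁻ E, ENNReal.ofReal (c * ∏ p ∈ P,
        if E s(p.1, p.2) ≤ ENNReal.ofReal (t p) then a p else b p) ∂clocksLaw R := by
        refine meas_le_lintegral₀ hmeas.aemeasurable fun E hE => ?_
        rw [← ENNReal.ofReal_one]
        exact ENNReal.ofReal_le_ofReal (hA E hE)
    _ = _ := by
        simp_rw [ENNReal.ofReal_mul hc]
        rw [lintegral_const_mul' _ _ ENNReal.ofReal_ne_top, lintegral_prod_two_valued R hP ht ha hb]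

lemma measureReal_forall_lt {P : Finset (Fin n × Fin n)}
    (hP : Set.InjOn (fun p : Fin n × Fin n => s(p.1, p.2)) P) {t : ℝ} (ht : 0 ≤ t) :
    (clocksLaw R).real {E | ∀ p ∈ P, ENNReal.ofReal t < E s(p.1, p.2)}
      = Real.exp (-(t * ∑ p ∈ P, R.rate p.1 p.2)) := by
  have h := lintegral_prod_two_valued R hP (t := fun _ => t) (a := fun _ => 0) (b := fun _ => 1)
    (fun _ => ht) (fun _ => le_rfl) (fun _ => zero_le_one)
  have hm : MeasurableSet {E : Clocks n | ∀ p ∈ P, ENNReal.ofReal t < E s(p.1, p.2)} := by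
    simp only [Set.ofPred_forall]
    exact Finset.measurableSet_biInter _ fun p _ =>
      measurableSet_Ioi.preimage (measurable_pi_apply (s(p.1, p.2)))
  have hind : (fun E : Clocks n => ENNReal.ofReal (∏ p ∈ P,
      if E s(p.1, p.2) ≤ ENNReal.ofReal t then (0 : ℝ) else 1))
      = {E : Clocks n | ∀ p ∈ P, ENNReal.ofReal t < E s(p.1, p.2)}.indicator fun _ => 1 := by
    ext E
    by_cases hE : ∀ p ∈ P, ENNReal.ofReal t < E s(p.1, p.2)
    · rw [Set.indicator_of_mem (by exact hE), Finset.prod_eq_one, ENNReal.ofReal_one]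
      intro p hp
      rw [if_neg (not_le.2 (hE p hp))]
    · rw [Set.indicator_of_notMem (by exact hE)]
      push Not at hE
      obtain ⟨p, hp, hpE⟩ := hE
      rw [Finset.prod_eq_zero (i := p) hp (by rw [if_pos hpE]), ENNReal.ofReal_zero]
  rw [hind, lintegral_indicator_const hm, one_mul] at h
  rw [Measure.real, h, ENNReal.toReal_ofReal]
  · simp only [zero_mul, one_mul, zero_add]
    rw [← Real.exp_sum, Finset.sum_neg_distrib, ← Finset.sum_mul, mul_comm]
  · exact Finset.prod_nonneg fun p _ => by simp [Real.exp_nonneg]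

/-- Weight `z` for each clock that rang: the factor of a pair with `y = R t` is `z(1 - e^(-y)) +
e^(-y) ≤ 1 + z y ≤ e^(z y)`. -/
lemma measureReal_count_ge {P : Finset (Fin n × Fin n)}
    (hP : Set.InjOn (fun p : Fin n × Fin n => s(p.1, p.2)) P) {t : Fin n × Fin n → ℝ}
    (ht : ∀ p, 0 ≤ t p) {z : ℝ} (hz : 1 ≤ z) (m : ℝ) :
    (clocksLaw R).real
        {E | m ≤ ((P.filter fun p => E s(p.1, p.2) ≤ ENNReal.ofReal (t p)).card : ℝ)}
      ≤ z ^ (-m) * Real.exp (z * ∑ p ∈ P, R.rate p.1 p.2 * t p) := by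
  have hz0 : 0 < z := by linarith
  refine (measureReal_le_prod R hP ht (a := fun _ => z) (b := fun _ => 1) (fun _ => hz0.le)
    (fun _ => zero_le_one) (c := z ^ (-m)) (by positivity) ?_).trans ?_
  · intro E hE
    rw [Finset.prod_ite, Finset.prod_const, Finset.prod_const_one, mul_one, ← Real.rpow_natCast,
      ← Real.rpow_add hz0]
    refine Real.one_le_rpow hz ?_
    have : m ≤ _ := hE
    linarith
  · refine mul_le_mul_of_nonneg_left ?_ (by positivity)
    rw [Finset.mul_sum, Real.exp_sum]
    refine Finset.prod_le_prod (fun p _ => ?_) fun p _ => ?_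
    · have : Real.exp (-(R.rate p.1 p.2 * t p)) ≤ 1 := by
        rw [Real.exp_le_one_iff]; have := mul_nonneg (R.nonneg p.1 p.2) (ht p); linarith
      have := mul_nonneg hz0.le (sub_nonneg.2 this)
      have := (Real.exp_pos (-(R.rate p.1 p.2 * t p))).le
      linarith
    · set y := R.rate p.1 p.2 * t p
      have hy : 0 ≤ y := mul_nonneg (R.nonneg _ _) (ht p)
      have h1 : 1 - y ≤ Real.exp (-y) := by have := Real.add_one_le_exp (-y); linarith
      have h2 := Real.add_one_le_exp (z * y)
      have h3 : Real.exp (-y) ≤ 1 := by rw [Real.exp_le_one_iff]; linarith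
      nlinarith

lemma injOn_mk_of_lt {P : Finset (Fin n × Fin n)} (h : ∀ p ∈ P, p.1 < p.2) :
    Set.InjOn (fun p : Fin n × Fin n => s(p.1, p.2)) P := by
  rintro ⟨a, b⟩ hp ⟨c, e⟩ hq hpq
  have h1 := h _ hp
  have h2 := h _ hq
  simp only [Sym2.eq_iff] at hpq
  rcases hpq with ⟨rfl, rfl⟩ | ⟨rfl, rfl⟩
  · rfl
  · exact absurd h1 (not_lt.2 h2.le)

lemma injOn_mk_of_gt {P : Finset (Fin n × Fin n)} (h : ∀ p ∈ P, p.2 < p.1) :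
    Set.InjOn (fun p : Fin n × Fin n => s(p.1, p.2)) P := by
  rintro ⟨a, b⟩ hp ⟨c, e⟩ hq hpq
  have h1 := h _ hp
  have h2 := h _ hq
  simp only [Sym2.eq_iff] at hpq
  rcases hpq with ⟨rfl, rfl⟩ | ⟨rfl, rfl⟩
  · rfl
  · exact absurd h1 (not_lt.2 h2.le)

/-- The number of vertices `v ≠ u` of `W` with `E(u,v) ≤ t`. -/
noncomputable def hits (E : Clocks n) (W : Finset (Fin n)) (t : ℝ) (u : Fin n) : ℕ :=
  (W.filter fun v => v ≠ u ∧ E s(u, v) ≤ ENNReal.ofReal t).card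

/-- Chernoff bound for the total number of hits. Pairs inside `L ∩ W` may be counted twice. -/
lemma measureReal_sum_hits_ge (L W : Finset (Fin n)) {t : Fin n → ℝ} (ht : ∀ u, 0 ≤ t u)
    {z : ℝ} (hz : 1 ≤ z) (m : ℝ) :
    (clocksLaw R).real {E | m ≤ ∑ u ∈ L, (hits E W (t u) u : ℝ)}
      ≤ 2 * (z ^ (-(m / 2)) * Real.exp (z * ∑ u ∈ L, ∑ v ∈ W, R.rate u v * t u)) := by
  classical
  -- Pairs inside `L ∩ W` occur in both orders and share a clock. Each of the two halves uses every
  -- clock at most once; the price is `m / 2` and the factor `2`.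
  set P₁ := (L ×ˢ W).filter fun p => p.1 < p.2 with hP₁
  set P₂ := (L ×ˢ W).filter fun p => p.2 < p.1 with hP₂
  have hP₁i := injOn_mk_of_lt (P := P₁) fun p hp => (Finset.mem_filter.1 hp).2
  have hP₂i := injOn_mk_of_gt (P := P₂) fun p hp => (Finset.mem_filter.1 hp).2
  have hsum : ∀ P : Finset (Fin n × Fin n), P ⊆ L ×ˢ W →
      ∑ p ∈ P, R.rate p.1 p.2 * t p.1 ≤ ∑ u ∈ L, ∑ v ∈ W, R.rate u v * t u := by
    intro P hP
    rw [← Finset.sum_product']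
    exact Finset.sum_le_sum_of_subset_of_nonneg hP fun p _ _ =>
      mul_nonneg (R.nonneg _ _) (ht _)
  have hb : ∀ P : Finset (Fin n × Fin n), P ⊆ L ×ˢ W →
      Set.InjOn (fun p : Fin n × Fin n => s(p.1, p.2)) P →
      (clocksLaw R).real {E | m / 2 ≤
          ((P.filter fun p => E s(p.1, p.2) ≤ ENNReal.ofReal (t p.1)).card : ℝ)}
        ≤ z ^ (-(m / 2)) * Real.exp (z * ∑ u ∈ L, ∑ v ∈ W, R.rate u v * t u) := by
    intro P hP hPi
    refine (measureReal_count_ge R hPi (t := fun p => t p.1) (fun p => ht _) hz (m / 2)).trans ?_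
    have := hsum P hP
    gcongr
  have hsub : {E : Clocks n | m ≤ ∑ u ∈ L, (hits E W (t u) u : ℝ)} ⊆
      {E | m / 2 ≤ ((P₁.filter fun p => E s(p.1, p.2) ≤ ENNReal.ofReal (t p.1)).card : ℝ)} ∪
      {E | m / 2 ≤ ((P₂.filter fun p => E s(p.1, p.2) ≤ ENNReal.ofReal (t p.1)).card : ℝ)} := by
    intro E hE
    simp only [Set.mem_ofPred_eq, Set.mem_union] at hE ⊢
    have hcount : ∑ u ∈ L, hits E W (t u) u
        = (P₁.filter fun p => E s(p.1, p.2) ≤ ENNReal.ofReal (t p.1)).card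
          + (P₂.filter fun p => E s(p.1, p.2) ≤ ENNReal.ofReal (t p.1)).card := by
      simp only [hits, hP₁, hP₂, Finset.card_filter, Finset.sum_filter, Finset.sum_product]
      rw [← Finset.sum_add_distrib]
      refine Finset.sum_congr rfl fun u _ => ?_
      rw [← Finset.sum_add_distrib]
      refine Finset.sum_congr rfl fun v _ => ?_
      rcases lt_trichotomy u v with h | h | h
      · simp [h, h.ne', not_lt.2 h.le]
      · simp [h]
      · simp [h, h.ne, not_lt.2 h.le]
    have hcount' : ∑ u ∈ L, (hits E W (t u) u : ℝ)
        = ((P₁.filter fun p => E s(p.1, p.2) ≤ ENNReal.ofReal (t p.1)).card : ℝ)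
          + ((P₂.filter fun p => E s(p.1, p.2) ≤ ENNReal.ofReal (t p.1)).card : ℝ) := by
      exact_mod_cast hcount
    by_contra! h
    linarith [h.1, h.2]
  refine (measureReal_mono hsub).trans ((measureReal_union_le _ _).trans ?_)
  have h1 := hb P₁ (Finset.filter_subset _ _) hP₁i
  have h2 := hb P₂ (Finset.filter_subset _ _) hP₂i
  linarith

lemma hits_le_degree (E : Clocks n) (W : Finset (Fin n)) (t : ℝ) (u : Fin n) :
    hits E W t u ≤ degree (processGraph E (ENNReal.ofReal t)) u := by
  unfold hits degree
  rw [← Set.ncard_coe_finset]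
  refine Set.ncard_le_ncard ?_ (Set.toFinite _)
  intro v hv
  simp only [Finset.coe_filter, Set.mem_ofPred_eq] at hv
  exact ⟨hv.2.1.symm, hv.2.2, hv.2.2.trans_lt ENNReal.ofReal_lt_top⟩

/-- Joint probability that prescribed pairs inside `X` are present and that prescribed vertices
have few neighbours, estimated with the pairs leaving `X`. -/
lemma measureReal_joint_le {X S : Finset (Fin n)} (hS : S ⊆ X) {J : Finset (Fin n × Fin n)}
    (hJX : ∀ p ∈ J, p.1 ∈ X ∧ p.2 ∈ X)
    (hJ : Set.InjOn (fun p : Fin n × Fin n => s(p.1, p.2)) J)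
    {t₁ : ℝ} (ht₁ : 0 ≤ t₁) {t z : Fin n → ℝ} (ht : ∀ u, 0 ≤ t u)
    (hty : ∀ u ∈ S, ∀ v, R.rate u v * t u ≤ 1) (hz : ∀ u ∈ S, 1 ≤ z u) (m : ℕ) :
    (clocksLaw R).real {E | (∀ p ∈ J, E s(p.1, p.2) ≤ ENNReal.ofReal t₁) ∧
        ∀ u ∈ S, degree (processGraph E (ENNReal.ofReal (t u))) u < m}
      ≤ (∏ p ∈ J, R.rate p.1 p.2 * t₁) *
        ∏ u ∈ S, (z u ^ m * Real.exp (-((1 - 2 / z u) * ∑ v ∈ Xᶜ, R.rate u v * t u))) := by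
  classical
  set P := J ∪ S ×ˢ Xᶜ with hPdef
  have hdisj : Disjoint J (S ×ˢ Xᶜ) := by
    rw [Finset.disjoint_left]
    intro p hp hp'
    rw [Finset.mem_product, Finset.mem_compl] at hp'
    exact hp'.2 (hJX p hp).2
  have hPi : Set.InjOn (fun p : Fin n × Fin n => s(p.1, p.2)) P := by
    rintro ⟨a, b⟩ hp ⟨c, e⟩ hq hpq
    simp only [hPdef, Finset.coe_union, Set.mem_union, Finset.mem_coe, Finset.mem_product,
      Finset.mem_compl] at hp hq
    rcases hp with hp | hp <;> rcases hq with hq | hq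
    · exact hJ hp hq hpq
    · simp only [Sym2.eq_iff] at hpq
      have := hJX _ hp
      rcases hpq with ⟨rfl, rfl⟩ | ⟨rfl, rfl⟩
      · exact absurd this.2 hq.2
      · exact absurd this.1 hq.2
    · simp only [Sym2.eq_iff] at hpq
      have := hJX _ hq
      rcases hpq with ⟨rfl, rfl⟩ | ⟨rfl, rfl⟩
      · exact absurd this.2 hp.2
      · exact absurd this.1 hp.2
    · simp only [Sym2.eq_iff] at hpq
      rcases hpq with ⟨rfl, rfl⟩ | ⟨rfl, rfl⟩
      · rfl
      · exact absurd (hS hq.1) hp.2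
  -- The Markov inequality wants nonnegative weights at all pairs, while `z` is controlled only on
  -- `S`.
  set z' : Fin n → ℝ := fun u => max 1 (z u) with hz'
  have hz'1 : ∀ u, 1 ≤ z' u := fun u => le_max_left _ _
  have hz'p : ∀ u, 0 < z' u := fun u => by linarith [hz'1 u]
  have hz'z : ∀ u ∈ S, z' u = z u := fun u hu => max_eq_right (hz u hu)
  -- Weight `0` for an absent pair of `J`, and `1 / z u` for each edge from `u ∈ S` out of `X`. On
  -- the event there are fewer than `m` such edges, which `z u ^ m` compensates.
  have key := measureReal_le_prod R hPi (t := fun p => if p ∈ J then t₁ else t p.1)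
    (a := fun p => if p ∈ J then 1 else (z' p.1)⁻¹) (b := fun p => if p ∈ J then 0 else 1)
    (fun p => by split_ifs; exacts [ht₁, ht _])
    (fun p => by split_ifs; exacts [zero_le_one, (inv_pos.2 (hz'p _)).le])
    (fun p => by split_ifs; exacts [le_rfl, zero_le_one])
    (c := ∏ u ∈ S, z u ^ m)
    (Finset.prod_nonneg fun u hu => pow_nonneg (by linarith [hz u hu]) _)
    (A := {E | (∀ p ∈ J, E s(p.1, p.2) ≤ ENNReal.ofReal t₁) ∧
        ∀ u ∈ S, degree (processGraph E (ENNReal.ofReal (t u))) u < m}) ?_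
  · refine key.trans ?_
    rw [hPdef, Finset.prod_union hdisj]
    have hJle : ∏ p ∈ J, ((if p ∈ J then (1 : ℝ) else (z' p.1)⁻¹) *
          (1 - Real.exp (-(R.rate p.1 p.2 * if p ∈ J then t₁ else t p.1)))
          + (if p ∈ J then 0 else 1) *
            Real.exp (-(R.rate p.1 p.2 * if p ∈ J then t₁ else t p.1)))
        ≤ ∏ p ∈ J, R.rate p.1 p.2 * t₁ := by
      refine Finset.prod_le_prod (fun p hp => ?_) fun p hp => ?_
      · simp only [hp, if_true, one_mul, zero_mul, add_zero, sub_nonneg, Real.exp_le_one_iff]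
        have := mul_nonneg (R.nonneg p.1 p.2) ht₁
        linarith
      · simp only [hp, if_true, one_mul, zero_mul, add_zero]
        have := Real.add_one_le_exp (-(R.rate p.1 p.2 * t₁))
        linarith
    have hSle : ∏ p ∈ S ×ˢ Xᶜ, ((if p ∈ J then (1 : ℝ) else (z' p.1)⁻¹) *
          (1 - Real.exp (-(R.rate p.1 p.2 * if p ∈ J then t₁ else t p.1)))
          + (if p ∈ J then 0 else 1) *
            Real.exp (-(R.rate p.1 p.2 * if p ∈ J then t₁ else t p.1)))
        ≤ ∏ u ∈ S, Real.exp (-((1 - 2 / z u) * ∑ v ∈ Xᶜ, R.rate u v * t u)) := by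
      rw [Finset.prod_product]
      refine Finset.prod_le_prod (fun u hu => Finset.prod_nonneg fun v hv => ?_) fun u hu => ?_
      · have hnJ : (u, v) ∉ J := fun h => Finset.disjoint_left.1 hdisj h
          (Finset.mem_product.2 ⟨hu, hv⟩)
        simp only [hnJ, if_false, one_mul]
        have h1 : Real.exp (-(R.rate u v * t u)) ≤ 1 := by
          rw [Real.exp_le_one_iff]; have := mul_nonneg (R.nonneg u v) (ht u); linarith
        have := mul_nonneg (inv_pos.2 (hz'p u)).le (sub_nonneg.2 h1)
        have := (Real.exp_pos (-(R.rate u v * t u))).le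
        linarith
      · rw [Finset.mul_sum, ← Finset.sum_neg_distrib, Real.exp_sum]
        refine Finset.prod_le_prod (fun v hv => ?_) fun v hv => ?_
        · have hnJ : (u, v) ∉ J := fun h => Finset.disjoint_left.1 hdisj h
            (Finset.mem_product.2 ⟨hu, hv⟩)
          simp only [hnJ, if_false, one_mul]
          have h1 : Real.exp (-(R.rate u v * t u)) ≤ 1 := by
            rw [Real.exp_le_one_iff]; have := mul_nonneg (R.nonneg u v) (ht u); linarith
          have := mul_nonneg (inv_pos.2 (hz'p u)).le (sub_nonneg.2 h1)
          have := (Real.exp_pos (-(R.rate u v * t u))).le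
          linarith
        · have hnJ : (u, v) ∉ J := fun h => Finset.disjoint_left.1 hdisj h
            (Finset.mem_product.2 ⟨hu, hv⟩)
          simp only [hnJ, if_false, one_mul]
          rw [hz'z u hu]
          have hzu := hz u hu
          set y := R.rate u v * t u with hy
          have hy0 : 0 ≤ y := mul_nonneg (R.nonneg _ _) (ht u)
          have hy1 : y ≤ 1 := hty u hu v
          -- With this, the factor of a pair is `e^(-y) (1 + (e^y - 1)/z) ≤ e^(-y) e^(2y/z)`; here
          -- `R t ≤ 1` is needed.
          have hexp : Real.exp y ≤ 1 + 2 * y := by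
            have h := Real.abs_exp_sub_one_sub_id_le (x := y) (by rwa [abs_of_nonneg hy0])
            have := (abs_le.1 h).2
            nlinarith
          have hsplit : Real.exp (-((1 - 2 / z u) * y)) = Real.exp (-y) * Real.exp (2 * y / z u) := by
            rw [← Real.exp_add]; congr 1; ring
          have h2 := Real.add_one_le_exp (2 * y / z u)
          have h3 : (z u)⁻¹ * (1 - Real.exp (-y)) + Real.exp (-y)
              = Real.exp (-y) * (1 + (Real.exp y - 1) / z u) := by
            have : Real.exp (-y) * Real.exp y = 1 := by rw [← Real.exp_add]; simp
            field_simp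
            linear_combination -this
          rw [h3, hsplit]
          refine mul_le_mul_of_nonneg_left (le_trans ?_ h2) (Real.exp_pos _).le
          have : (Real.exp y - 1) / z u ≤ 2 * y / z u := by
            gcongr; linarith
          linarith
    rw [Finset.prod_mul_distrib (s := S)]
    have hcz : 0 ≤ ∏ u ∈ S, z u ^ m :=
      Finset.prod_nonneg fun u hu => pow_nonneg (by linarith [hz u hu]) _
    have hJ0 : 0 ≤ ∏ p ∈ J, R.rate p.1 p.2 * t₁ :=
      Finset.prod_nonneg fun p _ => mul_nonneg (R.nonneg _ _) ht₁
    calc _ ≤ (∏ u ∈ S, z u ^ m) * ((∏ p ∈ J, R.rate p.1 p.2 * t₁) *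
          ∏ u ∈ S, Real.exp (-((1 - 2 / z u) * ∑ v ∈ Xᶜ, R.rate u v * t u))) := by
          refine mul_le_mul_of_nonneg_left (mul_le_mul hJle hSle ?_ hJ0) hcz
          refine Finset.prod_nonneg fun p hp => ?_
          have hnJ : p ∉ J := fun h => Finset.disjoint_left.1 hdisj h hp
          simp only [hnJ, if_false, one_mul]
          have h1 : Real.exp (-(R.rate p.1 p.2 * t p.1)) ≤ 1 := by
            rw [Real.exp_le_one_iff]; have := mul_nonneg (R.nonneg p.1 p.2) (ht p.1); linarith
          have := mul_nonneg (inv_pos.2 (hz'p p.1)).le (sub_nonneg.2 h1)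
          have := (Real.exp_pos (-(R.rate p.1 p.2 * t p.1))).le
          linarith
      _ = _ := by ring
  · rintro E ⟨hE1, hE2⟩
    rw [hPdef, Finset.prod_union hdisj, Finset.prod_eq_one (s := J), one_mul, Finset.prod_product,
      ← Finset.prod_mul_distrib]
    · refine Finset.prod_induction _ (1 ≤ ·) (fun _ _ => one_le_mul_of_one_le_of_one_le) le_rfl
        fun u hu => ?_
      have hprod : ∏ v ∈ Xᶜ, (if E s(u, v) ≤ ENNReal.ofReal (if (u, v) ∈ J then t₁ else t u) then
          (if (u, v) ∈ J then (1 : ℝ) else (z' u)⁻¹) else if (u, v) ∈ J then 0 else 1)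
          = ((z' u)⁻¹) ^ hits E Xᶜ (t u) u := by
        rw [hits, ← Finset.prod_const, ← Finset.prod_filter_mul_prod_filter_not Xᶜ
          (fun v => v ≠ u ∧ E s(u, v) ≤ ENNReal.ofReal (t u))]
        refine (congrArg₂ (· * ·) (Finset.prod_congr rfl fun v hv => ?_)
          (Finset.prod_eq_one fun v hv => ?_)).trans (mul_one _)
        rotate_left
        · simp only [Finset.mem_filter, not_and] at hv
          have hnJ : (u, v) ∉ J := fun h => Finset.disjoint_left.1 hdisj h
            (Finset.mem_product.2 ⟨hu, hv.1⟩)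
          have hvu : v ≠ u := fun h => (Finset.mem_compl.1 hv.1) (h ▸ hS hu)
          simp only [hnJ, if_false, hv.2 hvu]
        · simp only [Finset.mem_filter] at hv
          have hnJ : (u, v) ∉ J := fun h => Finset.disjoint_left.1 hdisj h
            (Finset.mem_product.2 ⟨hu, hv.1⟩)
          simp only [hnJ, if_false, hv.2.2, if_true]
      rw [hprod, hz'z u hu]
      have hlt : hits E Xᶜ (t u) u ≤ m := (hits_le_degree E _ _ _).trans (hE2 u hu).le
      have hzu := hz u hu
      rw [inv_pow, ← div_eq_mul_inv, one_le_div (by positivity)]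
      exact pow_le_pow_right₀ hzu hlt
    · intro p hp
      simp [hp, hE1 p hp]

end Clocks

/-! ### Eigenvalues and the expander mixing lemma. -/

lemma getD_ofFn {m : ℕ} (f : Fin m → ℝ) (i : ℕ) (hi : i < m) (c : ℝ) :
    (List.ofFn f).getD i c = f ⟨i, hi⟩ := by
  rw [List.getD_eq_getElem?_getD, List.getElem?_ofFn]
  simp [hi]

namespace RateMatrix

variable {n : ℕ} (R : RateMatrix n)

/-- The symmetric matrix `R(u,v) / √(d_R(u) d_R(v))`, which is similar to the transition matrix. -/
noncomputable def symMat : Matrix (Fin n) (Fin n) ℝ :=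
  fun u v => R.rate u v / (√(R.deg u) * √(R.deg v))

lemma symMat_isHermitian : R.symMat.IsHermitian := by
  ext u v
  simp [symMat, R.symm v u, mul_comm]

lemma deg_nonneg (u : Fin n) : 0 ≤ R.deg u := Finset.sum_nonneg fun v _ => R.nonneg u v

/-- With `A = diag(d_R)^(-1/2)` one has `M = A(AR)` and `symMat = (AR)A`, and the characteristic
polynomial of a product does not depend on the order. -/
lemma symMat_charpoly (hd : ∀ u, 0 < R.deg u) : R.transition.charpoly = R.symMat.charpoly := by
  set A : Matrix (Fin n) (Fin n) ℝ := Matrix.diagonal fun u => (√(R.deg u))⁻¹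
  set B : Matrix (Fin n) (Fin n) ℝ := A * R.rate
  have h1 : R.transition = A * B := by
    ext u v
    simp only [A, B, transition, Matrix.diagonal_mul]
    have := Real.mul_self_sqrt (hd u).le
    rw [← mul_assoc, ← mul_inv, this, div_eq_inv_mul]
  have h2 : R.symMat = B * A := by
    ext u v
    simp only [A, B, symMat, Matrix.diagonal_mul, Matrix.mul_diagonal]
    rw [div_eq_mul_inv, mul_inv]; ring
  rw [h1, h2, Matrix.charpoly_mul_comm]

lemma eigenvalues_eq_ofFn (hd : ∀ u, 0 < R.deg u) :
    R.eigenvalues = List.ofFn R.symMat_isHermitian.eigenvalues₀ := by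
  have := R.symMat_isHermitian.sort_roots_charpoly_eq_eigenvalues₀
  simp only [RCLike.re_to_real, Multiset.map_id'] at this
  rw [eigenvalues, R.symMat_charpoly hd, this]

/-- Transfers `λ(R)`, defined through positions in a sorted list, to eigenvalues indexed by an
eigenbasis. Apart from the top index `i₀`, all of them lie between `λₙ` and `λ₂`. -/
lemma exists_abs_eigenvalues_le_lam (hn : 2 ≤ n) (hd : ∀ u, 0 < R.deg u) :
    ∃ i₀ : Fin n, (∀ i, R.symMat_isHermitian.eigenvalues i ≤ R.symMat_isHermitian.eigenvalues i₀) ∧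
      ∀ i, i ≠ i₀ → |R.symMat_isHermitian.eigenvalues i| ≤ R.lam := by
  classical
  set h := R.symMat_isHermitian
  set φ : Fin (Fintype.card (Fin n)) ≃ Fin n := Fintype.equivOfCardEq (Fintype.card_fin _)
  have hcard : Fintype.card (Fin n) = n := Fintype.card_fin n
  have hev : ∀ i, h.eigenvalues i = h.eigenvalues₀ (φ.symm i) := fun i => rfl
  refine ⟨φ ⟨0, by omega⟩, fun i => ?_, fun i hi => ?_⟩
  · rw [hev, hev, Equiv.symm_apply_apply]
    exact h.eigenvalues₀_antitone (Nat.zero_le _)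
  · have hi0 : (φ.symm i : ℕ) ≠ 0 := by
      intro h0
      apply hi
      rw [← φ.symm_apply_eq]
      exact Fin.ext h0
    have hlt := (φ.symm i).2
    have hle1 : h.eigenvalues i ≤ h.eigenvalues₀ ⟨1, by omega⟩ := by
      rw [hev]
      exact h.eigenvalues₀_antitone (Nat.one_le_iff_ne_zero.2 hi0)
    have hge : h.eigenvalues₀ ⟨n - 1, by omega⟩ ≤ h.eigenvalues i := by
      rw [hev]
      refine h.eigenvalues₀_antitone ?_
      rw [Fin.le_def]
      dsimp only
      omega
    rw [lam, R.eigenvalues_eq_ofFn hd, getD_ofFn _ 1 (by omega), getD_ofFn _ (n - 1) (by omega)]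
    rcases le_or_gt 0 (h.eigenvalues i) with h0 | h0
    · refine le_max_of_le_left ?_
      rw [abs_of_nonneg h0, abs_of_nonneg (h0.trans hle1)]
      exact hle1
    · refine le_max_of_le_right ?_
      rw [abs_of_neg h0, abs_of_neg (hge.trans_lt h0)]
      linarith

/-- The quadratic form of `symMat` is at most the identity. -/
lemma quadratic_form_le (hd : ∀ u, 0 < R.deg u) (x : Fin n → ℝ) :
    ∑ u, x u * ∑ v, R.symMat u v * x v ≤ ∑ u, x u ^ 2 := by
  have hs : ∀ u, 0 < √(R.deg u) := fun u => Real.sqrt_pos.2 (hd u)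
  have hsq : ∀ u, √(R.deg u) ^ 2 = R.deg u := fun u => Real.sq_sqrt (hd u).le
  set y : Fin n → ℝ := fun u => x u / √(R.deg u) with hy
  have h1 : ∀ u v, x u * (R.symMat u v * x v) ≤ R.rate u v * y u ^ 2 / 2 + R.rate v u * y v ^ 2 / 2 := by
    intro u v
    have : x u * (R.symMat u v * x v) = R.rate u v * (y u * y v) := by
      simp only [symMat, hy]; field_simp
    rw [this, R.symm v u]
    nlinarith [mul_nonneg (R.nonneg u v) (sq_nonneg (y u - y v))]
  have h2 : ∑ u, ∑ v, R.rate u v * y u ^ 2 / 2 = (∑ u, x u ^ 2) / 2 := by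
    rw [Finset.sum_div]
    refine Finset.sum_congr rfl fun u _ => ?_
    rw [← Finset.sum_div, ← Finset.sum_mul]
    have : ∑ v, R.rate u v = R.deg u := rfl
    rw [this, hy]
    simp only [div_pow, hsq]
    have := (hd u).ne'
    field_simp
  calc ∑ u, x u * ∑ v, R.symMat u v * x v = ∑ u, ∑ v, x u * (R.symMat u v * x v) := by
        simp_rw [Finset.mul_sum]
    _ ≤ ∑ u, ∑ v, (R.rate u v * y u ^ 2 / 2 + R.rate v u * y v ^ 2 / 2) :=
        Finset.sum_le_sum fun u _ => Finset.sum_le_sum fun v _ => h1 u v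
    _ = _ := by
        simp_rw [Finset.sum_add_distrib]
        rw [Finset.sum_comm (f := fun u v => R.rate v u * y v ^ 2 / 2), h2]
        ring

lemma symMat_mulVec_sqrt (hd : ∀ u, 0 < R.deg u) (u : Fin n) :
    ∑ v, R.symMat u v * √(R.deg v) = √(R.deg u) := by
  have hs : ∀ u, 0 < √(R.deg u) := fun u => Real.sqrt_pos.2 (hd u)
  have : ∀ v, R.symMat u v * √(R.deg v) = R.rate u v / √(R.deg u) := by
    intro v
    have := hs v
    have := hs u
    simp only [symMat]; field_simp
  simp_rw [this]
  rw [← Finset.sum_div]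
  have h : ∑ v, R.rate u v = R.deg u := rfl
  rw [h, Real.div_sqrt]

/-- On the orthogonal complement of the top eigenvector, `symMat` has norm at most `λ(R)`. -/
lemma sum_sq_symMat_le (hn : 2 ≤ n) (hd : ∀ u, 0 < R.deg u) (x : Fin n → ℝ)
    (hx : ∑ u, √(R.deg u) * x u = 0) :
    ∑ u, (∑ v, R.symMat u v * x v) ^ 2 ≤ R.lam ^ 2 * ∑ u, x u ^ 2 := by
  classical
  obtain ⟨i₀, hmax, hlam⟩ := R.exists_abs_eigenvalues_le_lam hn hd
  set h := R.symMat_isHermitian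
  set b := h.eigenvectorBasis
  set T := Matrix.toEuclideanLin R.symMat
  have hT : T.IsSymmetric := Matrix.isSymmetric_toEuclideanLin_iff.mpr h
  have hTapp : ∀ (y : EuclideanSpace ℝ (Fin n)) u, T y u = ∑ v, R.symMat u v * y v := by
    intro y u
    simp [T, Matrix.toLpLin_apply, Matrix.mulVec, dotProduct]
  have hTb : ∀ i, T (b i) = h.eigenvalues i • b i := by
    intro i
    ext u
    have := congrFun (h.mulVec_eigenvectorBasis i) u
    rw [hTapp]
    simpa [Matrix.mulVec, dotProduct, b] using this
  have hinner : ∀ i y, inner ℝ (b i) (T y) = h.eigenvalues i * inner ℝ (b i) y := by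
    intro i y
    rw [← hT, hTb, inner_smul_left]; simp
  have hin : ∀ y z : EuclideanSpace ℝ (Fin n), inner ℝ y z = ∑ u, y u * z u := by
    intro y z
    simp [PiLp.inner_apply, mul_comm]
  set s : EuclideanSpace ℝ (Fin n) := WithLp.toLp 2 fun u => √(R.deg u) with hs
  set X : EuclideanSpace ℝ (Fin n) := WithLp.toLp 2 x with hX
  have hTs : T s = s := by
    ext u
    rw [hTapp]
    exact R.symMat_mulVec_sqrt hd u
  have hsX : inner ℝ s X = 0 := by rw [hin]; exact hx
  have hcoef : ∀ i, |h.eigenvalues i * inner ℝ (b i) X| ≤ R.lam * |inner ℝ (b i) X| := by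
    intro i
    rw [abs_mul]
    by_cases hi : i = i₀
    -- If `1` is a multiple eigenvalue, `b i₀` need not be parallel to `√d_R`; but then `λ(R) ≥ 1`
    -- and the bound is trivial. If it is simple, every other `b j` is orthogonal to `√d_R`, so `b
    -- i₀` spans its line and is orthogonal to `X`.
    · by_cases hone : ∃ j, j ≠ i₀ ∧ h.eigenvalues j = 1
      · obtain ⟨j, hj, hj1⟩ := hone
        refine mul_le_mul_of_nonneg_right ?_ (abs_nonneg _)
        have h1 : 1 ≤ R.lam := by
          have := hlam j hj
          rwa [hj1, abs_one] at this
        have h2 : 1 ≤ h.eigenvalues i₀ := hj1 ▸ hmax j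
        have h3 : h.eigenvalues i₀ ≤ 1 := by
          have hq := R.quadratic_form_le hd (b i₀)
          have e1 : ∑ u, b i₀ u * ∑ v, R.symMat u v * b i₀ v = inner ℝ (b i₀) (T (b i₀)) := by
            rw [hin]
            exact Finset.sum_congr rfl fun u _ => by rw [hTapp]
          have e2 : ∑ u, b i₀ u ^ 2 = inner ℝ (b i₀) (b i₀) := by
            rw [hin]
            exact Finset.sum_congr rfl fun u _ => by ring
          rw [e1, e2, hinner] at hq
          have : inner ℝ (b i₀) (b i₀) = (1 : ℝ) := by
            rw [real_inner_self_eq_norm_sq, b.orthonormal.1]; norm_num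
          rw [this] at hq
          linarith
        rw [hi, abs_of_nonneg (by linarith)]
        linarith
      · push Not at hone
        have h0 : ∀ j, j ≠ i₀ → inner ℝ (b j) s = (0 : ℝ) := by
          intro j hj
          have := hinner j s
          rw [hTs] at this
          have h1 : (h.eigenvalues j - 1) * inner ℝ (b j) s = 0 := by linarith
          rcases mul_eq_zero.1 h1 with h1 | h1
          · exact absurd (by linarith) (hone j hj)
          · exact h1
        have hrep := b.sum_repr' s
        rw [Finset.sum_eq_single i₀ (fun j _ hj => by rw [h0 j hj, zero_smul])
          (fun hh => absurd (Finset.mem_univ _) hh)] at hrep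
        have hs0 : inner ℝ (b i₀) s ≠ (0 : ℝ) := by
          intro hz
          rw [hz, zero_smul] at hrep
          have := congrArg (fun y : EuclideanSpace ℝ (Fin n) => y ⟨0, by omega⟩) hrep
          simp only [hs, PiLp.zero_apply] at this
          exact (Real.sqrt_pos.2 (hd ⟨0, by omega⟩)).ne this
        have hz : inner ℝ (b i₀) X = (0 : ℝ) := by
          rw [← hrep, inner_smul_left] at hsX
          rcases mul_eq_zero.1 hsX with h1 | h1
          · exact absurd (by simpa using h1) hs0
          · exact h1
        rw [hi, hz]; simp
    · exact mul_le_mul_of_nonneg_right (hlam i hi) (abs_nonneg _)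
  have e1 : ∑ u, (∑ v, R.symMat u v * x v) ^ 2 = ‖T X‖ ^ 2 := by
    rw [EuclideanSpace.real_norm_sq_eq]
    exact Finset.sum_congr rfl fun u _ => by rw [hTapp]
  have e2 : ∑ u, x u ^ 2 = ‖X‖ ^ 2 := by
    rw [EuclideanSpace.real_norm_sq_eq]
  rw [e1, e2, ← b.sum_sq_norm_inner_right, ← b.sum_sq_norm_inner_right X, Finset.mul_sum]
  refine Finset.sum_le_sum fun i _ => ?_
  rw [hinner, Real.norm_eq_abs, Real.norm_eq_abs, ← mul_pow]
  exact pow_le_pow_left₀ (abs_nonneg _) (hcoef i) 2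

/-- `M(u,W) = ∑_{v ∈ W} M(u,v)`. -/
noncomputable def hitProb (W : Finset (Fin n)) (u : Fin n) : ℝ := (∑ v ∈ W, R.rate u v) / R.deg u

lemma total_pos (hn : 2 ≤ n) (hd : ∀ u, 0 < R.deg u) : 0 < R.total :=
  Finset.sum_pos (fun u _ => hd u) ⟨⟨0, by omega⟩, Finset.mem_univ _⟩

/-- The variance form of the expander mixing lemma. -/
lemma sum_deg_mul_sq_le (hn : 2 ≤ n) (hd : ∀ u, 0 < R.deg u) (W : Finset (Fin n)) :
    ∑ u, R.deg u * (R.hitProb W u - R.stationary W) ^ 2 ≤ R.lam ^ 2 * R.degSet W := by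
  classical
  have hs : ∀ u, 0 < √(R.deg u) := fun u => Real.sqrt_pos.2 (hd u)
  have hsq : ∀ u, √(R.deg u) * √(R.deg u) = R.deg u := fun u => Real.mul_self_sqrt (hd u).le
  have htot := R.total_pos hn hd
  set σ := R.stationary W with hσ
  have hσtot : σ * R.total = R.degSet W := by
    rw [hσ, stationary]; field_simp
  -- The centred indicator of `W`, scaled by `√d_R`, is orthogonal to the top eigenvector, and
  -- `symMat` maps it to `√d_R (M(·,W) - σ(W))`.
  set x : Fin n → ℝ := fun u => √(R.deg u) * ((if u ∈ W then 1 else 0) - σ) with hx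
  have hW : ∑ u, R.deg u * (if u ∈ W then (1 : ℝ) else 0) = R.degSet W := by
    simp [degSet, Finset.sum_ite_mem]
  have hV : ∑ u, R.deg u = R.total := rfl
  have h0 : ∑ u, √(R.deg u) * x u = 0 := by
    have : ∀ u, √(R.deg u) * x u = R.deg u * (if u ∈ W then 1 else 0) - σ * R.deg u := by
      intro u
      simp only [hx]
      rw [← mul_assoc, hsq]; ring
    simp_rw [this]
    rw [Finset.sum_sub_distrib, hW, ← Finset.mul_sum, hV, hσtot, sub_self]
  have h1 := R.sum_sq_symMat_le hn hd x h0
  have h2 : ∀ u, (∑ v, R.symMat u v * x v) ^ 2 = R.deg u * (R.hitProb W u - σ) ^ 2 := by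
    intro u
    have : ∀ v, R.symMat u v * x v
        = (R.rate u v * (if v ∈ W then 1 else 0) - σ * R.rate u v) / √(R.deg u) := by
      intro v
      have := hs v
      have := hs u
      simp only [hx, symMat]
      field_simp
    simp_rw [this]
    rw [← Finset.sum_div, Finset.sum_sub_distrib, ← Finset.mul_sum]
    have e1 : ∑ v, R.rate u v * (if v ∈ W then (1 : ℝ) else 0) = ∑ v ∈ W, R.rate u v := by
      simp [Finset.sum_ite_mem]
    have e2 : ∑ v, R.rate u v = R.deg u := rfl
    rw [e1, e2, hitProb, div_pow, Real.sq_sqrt (hd u).le]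
    have := (hd u).ne'
    field_simp
  have h3 : ∑ u, x u ^ 2 ≤ R.degSet W := by
    have : ∀ u, x u ^ 2 = R.deg u * (if u ∈ W then (1 : ℝ) else 0) * (1 - 2 * σ) + σ ^ 2 * R.deg u := by
      intro u
      simp only [hx, mul_pow, Real.sq_sqrt (hd u).le]
      split_ifs <;> ring
    simp_rw [this]
    rw [Finset.sum_add_distrib, ← Finset.sum_mul, ← Finset.mul_sum, hW, hV]
    have hσ0 : 0 ≤ σ := div_nonneg (Finset.sum_nonneg fun u _ => (hd u).le) htot.le
    have hdW : 0 ≤ R.degSet W := Finset.sum_nonneg fun u _ => (hd u).le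
    have : σ ^ 2 * R.total = σ * R.degSet W := by rw [← hσtot]; ring
    nlinarith [mul_nonneg hσ0 hdW]
  simp_rw [h2] at h1
  exact h1.trans (mul_le_mul_of_nonneg_left h3 (sq_nonneg _))

end RateMatrix

/-! ### Vertices that send much weight into a small set. -/

/-- The conditions of `IsRM` at a single `n`, with scale `d`. -/
structure IsRMAt {n : ℕ} (R : RateMatrix n) (α γ b d : ℝ) : Prop where
  two_le : 2 ≤ n
  d_pos : 0 < d
  lam_le : R.lam ≤ ((n : ℝ) * maxEntry R.transition) ^ (-α - γ)
  le_deg : ∀ u, d ≤ R.deg u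
  total_le : R.total ≤ b * d * n
  stationary_le : ∀ A : Finset (Fin n), R.stationary A ≤ b * ((A.card : ℝ) / n) ^ (1 - 2 * α)
  entry_le : maxEntry R.rate ≤ d * (n : ℝ) ^ (-γ)

lemma IsRM.eventually_isRMAt {R : (n : ℕ) → RateMatrix n} {α γ b : ℝ} {d : ℕ → ℝ}
    (h : IsRM R α γ b d) : ∀ᶠ n in atTop, IsRMAt (R n) α γ b (d n) := by
  filter_upwards [eventually_ge_atTop 2, h.d_pos, h.lam_le, h.le_deg, h.total_le, h.stationary_le,
    h.entry_le] with n h1 h2 h3 h4 h5 h6 h7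
  exact ⟨h1, h2, h3, h4, h5, h6, h7⟩

lemma le_maxEntry {n : ℕ} (A : Matrix (Fin n) (Fin n) ℝ) (u v : Fin n) : A u v ≤ maxEntry A :=
  le_ciSup (f := fun p : Fin n × Fin n => A p.1 p.2) (Set.finite_range _).bddAbove (u, v)

namespace IsRMAt

variable {n : ℕ} {R : RateMatrix n} {α γ b d : ℝ}

lemma n_pos (h : IsRMAt R α γ b d) : (0 : ℝ) < n := by
  have := h.two_le
  exact_mod_cast (by omega : 0 < n)

lemma deg_pos (h : IsRMAt R α γ b d) (u : Fin n) : 0 < R.deg u := h.d_pos.trans_le (h.le_deg u)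

lemma rate_le (h : IsRMAt R α γ b d) (u v : Fin n) : R.rate u v ≤ d * (n : ℝ) ^ (-γ) :=
  (le_maxEntry R.rate u v).trans h.entry_le

lemma one_le_mul_maxEntry (h : IsRMAt R α γ b d) : 1 ≤ (n : ℝ) * maxEntry R.transition := by
  set u : Fin n := ⟨0, by have := h.two_le; omega⟩
  have h1 : ∑ v, R.transition u v = 1 := by
    simp only [RateMatrix.transition]
    rw [← Finset.sum_div]
    exact div_self (h.deg_pos u).ne'
  rw [← h1]
  calc ∑ v, R.transition u v ≤ ∑ _v : Fin n, maxEntry R.transition :=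
        Finset.sum_le_sum fun v _ => le_maxEntry _ u v
    _ = _ := by simp

lemma hitProb_le (_h : IsRMAt R α γ b d) (W : Finset (Fin n)) (u : Fin n) :
    R.hitProb W u ≤ W.card * maxEntry R.transition := by
  rw [RateMatrix.hitProb, Finset.sum_div]
  calc ∑ v ∈ W, R.rate u v / R.deg u ≤ ∑ _v ∈ W, maxEntry R.transition :=
        Finset.sum_le_sum fun v _ => le_maxEntry R.transition u v
    _ = _ := by simp

end IsRMAt

set_option maxHeartbeats 800000 in
/-- Few vertices send a large part of their weight into a given small set. -/
theorem exists_card_exceptional_le {α γ b : ℝ} (hα : 0 ≤ α) (hα' : α < 1 / 2) (hγ : 0 < γ)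
    (hb : 0 < b) : ∃ δ β : ℝ, 0 < δ ∧ 0 < β ∧ β ≤ 1 ∧ ∀ (n : ℕ) (R : RateMatrix n) (d : ℝ),
      IsRMAt R α γ b d → ∀ W : Finset (Fin n), W.Nonempty → (W.card : ℝ) ≤ β * n →
        ((Finset.univ.filter fun u => ((W.card : ℝ) / n) ^ δ < R.hitProb W u).card : ℝ)
          ≤ ((W.card : ℝ) / n) ^ δ * W.card := by
  -- Sizes are compared on a logarithmic scale, `l = log(1/x)` against `a = log(n‖M‖)`, and `l =
  -- (1+δ₁)a` separates the trivial from the spectral range. The trivial range needs `(1-δ)(1+δ₁) ≥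
  -- 1`, the spectral one `(α+γ/2)(1+δ₁) ≤ α+γ` and `4δ ≤ γ`; the latter also uses `2δ ≤ 1-2α`.
  set δ₁ : ℝ := γ / (1 + γ) with hδ₁
  have hδ₁0 : 0 < δ₁ := by positivity
  set δ : ℝ := min (γ / (4 * (1 + 2 * γ))) ((1 - 2 * α) / 2) with hδ
  have hδ0 : 0 < δ := lt_min (by positivity) (by linarith)
  have hδa : δ ≤ (1 - 2 * α) / 2 := min_le_right _ _
  have hδg' : δ ≤ γ / (4 * (1 + 2 * γ)) := min_le_left _ _
  have hδg : δ * (4 * (1 + 2 * γ)) ≤ γ := by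
    rwa [le_div_iff₀ (by positivity)] at hδg'
  have hδγ : 4 * δ ≤ γ := by nlinarith [mul_pos hδ0 hγ]
  have hδδ₁ : 1 ≤ (1 - δ) * (1 + δ₁) := by
    have e : (1 - δ) * (1 + δ₁) = (1 - δ) * (1 + 2 * γ) / (1 + γ) := by
      rw [hδ₁]; field_simp; ring
    rw [e, le_div_iff₀ (by positivity)]
    nlinarith [mul_pos hδ0 hγ]
  have hag : (α + γ / 2) * (1 + δ₁) ≤ α + γ := by
    have : (α + γ / 2) * δ₁ ≤ γ / 2 := by
      rw [hδ₁, mul_div_assoc', div_le_iff₀ (by positivity)]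
      nlinarith
    linarith
  -- Since `x^δ c ≤ 1`, one small power of `x` absorbs both constants that occur, `2b` and `4b²`.
  set c : ℝ := 4 * b ^ 2 + 2 * b + 1 with hc
  have hc1 : 1 ≤ c := by nlinarith [sq_nonneg b]
  refine ⟨δ, c⁻¹ ^ (1 / δ), hδ0, by positivity, ?_, ?_⟩
  · exact Real.rpow_le_one (by positivity) (inv_le_one_of_one_le₀ hc1) (by positivity)
  intro n R d h W hW hWβ
  have hn := h.n_pos
  have hWc : (0 : ℝ) < W.card := by exact_mod_cast hW.card_pos
  set x : ℝ := (W.card : ℝ) / n with hx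
  have hx0 : 0 < x := by positivity
  have hxβ : x ≤ c⁻¹ ^ (1 / δ) := by rw [hx, div_le_iff₀ hn]; exact hWβ
  have hxδ : x ^ δ ≤ c⁻¹ := by
    calc x ^ δ ≤ (c⁻¹ ^ (1 / δ)) ^ δ := Real.rpow_le_rpow hx0.le hxβ hδ0.le
      _ = c⁻¹ := by rw [← Real.rpow_mul (by positivity), one_div_mul_cancel hδ0.ne', Real.rpow_one]
  have hcx : x ^ δ * c ≤ 1 := by
    calc x ^ δ * c ≤ c⁻¹ * c := by gcongr
      _ = 1 := inv_mul_cancel₀ (by positivity)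
  have hx1 : x ≤ 1 := hxβ.trans
    (Real.rpow_le_one (by positivity) (inv_le_one_of_one_le₀ hc1) (by positivity))
  have hWx : (W.card : ℝ) = x * n := by rw [hx]; field_simp
  have hst : R.stationary W ≤ b * x ^ (1 - 2 * α) := h.stationary_le W
  clear_value x
  clear hx
  set m : ℝ := (n : ℝ) * maxEntry R.transition with hm
  have hm1 : 1 ≤ m := h.one_le_mul_maxEntry
  set a := Real.log m with ha
  set l := -Real.log x with hl
  have hl0 : 0 ≤ l := by rw [hl]; linarith [Real.log_nonpos hx0.le hx1]
  have hxpow : ∀ p : ℝ, x ^ p = Real.exp (-(l * p)) := by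
    intro p
    rw [Real.rpow_def_of_pos hx0, hl]; congr 1; ring
  have hxm : x * m = Real.exp (-l + a) := by
    rw [Real.exp_add, hl, neg_neg, Real.exp_log hx0, ha, Real.exp_log (by linarith)]
  have hxx : x ^ δ * x = Real.exp (-(l * δ) + -l) := by
    rw [Real.exp_add, hl, neg_neg, Real.exp_log hx0, ← hl, hxpow]
  -- In the first case `M(u,W) ≤ |W|‖M‖ = e^(a-l) ≤ x^δ` for every `u`, so nothing is exceptional.
  rcases le_or_gt ((1 + δ₁) * a) l with hcase | hcase
  · have hempty : (Finset.univ.filter fun u => x ^ δ < R.hitProb W u) = ∅ := by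
      refine Finset.filter_eq_empty_iff.2 fun u _ => not_lt.2 ?_
      refine (h.hitProb_le W u).trans ?_
      have : (W.card : ℝ) * maxEntry R.transition = x * m := by rw [hWx, hm]; ring
      rw [this, hxpow, hxm, Real.exp_le_exp]
      have ha0 : 0 ≤ a := Real.log_nonneg hm1
      have : a ≤ (1 - δ) * l := by
        have h1 : 0 ≤ 1 - δ := by nlinarith
        calc a = 1 * a := (one_mul a).symm
          _ ≤ (1 - δ) * (1 + δ₁) * a := by gcongr
          _ = (1 - δ) * ((1 + δ₁) * a) := by ring
          _ ≤ _ := by gcongr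
      linarith
    rw [hempty, Finset.card_empty, Nat.cast_zero]
    positivity
  · set X := Finset.univ.filter fun u => x ^ δ < R.hitProb W u with hX
    have hvar := R.sum_deg_mul_sq_le h.two_le h.deg_pos W
    have htot := R.total_pos h.two_le h.deg_pos
    have hdW : R.degSet W = R.stationary W * R.total := by
      rw [RateMatrix.stationary]; field_simp
    -- Exceptional vertices thus deviate from the mean by at least `x^δ / 2`, and Chebyshev's
    -- inequality applies to the variance bound.
    have hσ : R.stationary W ≤ x ^ δ / 2 := by
      refine hst.trans ?_
      have : x ^ (1 - 2 * α) ≤ x ^ δ * x ^ δ := by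
        rw [← Real.rpow_add hx0]
        exact Real.rpow_le_rpow_of_exponent_ge hx0 hx1 (by linarith)
      have hxp : 0 < x ^ δ := Real.rpow_pos_of_pos hx0 δ
      have h2 : b * x ^ δ ≤ 1 / 2 := by
        have : x ^ δ * (2 * b) ≤ x ^ δ * c :=
          mul_le_mul_of_nonneg_left (by rw [hc]; linarith [sq_nonneg b]) hxp.le
        linarith
      calc b * x ^ (1 - 2 * α) ≤ b * (x ^ δ * x ^ δ) := by gcongr
        _ = (b * x ^ δ) * x ^ δ := by ring
        _ ≤ 1 / 2 * x ^ δ := by gcongr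
        _ = _ := by ring
    have hlow : X.card * (d * (x ^ δ / 2) ^ 2) ≤
        ∑ u, R.deg u * (R.hitProb W u - R.stationary W) ^ 2 := by
      calc X.card * (d * (x ^ δ / 2) ^ 2) = ∑ _u ∈ X, d * (x ^ δ / 2) ^ 2 := by simp
        _ ≤ ∑ u ∈ X, R.deg u * (R.hitProb W u - R.stationary W) ^ 2 := by
            refine Finset.sum_le_sum fun u hu => ?_
            have hu' : x ^ δ < R.hitProb W u := (Finset.mem_filter.1 hu).2
            have hxp : 0 < x ^ δ := Real.rpow_pos_of_pos hx0 δ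
            have h1 : x ^ δ / 2 ≤ R.hitProb W u - R.stationary W := by linarith
            have := h.le_deg u
            have := h.d_pos
            have := (h.deg_pos u).le
            gcongr
        _ ≤ _ := Finset.sum_le_sum_of_subset_of_nonneg (Finset.subset_univ _) fun u _ _ =>
            mul_nonneg (h.deg_pos u).le (sq_nonneg _)
    have hlam : R.lam ≤ Real.exp (-((α + γ / 2) * l)) := by
      refine h.lam_le.trans ?_
      rw [← hm, Real.rpow_def_of_pos (by linarith), ← ha, Real.exp_le_exp]
      have h1 : (α + γ / 2) * l ≤ (α + γ / 2) * ((1 + δ₁) * a) := by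
        gcongr
      have ha0 : 0 ≤ a := Real.log_nonneg hm1
      have h2 : (α + γ / 2) * (1 + δ₁) * a ≤ (α + γ) * a := by gcongr
      linarith
    have hlam0 : 0 ≤ R.lam := (abs_nonneg _).trans (le_max_left _ _)
    have hup : R.lam ^ 2 * R.degSet W ≤
        Real.exp (-((α + γ / 2) * l)) ^ 2 * (b * x ^ (1 - 2 * α) * (b * d * n)) := by
      rw [hdW]
      have h1 : R.stationary W * R.total ≤ b * x ^ (1 - 2 * α) * (b * d * n) :=
        mul_le_mul hst h.total_le htot.le (by positivity)
      have h2 : 0 ≤ R.stationary W * R.total := by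
        rw [← hdW]; exact Finset.sum_nonneg fun u _ => R.deg_nonneg u
      gcongr
    have hall := hlow.trans (hvar.trans hup)
    have hd := h.d_pos
    rw [hWx]
    have hcard : (X.card : ℝ) ≤ 4 * b ^ 2 * n * Real.exp (2 * δ * l - (1 + γ) * l) := by
      have e1 : (X.card : ℝ) * (d * (x ^ δ / 2) ^ 2)
          = (X.card * Real.exp (-(2 * δ * l))) * (d / 4) := by
        rw [hxpow]
        have : Real.exp (-(2 * δ * l)) = Real.exp (-(l * δ)) ^ 2 := by
          rw [← Real.exp_nat_mul]; congr 1; push_cast; ring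
        rw [this]; ring
      have e2 : Real.exp (-((α + γ / 2) * l)) ^ 2 * (b * x ^ (1 - 2 * α) * (b * d * n))
          = (4 * b ^ 2 * n * Real.exp (-((1 + γ) * l))) * (d / 4) := by
        rw [hxpow]
        have : Real.exp (-((1 + γ) * l))
            = Real.exp (-((α + γ / 2) * l)) ^ 2 * Real.exp (-(l * (1 - 2 * α))) := by
          rw [← Real.exp_nat_mul, ← Real.exp_add]; congr 1; push_cast; ring
        rw [this]; ring
      rw [e1, e2] at hall
      have h3 := le_of_mul_le_mul_right hall (by positivity)
      have h4 : (X.card : ℝ) = X.card * Real.exp (-(2 * δ * l)) * Real.exp (2 * δ * l) := by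
        rw [mul_assoc, ← Real.exp_add]; simp
      rw [h4]
      calc _ ≤ 4 * b ^ 2 * n * Real.exp (-((1 + γ) * l)) * Real.exp (2 * δ * l) := by gcongr
        _ = 4 * b ^ 2 * n * (Real.exp (-((1 + γ) * l)) * Real.exp (2 * δ * l)) := by ring
        _ = _ := by rw [← Real.exp_add]; congr 2; ring
    refine hcard.trans ?_
    have h5 : Real.exp (2 * δ * l - (1 + γ) * l) ≤ Real.exp (-(l * δ)) * (x ^ δ * x) := by
      rw [hxx, ← Real.exp_add, Real.exp_le_exp]
      have := mul_le_mul_of_nonneg_right hδγ hl0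
      linarith
    have hxp : 0 < x ^ δ := Real.rpow_pos_of_pos hx0 δ
    calc _ ≤ 4 * b ^ 2 * n * (Real.exp (-(l * δ)) * (x ^ δ * x)) := by gcongr
      _ = (4 * b ^ 2 * x ^ δ) * (x ^ δ * (x * n)) := by rw [← hxpow]; ring
      _ ≤ 1 * (x ^ δ * (x * n)) := by
          gcongr
          have : x ^ δ * (4 * b ^ 2) ≤ x ^ δ * c :=
            mul_le_mul_of_nonneg_left (by rw [hc]; linarith) hxp.le
          linarith
      _ = _ := one_mul _

/-! ### Deterministic facts about the process, the sparse graph and expansion. -/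

section Graphs

variable {n : ℕ}

lemma degree_mono {G G' : SimpleGraph (Fin n)} (h : G ≤ G') (u : Fin n) :
    degree G u ≤ degree G' u :=
  Set.ncard_le_ncard (fun _ hv => h hv) (Set.toFinite _)

lemma processGraph_mono (E : Clocks n) {t t' : ℝ≥0∞} (h : t ≤ t') :
    processGraph E t ≤ processGraph E t' := fun _ _ hv => ⟨hv.1, hv.2.1.trans h, hv.2.2⟩

lemma degreeTime_mono (E : Clocks n) {D D' : ℕ} (h : D ≤ D') (u : Fin n) :
    degreeTime E D u ≤ degreeTime E D' u :=
  sInf_le_sInf fun _ ht => ⟨ht.1, h.trans ht.2⟩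

lemma sparseGraph_mono (E : Clocks n) {D D' : ℕ} (h : D ≤ D') (k : ℕ) :
    sparseGraph E D k ≤ sparseGraph E D' k := fun _ _ hv =>
  ⟨hv.1, hv.2.trans (max_le_max (degreeTime_mono E h _) (degreeTime_mono E h _))⟩

lemma nbhd_mono {G G' : SimpleGraph (Fin n)} (h : G ≤ G') (A : Set (Fin n)) :
    nbhd G A ⊆ nbhd G' A := fun _ ⟨hu, v, hv, ha⟩ => ⟨hu, v, hv, h ha⟩

/-- The process is right-continuous. -/
lemma exists_mem_processGraph_eq_sInf (E : Clocks n) {S : Set ℝ≥0∞} (hS : S.Nonempty) :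
    ∃ t ∈ S, processGraph E t = processGraph E (sInf S) := by
  rcases eq_or_ne (sInf S) ⊤ with h | h
  · obtain ⟨t, ht⟩ := hS
    exact ⟨t, ht, by rw [h, sInf_eq_top.1 h t ht]⟩
  · have hev : ∀ᶠ t in 𝓝[>] (sInf S), ∀ e, sInf S < E e → t < E e := by
      rw [eventually_all]
      intro e
      by_cases he : sInf S < E e
      · filter_upwards [mem_nhdsWithin_of_mem_nhds (Iio_mem_nhds he)] with t ht _ using ht
      · exact Eventually.of_forall fun _ h => absurd h he
    have hne : (𝓝[>] (sInf S)).NeBot := nhdsGT_neBot_of_exists_gt ⟨⊤, lt_top_iff_ne_top.2 h⟩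
    obtain ⟨t', ht', hgt⟩ := (hev.and self_mem_nhdsWithin).exists
    obtain ⟨t, htS, htlt⟩ := sInf_lt_iff.1 hgt
    refine ⟨t, htS, le_antisymm (fun u v hv => ?_) (processGraph_mono E (sInf_le htS))⟩
    refine ⟨hv.1, ?_, hv.2.2⟩
    by_contra hlt
    exact absurd (ht' _ (not_le.1 hlt)) (not_lt.2 (hv.2.1.trans htlt.le))

lemma le_degree_degreeTime (E : Clocks n) {D : ℕ} {u : Fin n} {t : ℝ≥0∞}
    (ht : 0 < t) (h : D ≤ degree (processGraph E t) u) :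
    D ≤ degree (processGraph E (degreeTime E D u)) u := by
  obtain ⟨t', ht', he⟩ := exists_mem_processGraph_eq_sInf E
    (S := {t | 0 < t ∧ D ≤ degree (processGraph E t) u}) ⟨t, ht, h⟩
  rw [degreeTime, ← he]
  exact ht'.2

lemma le_degree_minDegreeTime (E : Clocks n) {k : ℕ} {t : ℝ≥0∞}
    (ht : 0 < t) (h : ∀ u, k ≤ degree (processGraph E t) u) (u : Fin n) :
    k ≤ degree (processGraph E (minDegreeTime E k)) u := by
  obtain ⟨t', ht', he⟩ := exists_mem_processGraph_eq_sInf E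
    (S := {t | 0 < t ∧ ∀ u, k ≤ degree (processGraph E t) u}) ⟨t, ht, h⟩
  rw [minDegreeTime, ← he]
  exact ht'.2 u

lemma minDegreeTime_le (E : Clocks n) {k : ℕ} {t : ℝ≥0∞}
    (ht : 0 < t) (h : ∀ u, k ≤ degree (processGraph E t) u) : minDegreeTime E k ≤ t :=
  sInf_le ⟨ht, h⟩

lemma le_minDegreeTime (E : Clocks n) {k : ℕ} {t : ℝ≥0∞} {u : Fin n}
    (h : degree (processGraph E t) u < k) : t ≤ minDegreeTime E k := by
  refine le_sInf fun t' ht' => ?_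
  by_contra hlt
  have := degree_mono (processGraph_mono E (not_le.1 hlt).le) u
  have := ht'.2 u
  omega

/-- All edges at a vertex of degree less than `D` are kept. -/
lemma sparseGraph_adj_of_degree_lt (E : Clocks n) {D k : ℕ} {u v : Fin n}
    (h : degree (processGraph E (minDegreeTime E k)) u < D)
    (hv : (processGraph E (minDegreeTime E k)).Adj u v) : (sparseGraph E D k).Adj u v := by
  refine ⟨hv, le_max_of_le_left (hv.2.1.trans (le_sInf fun t ht => ?_))⟩
  by_contra hlt
  have := degree_mono (processGraph_mono E (not_le.1 hlt).le) u
  have := ht.2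
  omega

/-- The first `D` edges at a vertex of degree at least `D` are kept. -/
lemma exists_sparseGraph_neighbors (E : Clocks n) {D k : ℕ} {u : Fin n} {t : ℝ≥0∞} (ht : 0 < t)
    (h : D ≤ degree (processGraph E (minDegreeTime E k)) u)
    (h' : D ≤ degree (processGraph E t) u) :
    ∃ N : Finset (Fin n), D ≤ N.card ∧ ∀ v ∈ N, (sparseGraph E D k).Adj u v ∧ E s(u, v) ≤ t := by
  classical
  -- At each of the three times `u` has degree at least `D`, hence also at the earliest. Edges
  -- present then lie in `G(τ_k)`, are among those kept in `H`, and arrived by `t`.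
  set T := min (minDegreeTime E k) (min (degreeTime E D u) t) with hT
  have hdeg : D ≤ degree (processGraph E T) u := by
    rcases min_choice (minDegreeTime E k) (min (degreeTime E D u) t) with h1 | h1
    · rwa [hT, h1]
    · rw [hT, h1]
      rcases min_choice (degreeTime E D u) t with h2 | h2
      · rw [h2]; exact le_degree_degreeTime E ht h'
      · rwa [h2]
  refine ⟨((processGraph E T).neighborSet u).toFinset, ?_, fun v hv => ?_⟩
  · rwa [← Set.ncard_eq_toFinset_card']
  · rw [Set.mem_toFinset] at hv
    have h3 : E s(u, v) ≤ T := hv.2.1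
    exact ⟨⟨⟨hv.1, h3.trans (min_le_left _ _), hv.2.2⟩,
      le_max_of_le_left (h3.trans ((min_le_right _ _).trans (min_le_left _ _)))⟩,
      h3.trans ((min_le_right _ _).trans (min_le_right _ _))⟩

/-- The neighbours chosen by `u`: those attached before its degree time. -/
def chosen (E : Clocks n) (D : ℕ) (u : Fin n) : Set (Fin n) :=
  {v | u ≠ v ∧ E s(u, v) < ⊤ ∧ E s(u, v) ≤ degreeTime E D u}

lemma mem_chosen_of_adj {E : Clocks n} {D k : ℕ} {u v : Fin n} (h : (sparseGraph E D k).Adj u v) :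
    v ∈ chosen E D u ∨ u ∈ chosen E D v := by
  rcases le_max_iff.1 h.2 with h1 | h1
  · exact Or.inl ⟨h.1.1, h.1.2.2, h1⟩
  · exact Or.inr ⟨h.1.1.symm, by rw [Sym2.eq_swap]; exact h.1.2.2, by rw [Sym2.eq_swap]; exact h1⟩

/-- No two clocks ring at the same finite time. -/
def NoTies (E : Clocks n) : Prop := ∀ e e', e ≠ e' → E e < ⊤ → E e ≠ E e'

/-- Fewer than `D` edges arrive strictly before the degree time, and without ties at most one
arrives exactly then. -/
lemma ncard_chosen_le {E : Clocks n} (hE : NoTies E) {D : ℕ} (hD : 1 ≤ D) (u : Fin n) :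
    (chosen E D u).ncard ≤ D := by
  set T := degreeTime E D u with hT
  set A : Set (Fin n) := {v | u ≠ v ∧ E s(u, v) < T}
  set B : Set (Fin n) := {v | u ≠ v ∧ E s(u, v) < ⊤ ∧ E s(u, v) = T}
  have hsub : chosen E D u ⊆ A ∪ B := by
    intro v hv
    rcases hv.2.2.lt_or_eq with h | h
    · exact Or.inl ⟨hv.1, h⟩
    · exact Or.inr ⟨hv.1, hv.2.1, h⟩
  have hB : B.ncard ≤ 1 := by
    rw [Set.ncard_le_one (Set.toFinite _)]
    intro v hv w hw
    by_contra hvw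
    refine hE s(u, v) s(u, w) ?_ hv.2.1 (hv.2.2.trans hw.2.2.symm)
    intro h
    rcases Sym2.eq_iff.1 h with h | h
    · exact hvw h.2
    · exact hw.1 h.1
  have hA : A.ncard < D := by
    by_contra hAD
    push Not at hAD
    have hApos : A.Nonempty := by
      rw [← Set.ncard_pos (Set.toFinite _)]; omega
    obtain ⟨v₀, hv₀⟩ := hApos
    have hTpos : 0 < T := zero_le.trans_lt hv₀.2
    -- There are finitely many clocks, so all edges before `T` are present at some `t < T`. With `D`
    -- of them this contradicts the infimum; `1 ≤ D` provides an edge that forces `t > 0`.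
    have hev : ∀ᶠ t in 𝓝[<] T, ∀ e, E e < T → E e < t := by
      rw [eventually_all]
      intro e
      by_cases he : E e < T
      · filter_upwards [mem_nhdsWithin_of_mem_nhds (Ioi_mem_nhds he)] with t ht _ using ht
      · exact Eventually.of_forall fun _ h => absurd h he
    have hne : (𝓝[<] T).NeBot := nhdsLT_neBot_of_exists_lt ⟨0, hTpos⟩
    obtain ⟨t, ht, htlt⟩ := (hev.and self_mem_nhdsWithin).exists
    have ht0 : 0 < t := zero_le.trans_lt (ht _ hv₀.2)
    have hdeg : D ≤ degree (processGraph E t) u :=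
      hAD.trans (Set.ncard_le_ncard (fun v hv =>
        ⟨hv.1, (ht _ hv.2).le, hv.2.trans_le le_top⟩) (Set.toFinite _))
    exact absurd (sInf_le (show t ∈ {t | 0 < t ∧ D ≤ degree (processGraph E t) u} from ⟨ht0, hdeg⟩))
      (not_le.2 htlt)
  have := Set.ncard_le_ncard hsub (Set.toFinite _)
  have := Set.ncard_union_le A B
  omega

/-- Expansion of a graph with few, well separated small vertices, when the large vertices have many
neighbours outside any set that is not much larger than the set of large vertices considered. -/
lemma mul_card_le_ncard_nbhd (H : SimpleGraph (Fin n)) {k c D₂ : ℕ} (small : Fin n → Prop)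
    (hmin : ∀ u, k ≤ degree H u)
    (hadj : ∀ s s', small s → small s' → s ≠ s' → ¬ H.Adj s s')
    (hcommon : ∀ s s' y, small s → small s' → s ≠ s' → H.Adj s y → ¬ H.Adj y s')
    (hpaths : ∀ (x : Fin n) (y s : Fin c → Fin n), Function.Injective y → Function.Injective s →
      ¬ small x → (∀ i, ¬ small (y i)) → (∀ i, small (s i)) →
      ¬ ∀ i, H.Adj x (y i) ∧ H.Adj (y i) (s i))
    (A : Finset (Fin n))
    (hlarge : ∀ L W : Finset (Fin n), L ⊆ W → L.Nonempty → (∀ u ∈ L, ¬ small u) →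
      W.card ≤ (k + 2) * L.card → L.card ≤ A.card →
      ∃ u ∈ L, ∃ N : Finset (Fin n), D₂ + 1 + k * c ≤ N.card ∧ (∀ v ∈ N, H.Adj u v) ∧
        (W.filter (· ∈ N)).card < D₂) :
    k * A.card ≤ (nbhd H (A : Set (Fin n))).ncard := by
  classical
  set B : Finset (Fin n) := (nbhd H (A : Set (Fin n))).toFinset with hB
  have hmemB : ∀ v, v ∈ B ↔ v ∉ A ∧ ∃ w ∈ A, H.Adj w v := by
    intro v
    rw [hB, Set.mem_toFinset]
    exact ⟨fun ⟨h1, w, hw, h2⟩ => ⟨h1, w, hw, h2.symm⟩, fun ⟨h1, w, hw, h2⟩ => ⟨h1, w, hw, h2.symm⟩⟩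
  rw [Set.ncard_eq_toFinset_card', ← hB]
  by_contra! hlt
  set S := A.filter small with hS
  set L := A.filter (fun u => ¬ small u) with hL
  have hSL : S.card + L.card = A.card := Finset.card_filter_add_card_filter_not _
  have hY : ∀ u, ∃ Y : Finset (Fin n), Y.card = k ∧ ∀ v ∈ Y, H.Adj u v := by
    intro u
    have h1 : k ≤ (H.neighborSet u).toFinset.card := by
      rw [← Set.ncard_eq_toFinset_card']; exact hmin u
    obtain ⟨Y, hYs, hYc⟩ := Finset.exists_subset_card_eq h1
    exact ⟨Y, hYc, fun v hv => by simpa using hYs hv⟩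
  choose Y hYc hYadj using hY
  set U := S.biUnion Y with hU
  have hSsmall : ∀ s ∈ S, small s := fun s hs => (Finset.mem_filter.1 hs).2
  have hSA : ∀ s ∈ S, s ∈ A := fun s hs => (Finset.mem_filter.1 hs).1
  have hLlarge : ∀ s ∈ L, ¬ small s := fun s hs => (Finset.mem_filter.1 hs).2
  have hLA : ∀ s ∈ L, s ∈ A := fun s hs => (Finset.mem_filter.1 hs).1
  have hdisj : ∀ s ∈ S, ∀ s' ∈ S, s ≠ s' → Disjoint (Y s) (Y s') := by
    intro s hs s' hs' hne
    rw [Finset.disjoint_left]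
    intro y hy hy'
    exact hcommon s s' y (hSsmall s hs) (hSsmall s' hs') hne (hYadj s y hy) (hYadj s' y hy').symm
  have hUcard : U.card = S.card * k := by
    rw [hU, Finset.card_biUnion hdisj, Finset.sum_const_nat fun s _ => hYc s]
  have hUsmall : ∀ y ∈ U, ¬ small y := by
    intro y hy hys
    obtain ⟨s, hs, hys'⟩ := Finset.mem_biUnion.1 hy
    have ha := hYadj s y hys'
    exact hadj s y (hSsmall s hs) hys ha.ne ha
  -- The stars supply at least `k|S| - |L|` vertices of `N(A)`, as they are disjoint and meet `A`
  -- only in `L`. With `|N(A)| < k|A|` this leaves `|Z| < (k+1)|L|`.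
  set Z := B \ U with hZ
  have hUL : U \ L ⊆ B := by
    intro y hy
    obtain ⟨hyU, hyL⟩ := Finset.mem_sdiff.1 hy
    obtain ⟨s, hs, hys⟩ := Finset.mem_biUnion.1 hyU
    rw [hmemB]
    refine ⟨fun hyA => hyL (Finset.mem_filter.2 ⟨hyA, hUsmall y hyU⟩), s, hSA s hs, hYadj s y hys⟩
  have hBcard : (U \ L).card + Z.card ≤ B.card := by
    rw [← Finset.card_union_of_disjoint]
    · exact Finset.card_le_card (Finset.union_subset hUL Finset.sdiff_subset)
    · rw [Finset.disjoint_left]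
      intro y hy hy'
      exact (Finset.mem_sdiff.1 hy').2 (Finset.mem_sdiff.1 hy).1
  have hUL' : U.card ≤ (U \ L).card + L.card := by
    have := Finset.le_card_sdiff L U
    omega
  have hZcard : Z.card + k * S.card < L.card + k * A.card := by
    rw [hUcard, mul_comm] at hUL'
    omega
  have hZcard' : Z.card < (k + 1) * L.card := by
    rw [← hSL] at hZcard
    nlinarith
  have hLne : L.Nonempty := by
    rw [← Finset.card_pos]
    by_contra h0
    have : L.card = 0 := by omega
    rw [this] at hZcard'
    omega
  obtain ⟨u, huL, N, hNcard, hNadj, hNW⟩ := hlarge L (L ∪ Z) Finset.subset_union_left hLne hLlarge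
    (by have := Finset.card_union_le L Z; nlinarith) (by omega)
  have hNsub : N ⊆ (N.filter (· ∈ S)) ∪ (N.filter (· ∈ U)) ∪ ((L ∪ Z).filter (· ∈ N)) := by
    intro v hv
    simp only [Finset.mem_union, Finset.mem_filter]
    by_cases hvA : v ∈ A
    · by_cases hvs : small v
      · exact Or.inl (Or.inl ⟨hv, Finset.mem_filter.2 ⟨hvA, hvs⟩⟩)
      · exact Or.inr ⟨Or.inl (Finset.mem_filter.2 ⟨hvA, hvs⟩), hv⟩
    · by_cases hvU : v ∈ U
      · exact Or.inl (Or.inr ⟨hv, hvU⟩)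
      · exact Or.inr ⟨Or.inr (Finset.mem_sdiff.2
          ⟨(hmemB v).2 ⟨hvA, u, hLA u huL, hNadj v hv⟩, hvU⟩), hv⟩
  have hNS : (N.filter (· ∈ S)).card ≤ 1 := by
    rw [Finset.card_le_one]
    intro s hs s' hs'
    obtain ⟨hsN, hsS⟩ := Finset.mem_filter.1 hs
    obtain ⟨hsN', hsS'⟩ := Finset.mem_filter.1 hs'
    by_contra hne
    exact hcommon s s' u (hSsmall s hsS) (hSsmall s' hsS') hne (hNadj s hsN).symm (hNadj s' hsN')
  -- If the neighbours of `u` met `c` stars, one neighbour from each would give the `c` paths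
  -- excluded by `hpaths`.
  have hNU : (N.filter (· ∈ U)).card ≤ k * c := by
    set T := S.filter fun s => (N ∩ Y s).Nonempty with hT
    have hTc : T.card < c := by
      by_contra! hcT
      obtain ⟨T', hT', hT'c⟩ := Finset.exists_subset_card_eq hcT
      set φ := T'.equivFinOfCardEq hT'c
      have hmem : ∀ i, ((φ.symm i : T') : Fin n) ∈ T := fun i => hT' (φ.symm i).2
      have hne : ∀ i, ∃ y, y ∈ N ∩ Y (φ.symm i : T') := fun i => (Finset.mem_filter.1 (hmem i)).2
      choose y hy using hne
      have hST : ∀ i, ((φ.symm i : T') : Fin n) ∈ S := fun i => (Finset.mem_filter.1 (hmem i)).1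
      have hsinj : Function.Injective fun i => ((φ.symm i : T') : Fin n) :=
        Subtype.val_injective.comp φ.symm.injective
      refine hpaths u y (fun i => (φ.symm i : T')) ?_ hsinj (hLlarge u huL) (fun i => ?_)
        (fun i => hSsmall _ (hST i)) fun i => ⟨hNadj _ (Finset.mem_inter.1 (hy i)).1,
          (hYadj _ _ (Finset.mem_inter.1 (hy i)).2).symm⟩
      · intro i j hij
        by_contra hne
        have := hdisj _ (hST i) _ (hST j) (fun h => hne (hsinj h))
        refine Finset.disjoint_left.1 this (Finset.mem_inter.1 (hy i)).2 ?_
        rw [hij]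
        exact (Finset.mem_inter.1 (hy j)).2
      · exact hUsmall _ (Finset.mem_biUnion.2 ⟨_, hST i, (Finset.mem_inter.1 (hy i)).2⟩)
    have hsub : N.filter (· ∈ U) ⊆ T.biUnion Y := by
      intro v hv
      obtain ⟨hvN, hvU⟩ := Finset.mem_filter.1 hv
      obtain ⟨s, hs, hvs⟩ := Finset.mem_biUnion.1 hvU
      exact Finset.mem_biUnion.2 ⟨s, Finset.mem_filter.2 ⟨hs, v, Finset.mem_inter.2 ⟨hvN, hvs⟩⟩, hvs⟩
    calc (N.filter (· ∈ U)).card ≤ (T.biUnion Y).card := Finset.card_le_card hsub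
      _ ≤ ∑ s ∈ T, (Y s).card := Finset.card_biUnion_le
      _ = T.card * k := Finset.sum_const_nat fun s _ => hYc s
      _ ≤ k * c := by rw [mul_comm]; gcongr
  have h1 := Finset.card_le_card hNsub
  have h2 := Finset.card_union_le (N.filter (· ∈ S) ∪ N.filter (· ∈ U)) ((L ∪ Z).filter (· ∈ N))
  have h3 := Finset.card_union_le (N.filter (· ∈ S)) (N.filter (· ∈ U))
  omega

end Graphs

/-! ### Early edges of large vertices: union bounds over sets. -/

lemma choose_mul_pow_self_le (n w : ℕ) : (n.choose w : ℝ) * (w : ℝ) ^ w ≤ (Real.exp 1 * n) ^ w := by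
  have h1 : (n.choose w : ℝ) ≤ (n : ℝ) ^ w / (w.factorial : ℝ) := Nat.choose_le_pow_div w n
  have h2 : (w : ℝ) ^ w / (w.factorial : ℝ) ≤ Real.exp w :=
    Real.pow_div_factorial_le_exp w (Nat.cast_nonneg w) w
  have h3 : Real.exp 1 ^ w = Real.exp w := by rw [← Real.exp_nat_mul, mul_one]
  calc (n.choose w : ℝ) * (w : ℝ) ^ w ≤ (n : ℝ) ^ w / (w.factorial : ℝ) * (w : ℝ) ^ w := by gcongr
    _ = (n : ℝ) ^ w * ((w : ℝ) ^ w / (w.factorial : ℝ)) := by ring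
    _ ≤ (n : ℝ) ^ w * Real.exp w := by gcongr
    _ = _ := by rw [mul_pow, h3, mul_comm]

/-- As `C(n,w) ≤ (en/w)^w`, the square of `w/n` beats the number of sets of size `w` and leaves
`(2e² w/n)^w`. One factor is kept for the `1/n`; the others are at most `1/4` and make the sum
geometric. -/
lemma sum_finset_le_div {n : ℕ} (hn : 0 < n) {β : ℝ} (hβ : 2 * Real.exp 1 ^ 2 * β ≤ 1 / 4) :
    ∑ W : Finset (Fin n), (if W.Nonempty ∧ (W.card : ℝ) ≤ β * n then
        (2 * Real.exp 1 * ((W.card : ℝ) / n) ^ 2) ^ W.card else 0)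
      ≤ 16 * Real.exp 1 ^ 2 / n := by
  have hn' : (0 : ℝ) < n := by exact_mod_cast hn
  set f : ℕ → ℝ := fun w => if 0 < w ∧ (w : ℝ) ≤ β * n then
    (2 * Real.exp 1 * ((w : ℝ) / n) ^ 2) ^ w else 0 with hf
  have h1 : ∑ W : Finset (Fin n), (if W.Nonempty ∧ (W.card : ℝ) ≤ β * n then
        (2 * Real.exp 1 * ((W.card : ℝ) / n) ^ 2) ^ W.card else 0)
      = ∑ w ∈ Finset.range (n + 1), n.choose w • f w := by
    have := Finset.sum_powerset_apply_card f (x := (Finset.univ : Finset (Fin n)))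
    rw [Finset.powerset_univ, Finset.card_fin] at this
    rw [← this]
    simp only [hf, Finset.card_pos]
  rw [h1]
  have h2 : ∀ w, n.choose w • f w ≤ 8 * Real.exp 1 ^ 2 / n * (1 / 2 : ℝ) ^ w := by
    intro w
    simp only [hf]
    split_ifs with hw
    · obtain ⟨hw0, hwβ⟩ := hw
      have hw' : (0 : ℝ) < w := by exact_mod_cast hw0
      set q : ℝ := 2 * Real.exp 1 ^ 2 * (w / n) with hq
      have hq0 : 0 ≤ q := by positivity
      have hq1 : q ≤ 1 / 4 := by
        refine le_trans ?_ hβ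
        rw [hq]
        gcongr
        rw [div_le_iff₀ hn']; exact hwβ
      have h3 : (n.choose w : ℝ) * (2 * Real.exp 1 * ((w : ℝ) / n) ^ 2) ^ w ≤ q ^ w := by
        have e : (2 * Real.exp 1 * ((w : ℝ) / n) ^ 2) ^ w
            = (w : ℝ) ^ w * (2 * Real.exp 1 * (w / n ^ 2)) ^ w := by
          rw [← mul_pow]; congr 1; ring
        rw [e, ← mul_assoc]
        calc _ ≤ (Real.exp 1 * n) ^ w * (2 * Real.exp 1 * (w / n ^ 2)) ^ w := by
              gcongr
              exact choose_mul_pow_self_le n w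
          _ = q ^ w := by
              rw [← mul_pow, hq]; congr 1; field_simp
      rw [nsmul_eq_mul]
      refine h3.trans ?_
      obtain ⟨w', rfl⟩ : ∃ w', w = w' + 1 := ⟨w - 1, by omega⟩
      have h4 : q ^ w' ≤ (1 / 4) ^ w' := by gcongr
      have h5 : ((w' + 1 : ℕ) : ℝ) ≤ 2 ^ (w' + 1) := by
        exact_mod_cast (Nat.lt_two_pow_self).le
      have h6 : (1 / 4 : ℝ) ^ (w' + 1) * 2 ^ (w' + 1) = (1 / 2) ^ (w' + 1) := by
        rw [← mul_pow]; norm_num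
      calc q ^ (w' + 1) = q * q ^ w' := by ring
        _ ≤ q * (1 / 4) ^ w' := by gcongr
        _ = 8 * Real.exp 1 ^ 2 / n * ((1 / 4 : ℝ) ^ (w' + 1) * ((w' + 1 : ℕ) : ℝ)) := by
            rw [hq]; ring
        _ ≤ 8 * Real.exp 1 ^ 2 / n * ((1 / 4 : ℝ) ^ (w' + 1) * 2 ^ (w' + 1)) := by gcongr
        _ = _ := by rw [h6]
    · rw [smul_zero]; positivity
  calc _ ≤ ∑ w ∈ Finset.range (n + 1), 8 * Real.exp 1 ^ 2 / n * (1 / 2 : ℝ) ^ w :=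
        Finset.sum_le_sum fun w _ => h2 w
    _ = 8 * Real.exp 1 ^ 2 / n * ∑ w ∈ Finset.range (n + 1), (1 / 2 : ℝ) ^ w := by
        rw [Finset.mul_sum]
    _ ≤ 8 * Real.exp 1 ^ 2 / n * 2 := by
        gcongr
        exact sum_geometric_two_le _
    _ = _ := by ring

section Large

variable {n : ℕ} (R : RateMatrix n)

/-- A time by which a vertex normally has a given number of neighbours, with an exceptional
probability that is a large power of `|W| / n`. -/
noncomputable def largeTime (K : ℕ) (W : Finset (Fin n)) (u : Fin n) : ℝ :=
  36 * K * -Real.log ((W.card : ℝ) / n) / R.deg u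

lemma largeTime_nonneg {α γ b d : ℝ} (h : IsRMAt R α γ b d) (K : ℕ) (W : Finset (Fin n))
    (u : Fin n) : 0 ≤ largeTime R K W u := by
  have hlog : Real.log ((W.card : ℝ) / n) ≤ 0 := by
    refine Real.log_nonpos (by positivity) (div_le_one_of_le₀ ?_ (by positivity))
    exact_mod_cast (Finset.card_le_univ W).trans_eq (Fintype.card_fin n)
  have := h.deg_pos u
  have : 0 ≤ -Real.log ((W.card : ℝ) / n) := by linarith
  unfold largeTime
  positivity

lemma sum_rate_mul_largeTime {α γ b d : ℝ} (h : IsRMAt R α γ b d) (K : ℕ) (W : Finset (Fin n))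
    (u : Fin n) : ∑ v ∈ W, R.rate u v * largeTime R K W u
      = 36 * K * -Real.log ((W.card : ℝ) / n) * R.hitProb W u := by
  rw [← Finset.sum_mul, largeTime, RateMatrix.hitProb]
  have := (h.deg_pos u).ne'
  field_simp

/-- It is unlikely that many vertices hit a small set often. -/
lemma measureReal_hits_ge_le {α γ b d : ℝ} (h : IsRMAt R α γ b d) {δ : ℝ} (hδ : 0 < δ) {K D₂ : ℕ}
    (hK : 1 ≤ K) (hD₂ : 24 * K ≤ δ * D₂) {L W : Finset (Fin n)} (hL : L ⊆ W) (hW : W.Nonempty)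
    (hcard : W.card ≤ 3 * K * L.card) (hW1 : (W.card : ℝ) / n ≤ 1)
    (hlog : 36 * K * -Real.log ((W.card : ℝ) / n) * ((W.card : ℝ) / n) ^ (δ / 2) ≤ 1)
    (hhit : ∀ u ∈ L, R.hitProb W u ≤ ((W.card : ℝ) / n) ^ δ) :
    (clocksLaw R).real {E | ∀ u ∈ L, D₂ ≤ hits E W (largeTime R K W u) u}
      ≤ 2 * (Real.exp W.card * ((W.card : ℝ) / n) ^ (2 * W.card)) := by
  have hn := h.n_pos
  have hWc : (0 : ℝ) < W.card := by exact_mod_cast hW.card_pos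
  have hcard' : (W.card : ℝ) ≤ 3 * K * L.card := by exact_mod_cast hcard
  have hLW : (L.card : ℝ) ≤ W.card := by exact_mod_cast Finset.card_le_card hL
  have hK' : (1 : ℝ) ≤ K := by exact_mod_cast hK
  set x : ℝ := (W.card : ℝ) / n with hx
  have hx0 : 0 < x := by positivity
  have hl0 : 0 ≤ -Real.log x := by linarith [Real.log_nonpos hx0.le hW1]
  -- With this tilt the mean contributes at most `e^|W|`, and the tail is `x^(δ D₂ |L| / 4) ≤
  -- x^(6K|L|) ≤ x^(2|W|)`; this is where `24 K ≤ δ D₂` comes from.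
  have hz : 1 ≤ x ^ (-(δ / 2)) := Real.one_le_rpow_of_pos_of_le_one_of_nonpos hx0 hW1 (by linarith)
  have key := measureReal_sum_hits_ge R L W (t := largeTime R K W) (largeTime_nonneg R h K W) hz
    (D₂ * L.card)
  refine (measureReal_mono ?_).trans (key.trans ?_)
  · intro E hE
    simp only [Set.mem_ofPred_eq] at hE ⊢
    calc (D₂ * L.card : ℝ) = ∑ _u ∈ L, (D₂ : ℝ) := by simp [mul_comm]
      _ ≤ _ := Finset.sum_le_sum fun u hu => by exact_mod_cast hE u hu
  · have h1 : x ^ (-(δ / 2)) * ∑ u ∈ L, ∑ v ∈ W, R.rate u v * largeTime R K W u ≤ W.card := by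
      have h2 : ∑ u ∈ L, ∑ v ∈ W, R.rate u v * largeTime R K W u
          ≤ ∑ _u ∈ L, 36 * K * -Real.log x * x ^ δ := by
        refine Finset.sum_le_sum fun u hu => ?_
        rw [sum_rate_mul_largeTime R h]
        have := hhit u hu
        gcongr
      rw [Finset.sum_const, nsmul_eq_mul] at h2
      have h3 : x ^ (-(δ / 2)) * x ^ δ = x ^ (δ / 2) := by
        rw [← Real.rpow_add hx0]; congr 1; ring
      calc _ ≤ x ^ (-(δ / 2)) * (L.card * (36 * K * -Real.log x * x ^ δ)) := by gcongr
        _ = L.card * (36 * K * -Real.log x * (x ^ (-(δ / 2)) * x ^ δ)) := by ring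
        _ = L.card * (36 * K * -Real.log x * x ^ (δ / 2)) := by rw [h3]
        _ ≤ L.card * 1 := by gcongr
        _ ≤ W.card := by rw [mul_one]; exact hLW
    have h4 : (x ^ (-(δ / 2))) ^ (-(D₂ * L.card / 2 : ℝ)) ≤ x ^ (2 * W.card) := by
      rw [← Real.rpow_mul hx0.le, ← Real.rpow_natCast]
      refine Real.rpow_le_rpow_of_exponent_ge hx0 hW1 ?_
      push_cast
      have : 24 * K * L.card ≤ δ * D₂ * L.card := by gcongr
      linarith
    gcongr 2 * ?_
    rw [mul_comm (Real.exp _)]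
    gcongr

/-- It is unlikely that many vertices have a small degree. -/
lemma measureReal_degree_lt_le {α γ b d : ℝ} (h : IsRMAt R α γ b d) {K D₁ : ℕ}
    (hK : 1 ≤ K) {L W : Finset (Fin n)} (hL : L ⊆ W) (hW : W.Nonempty)
    (hcard : W.card ≤ 3 * K * L.card) (hW1 : (W.card : ℝ) / n ≤ 1)
    (hD₁ : 4 ^ D₁ * ((W.card : ℝ) / n) ≤ 1)
    (hn : 36 * K * Real.log n * (n : ℝ) ^ (-γ) ≤ 1)
    (hhit : ∀ u ∈ L, R.hitProb W u ≤ 1 / 2) :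
    (clocksLaw R).real
        {E | ∀ u ∈ L, degree (processGraph E (ENNReal.ofReal (largeTime R K W u))) u < D₁}
      ≤ ((W.card : ℝ) / n) ^ (2 * W.card) := by
  classical
  have hn0 := h.n_pos
  have hWc : (0 : ℝ) < W.card := by exact_mod_cast hW.card_pos
  have hWc1 : (1 : ℝ) ≤ W.card := by exact_mod_cast hW.card_pos
  have hK' : (1 : ℝ) ≤ K := by exact_mod_cast hK
  set x : ℝ := (W.card : ℝ) / n with hx
  have hx0 : 0 < x := by positivity
  have hl0 : 0 ≤ -Real.log x := by linarith [Real.log_nonpos hx0.le hW1]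
  have hln : -Real.log x ≤ Real.log n := by
    rw [hx, Real.log_div hWc.ne' hn0.ne']
    linarith [Real.log_nonneg hWc1]
  have key := measureReal_joint_le R (X := L) (S := L) (J := ∅) subset_rfl (by simp) (by simp)
    (t₁ := 0) le_rfl (t := largeTime R K W) (z := fun _ => 4) (largeTime_nonneg R h K W)
    (fun u _ v => ?_) (fun _ _ => by norm_num) D₁
  · simp only [Finset.notMem_empty, false_imp_iff, implies_true, true_and, Finset.prod_empty,
      one_mul] at key
    refine key.trans ?_
    -- Half of the rate leaves `L`, and the tilt `z = 4` halves again, so `36K` becomes `x^(9K)`.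
    -- One factor `x` pays for `4^D₁`; the other `8K` give `x^(2|W|)` since `|W| ≤ 3K|L|`.
    have hfac : ∀ u ∈ L, (4 : ℝ) ^ D₁ * Real.exp (-((1 - 2 / 4) *
        ∑ v ∈ Lᶜ, R.rate u v * largeTime R K W u)) ≤ x ^ (8 * K) := by
      intro u hu
      have hdeg := h.deg_pos u
      have h1 : R.deg u / 2 ≤ ∑ v ∈ Lᶜ, R.rate u v := by
        have e1 : ∑ v ∈ L, R.rate u v + ∑ v ∈ Lᶜ, R.rate u v = R.deg u :=
          Finset.sum_add_sum_compl L _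
        have e2 : ∑ v ∈ L, R.rate u v ≤ ∑ v ∈ W, R.rate u v :=
          Finset.sum_le_sum_of_subset_of_nonneg hL fun v _ _ => R.nonneg u v
        have e3 := hhit u hu
        rw [RateMatrix.hitProb, div_le_iff₀ hdeg] at e3
        linarith
      have h2 : 18 * K * -Real.log x ≤ ∑ v ∈ Lᶜ, R.rate u v * largeTime R K W u := by
        rw [← Finset.sum_mul]
        have := largeTime_nonneg R h K W u
        calc 18 * K * -Real.log x = R.deg u / 2 * largeTime R K W u := by
              rw [largeTime, ← hx]; field_simp; ring
          _ ≤ _ := by gcongr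
      have h3 : Real.exp (-((1 - 2 / 4) * ∑ v ∈ Lᶜ, R.rate u v * largeTime R K W u))
          ≤ x ^ (9 * K) := by
        rw [← Real.rpow_natCast, Real.rpow_def_of_pos hx0, Real.exp_le_exp]
        push_cast
        linarith
      have h4 : x ^ (9 * K) ≤ x * x ^ (8 * K) := by
        rw [← pow_succ']
        exact pow_le_pow_of_le_one hx0.le hW1 (by omega)
      calc _ ≤ (4 : ℝ) ^ D₁ * (x * x ^ (8 * K)) := by gcongr; exact h3.trans h4
        _ = ((4 : ℝ) ^ D₁ * x) * x ^ (8 * K) := by ring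
        _ ≤ 1 * x ^ (8 * K) := by gcongr
        _ = _ := one_mul _
    refine (Finset.prod_le_prod (fun u _ => by positivity) hfac).trans ?_
    rw [Finset.prod_const, ← pow_mul]
    exact pow_le_pow_of_le_one hx0.le hW1 (by nlinarith)
  · have h1 := h.rate_le u v
    have hdeg := h.deg_pos u
    have h2 := h.le_deg u
    have hd := h.d_pos
    have h3 : R.rate u v ≤ R.deg u * (n : ℝ) ^ (-γ) := h1.trans (by gcongr)
    calc R.rate u v * largeTime R K W u
        ≤ R.deg u * (n : ℝ) ^ (-γ) * largeTime R K W u := by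
          gcongr; exact largeTime_nonneg R h K W u
      _ = 36 * K * -Real.log x * (n : ℝ) ^ (-γ) := by
          rw [largeTime, ← hx]; field_simp
      _ ≤ 36 * K * Real.log n * (n : ℝ) ^ (-γ) := by gcongr
      _ ≤ 1 := hn

end Large

/-- The event that all vertices of some set `L` have low degree or hit a not much larger set `W`
often. -/
def LargeBad {n : ℕ} (R : RateMatrix n) (K D₁ D₂ : ℕ) (β : ℝ) : Set (Clocks n) :=
  {E | ∃ L W : Finset (Fin n), L ⊆ W ∧ L.Nonempty ∧ W.card ≤ K * L.card ∧ (W.card : ℝ) ≤ β * n ∧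
    ∀ u ∈ L, D₁ ≤ degree (processGraph E (ENNReal.ofReal (largeTime R K W u))) u →
      D₂ ≤ hits E W (largeTime R K W u) u}

/-- After removal of the exceptional vertices of `W`, those of `L` that hit `W` often or those of
low degree still number at least `|W|/(3K)`. Both events have probability of order `e^|W|
(|W|/n)^(2|W|)`, which survives the union bound over `W` and over the `2^|W|` subsets. -/
lemma measureReal_largeBad_le {n : ℕ} {R : RateMatrix n} {α γ b d : ℝ} (h : IsRMAt R α γ b d)
    {δ β : ℝ} {K D₁ D₂ : ℕ} (hδ : 0 < δ) (hK : 1 ≤ K) (hD₂ : 24 * K ≤ δ * D₂)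
    (hexc : ∀ W : Finset (Fin n), W.Nonempty → (W.card : ℝ) ≤ β * n →
      ((Finset.univ.filter fun u => ((W.card : ℝ) / n) ^ δ < R.hitProb W u).card : ℝ)
          ≤ ((W.card : ℝ) / n) ^ δ * W.card)
    (hβ : ∀ x : ℝ, 0 < x → x ≤ β → x ≤ 1 ∧ 36 * K * -Real.log x * x ^ (δ / 2) ≤ 1 ∧
      4 ^ D₁ * x ≤ 1 ∧ x ^ δ ≤ 1 / (3 * K))
    (hβe : 2 * Real.exp 1 ^ 2 * β ≤ 1 / 4)
    (hn : 36 * K * Real.log n * (n : ℝ) ^ (-γ) ≤ 1) :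
    (clocksLaw R).real (LargeBad R K D₁ D₂ β) ≤ 48 * Real.exp 1 ^ 2 / n := by
  classical
  have hn0 := h.n_pos
  have hK' : (1 : ℝ) ≤ K := by exact_mod_cast hK
  set 𝓦 : Finset (Finset (Fin n)) :=
    Finset.univ.filter fun W => W.Nonempty ∧ (W.card : ℝ) ≤ β * n with h𝓦
  set 𝓛 : Finset (Fin n) → Finset (Finset (Fin n)) := fun W => W.powerset.filter fun L =>
    W.card ≤ 3 * K * L.card ∧ ∀ u ∈ L, R.hitProb W u ≤ ((W.card : ℝ) / n) ^ δ with h𝓛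
  set F : Finset (Fin n) → Finset (Fin n) → Set (Clocks n) := fun W L =>
    {E | ∀ u ∈ L, D₂ ≤ hits E W (largeTime R K W u) u} with hF
  set G : Finset (Fin n) → Finset (Fin n) → Set (Clocks n) := fun W L =>
    {E | ∀ u ∈ L, degree (processGraph E (ENNReal.ofReal (largeTime R K W u))) u < D₁} with hG
  have hsub : LargeBad R K D₁ D₂ β ⊆ ⋃ W ∈ 𝓦, ⋃ L ∈ 𝓛 W, (F W L ∪ G W L) := by
    rintro E ⟨L, W, hLW, hLne, hWL, hWβ, hall⟩
    have hWne := hLne.mono hLW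
    have hWc : (0 : ℝ) < W.card := by exact_mod_cast hWne.card_pos
    have hx0 : 0 < (W.card : ℝ) / n := by positivity
    obtain ⟨-, -, -, hx4⟩ := hβ _ hx0 ((div_le_iff₀ hn0).2 hWβ)
    have hexcW := hexc W hWne hWβ
    set X := Finset.univ.filter fun u => ((W.card : ℝ) / n) ^ δ < R.hitProb W u with hX
    have hXc : 3 * K * X.card ≤ W.card := by
      have : (X.card : ℝ) ≤ 1 / (3 * K) * W.card := hexcW.trans (by gcongr)
      rw [one_div, inv_mul_eq_div, le_div_iff₀ (by positivity)] at this
      have h' : ((3 * K * X.card : ℕ) : ℝ) ≤ W.card := by push_cast; linarith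
      exact_mod_cast h'
    set L₁ := (L \ X).filter fun u => D₂ ≤ hits E W (largeTime R K W u) u with hL₁
    set L₂ := (L \ X).filter fun u => ¬ D₂ ≤ hits E W (largeTime R K W u) u with hL₂
    have hL₁₂ : L₁.card + L₂.card = (L \ X).card := Finset.card_filter_add_card_filter_not _
    have hLX := Finset.le_card_sdiff X L
    have hhit : ∀ u ∈ L \ X, R.hitProb W u ≤ ((W.card : ℝ) / n) ^ δ := by
      intro u hu
      have := (Finset.mem_sdiff.1 hu).2
      simpa [hX] using this
    -- From `|W| ≤ K|L|` and `3K|X| ≤ |W|`: the part of `L` outside `X` satisfies `3K|L \ X| ≥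
    -- 2|W|`.
    have hbig : 2 * W.card ≤ 3 * K * L₁.card + 3 * K * L₂.card := by
      have h1 : L.card ≤ L₁.card + L₂.card + X.card := by omega
      nlinarith
    simp only [Set.mem_iUnion]
    have hLXW : L \ X ⊆ W := Finset.sdiff_subset.trans hLW
    refine ⟨W, Finset.mem_filter.2 ⟨Finset.mem_univ _, hWne, hWβ⟩, ?_⟩
    rcases le_total W.card (3 * K * L₁.card) with hc | hc
    · refine ⟨L₁, Finset.mem_filter.2 ⟨Finset.mem_powerset.2
        ((Finset.filter_subset _ _).trans hLXW), hc,
        fun u hu => hhit u (Finset.mem_filter.1 hu).1⟩, Or.inl fun u hu => (Finset.mem_filter.1 hu).2⟩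
    · refine ⟨L₂, Finset.mem_filter.2 ⟨Finset.mem_powerset.2
        ((Finset.filter_subset _ _).trans hLXW), by omega,
        fun u hu => hhit u (Finset.mem_filter.1 hu).1⟩, Or.inr fun u hu => ?_⟩
      obtain ⟨h1, h2⟩ := Finset.mem_filter.1 hu
      by_contra h3
      exact h2 (hall u (Finset.mem_sdiff.1 h1).1 (not_lt.1 h3))
  have hterm : ∀ W ∈ 𝓦, (clocksLaw R).real (⋃ L ∈ 𝓛 W, (F W L ∪ G W L))
      ≤ 3 * (2 * Real.exp 1 * ((W.card : ℝ) / n) ^ 2) ^ W.card := by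
    intro W hW
    obtain ⟨-, hWne, hWβ⟩ := Finset.mem_filter.1 hW
    have hWc : (0 : ℝ) < W.card := by exact_mod_cast hWne.card_pos
    have hx0 : 0 < (W.card : ℝ) / n := by positivity
    obtain ⟨hx1, hx2, hx3, hx4⟩ := hβ _ hx0 ((div_le_iff₀ hn0).2 hWβ)
    set x := (W.card : ℝ) / n with hx
    have hhalf : x ^ δ ≤ 1 / 2 := hx4.trans (by
      rw [div_le_div_iff₀ (by positivity) (by norm_num)]; linarith)
    have hone : ∀ L ∈ 𝓛 W, (clocksLaw R).real (F W L ∪ G W L)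
        ≤ 3 * (Real.exp W.card * x ^ (2 * W.card)) := by
      intro L hL
      obtain ⟨hLW, hLc, hLh⟩ := Finset.mem_filter.1 hL
      have hLW := Finset.mem_powerset.1 hLW
      have h1 := measureReal_hits_ge_le R h hδ hK hD₂ hLW hWne hLc hx1 hx2 hLh
      have h2 := measureReal_degree_lt_le R h (D₁ := D₁) hK hLW hWne hLc hx1 hx3 hn
        fun u hu => (hLh u hu).trans hhalf
      have h3 : x ^ (2 * W.card) ≤ Real.exp W.card * x ^ (2 * W.card) :=
        le_mul_of_one_le_left (by positivity) (Real.one_le_exp (by positivity))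
      have := measureReal_union_le (μ := clocksLaw R) (F W L) (G W L)
      linarith
    calc _ ≤ ∑ L ∈ 𝓛 W, (clocksLaw R).real (F W L ∪ G W L) := measureReal_biUnion_finset_le _ _
      _ ≤ ∑ _L ∈ 𝓛 W, 3 * (Real.exp W.card * x ^ (2 * W.card)) := Finset.sum_le_sum hone
      _ = (𝓛 W).card * (3 * (Real.exp W.card * x ^ (2 * W.card))) := by
          rw [Finset.sum_const, nsmul_eq_mul]
      _ ≤ 2 ^ W.card * (3 * (Real.exp W.card * x ^ (2 * W.card))) := by
          gcongr
          have : (𝓛 W).card ≤ 2 ^ W.card := by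
            rw [← Finset.card_powerset]
            exact Finset.card_filter_le _ _
          exact_mod_cast this
      _ = _ := by
          have : Real.exp W.card = Real.exp 1 ^ W.card := by rw [← Real.exp_nat_mul, mul_one]
          rw [this, mul_pow, mul_pow, ← pow_mul]; ring
  calc _ ≤ (clocksLaw R).real (⋃ W ∈ 𝓦, ⋃ L ∈ 𝓛 W, (F W L ∪ G W L)) :=
        measureReal_mono hsub (measure_ne_top _ _)
    _ ≤ ∑ W ∈ 𝓦, (clocksLaw R).real (⋃ L ∈ 𝓛 W, (F W L ∪ G W L)) :=
        measureReal_biUnion_finset_le _ _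
    _ ≤ ∑ W ∈ 𝓦, 3 * (2 * Real.exp 1 * ((W.card : ℝ) / n) ^ 2) ^ W.card := Finset.sum_le_sum hterm
    _ = 3 * ∑ W : Finset (Fin n), (if W.Nonempty ∧ (W.card : ℝ) ≤ β * n then
        (2 * Real.exp 1 * ((W.card : ℝ) / n) ^ 2) ^ W.card else 0) := by
        rw [← Finset.mul_sum, h𝓦, Finset.sum_filter]
    _ ≤ 3 * (16 * Real.exp 1 ^ 2 / n) := by
        gcongr
        exact sum_finset_le_div (by exact_mod_cast hn0) hβe
    _ = _ := by ring

lemma tendsto_log_mul_rpow_neg {c γ : ℝ} (hγ : 0 < γ) :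
    Tendsto (fun n : ℕ => c * Real.log n * (n : ℝ) ^ (-γ)) atTop (𝓝 0) := by
  have h := ((isLittleO_log_rpow_atTop hγ).tendsto_div_nhds_zero.comp
    tendsto_natCast_atTop_atTop).const_mul c
  rw [mul_zero] at h
  refine h.congr fun n => ?_
  simp only [Function.comp_apply]
  rw [Real.rpow_neg (Nat.cast_nonneg n)]
  ring

/-- Whp no set of large vertices sends too many of its first edges into a set of comparable size. -/
theorem exists_tendsto_largeBad {R : (n : ℕ) → RateMatrix n} {α γ b : ℝ} {d : ℕ → ℝ}
    (hR : IsRM R α γ b d) {K : ℕ} (hK : 1 ≤ K) : ∃ D₂ : ℕ, ∀ D₁ : ℕ, ∃ β : ℝ, 0 < β ∧ β < 1 ∧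
      Tendsto (fun n => (clocksLaw (R n)).real (LargeBad (R n) K D₁ D₂ β)) atTop (𝓝 0) := by
  obtain ⟨δ, β₀, hδ, hβ₀, -, hexc⟩ :=
    exists_card_exceptional_le hR.alpha_nonneg hR.alpha_lt hR.gamma_pos hR.b_pos
  have hK' : (1 : ℝ) ≤ K := by exact_mod_cast hK
  obtain ⟨D₂, hD₂⟩ := exists_nat_ge (24 * K / δ)
  rw [div_le_iff₀ hδ, mul_comm (D₂ : ℝ)] at hD₂
  -- `D₂` depends only on `δ` and `K`, so `D₁` may later be chosen in terms of `D₂`; only `β` has to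
  -- depend on `D₁`.
  refine ⟨D₂, fun D₁ => ?_⟩
  have hid : Tendsto (fun x : ℝ => x) (𝓝[>] 0) (𝓝 0) := tendsto_id.mono_left nhdsWithin_le_nhds
  have e1 : ∀ᶠ x : ℝ in 𝓝[>] 0, x < 1 := hid.eventually_lt_const one_pos
  have e2 : ∀ᶠ x : ℝ in 𝓝[>] 0, 36 * K * -Real.log x * x ^ (δ / 2) < 1 := by
    have h := (tendsto_log_mul_rpow_nhdsGT_zero (half_pos hδ)).const_mul (-(36 * K : ℝ))
    rw [mul_zero] at h
    filter_upwards [h.eventually_lt_const one_pos] with x hx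
    linarith
  have e3 : ∀ᶠ x : ℝ in 𝓝[>] 0, 4 ^ D₁ * x < 1 := by
    have h := hid.const_mul ((4 : ℝ) ^ D₁)
    rw [mul_zero] at h
    exact h.eventually_lt_const one_pos
  have e4 : ∀ᶠ x : ℝ in 𝓝[>] 0, x ^ δ < 1 / (3 * K) := by
    have h := hid.rpow_const (p := δ) (Or.inr hδ.le)
    rw [Real.zero_rpow hδ.ne'] at h
    exact h.eventually_lt_const (by positivity)
  have e5 : ∀ᶠ x : ℝ in 𝓝[>] 0, 2 * Real.exp 1 ^ 2 * x < 1 / 4 := by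
    have h := hid.const_mul (2 * Real.exp 1 ^ 2)
    rw [mul_zero] at h
    exact h.eventually_lt_const (by norm_num)
  obtain ⟨r, hr, hrall⟩ := mem_nhdsGT_iff_exists_Ioo_subset.1
    (e1.and (e2.and (e3.and (e4.and e5))))
  have hr : 0 < r := hr
  set β := min β₀ (r / 2) with hβ
  have hβ0 : 0 < β := lt_min hβ₀ (half_pos hr)
  have hβr : β < r := (min_le_right _ _).trans_lt (half_lt_self hr)
  have hβin : ∀ x, 0 < x → x ≤ β → x ∈ Set.Ioo 0 r := fun x h1 h2 => ⟨h1, h2.trans_lt hβr⟩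
  refine ⟨β, hβ0, (hrall (hβin β hβ0 le_rfl)).1, ?_⟩
  have hlim : Tendsto (fun n : ℕ => 48 * Real.exp 1 ^ 2 / (n : ℝ)) atTop (𝓝 0) :=
    tendsto_const_div_atTop_nhds_zero_nat _
  refine tendsto_of_tendsto_of_tendsto_of_le_of_le' tendsto_const_nhds hlim
    (Eventually.of_forall fun n => measureReal_nonneg) ?_
  filter_upwards [hR.eventually_isRMAt,
    (tendsto_log_mul_rpow_neg (c := 36 * K) hR.gamma_pos).eventually_le_const one_pos] with n hn hlog
  refine measureReal_largeBad_le hn hδ hK hD₂ (fun W hW hWβ => hexc n (R n) (d n) hn W hW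
    (hWβ.trans (by gcongr; exact min_le_left _ _))) (fun x hx0 hxβ => ?_) ?_ hlog
  · obtain ⟨h1, h2, h3, h4, -⟩ := hrall (hβin x hx0 hxβ)
    exact ⟨h1.le, h2.le, h3.le, h4.le⟩
  · exact (hrall (hβin β hβ0 le_rfl)).2.2.2.2.le

/-! ### Isolated vertices and the lower bound for the hitting time. -/

/-- The second moment method. -/
lemma measureReal_forall_notMem_le {Ω ι : Type*} [MeasurableSpace Ω] [Fintype ι] (μ : Measure Ω)
    [IsProbabilityMeasure μ] {A : ι → Set Ω} (hA : ∀ i, MeasurableSet (A i)) {κ : ℝ}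
    (hm : 0 < ∑ i, μ.real (A i))
    (hpair : ∑ i, ∑ j, μ.real (A i ∩ A j) ≤ ∑ i, μ.real (A i) + (1 + κ) * (∑ i, μ.real (A i)) ^ 2) :
    μ.real {ω | ∀ i, ω ∉ A i} ≤ 1 / ∑ i, μ.real (A i) + κ := by
  set m := ∑ i, μ.real (A i) with hmdef
  set X : Ω → ℝ := fun ω => ∑ i, (A i).indicator (fun _ => (1 : ℝ)) ω with hX
  have hint : ∀ s : Set Ω, MeasurableSet s → Integrable (s.indicator fun _ => (1 : ℝ)) μ :=
    fun s hs => (integrable_const _).indicator hs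
  have hXint : Integrable X μ := integrable_finsetSum _ fun i _ => hint _ (hA i)
  have hEX : ∫ ω, X ω ∂μ = m := by
    rw [hX, integral_finsetSum _ fun i _ => hint _ (hA i)]
    exact Finset.sum_congr rfl fun i _ => by rw [integral_indicator_const _ (hA i)]; simp
  have hX2 : (fun ω => X ω ^ 2)
      = fun ω => ∑ i, ∑ j, (A i ∩ A j).indicator (fun _ => (1 : ℝ)) ω := by
    ext ω
    simp only [hX, sq, Finset.sum_mul_sum, ← Set.inter_indicator_mul, mul_one]
  have hX2int : Integrable (fun ω => X ω ^ 2) μ := by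
    rw [hX2]
    exact integrable_finsetSum _ fun i _ => integrable_finsetSum _ fun j _ =>
      hint _ ((hA i).inter (hA j))
  have hEX2 : ∫ ω, X ω ^ 2 ∂μ = ∑ i, ∑ j, μ.real (A i ∩ A j) := by
    rw [hX2, integral_finsetSum _ fun i _ => integrable_finsetSum _ fun j _ =>
      hint _ ((hA i).inter (hA j))]
    refine Finset.sum_congr rfl fun i _ => ?_
    rw [integral_finsetSum _ fun j _ => hint _ ((hA i).inter (hA j))]
    exact Finset.sum_congr rfl fun j _ => by
      rw [integral_indicator_const _ ((hA i).inter (hA j))]; simp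
  have hBm : MeasurableSet {ω | ∀ i, ω ∉ A i} := by
    simp only [Set.ofPred_forall]
    exact MeasurableSet.iInter fun i => (hA i).compl
  have hmain : m ^ 2 * μ.real {ω | ∀ i, ω ∉ A i} ≤ ∫ ω, (X ω - m) ^ 2 ∂μ := by
    have h1 : m ^ 2 * μ.real {ω | ∀ i, ω ∉ A i}
        = ∫ ω, {ω | ∀ i, ω ∉ A i}.indicator (fun _ => m ^ 2) ω ∂μ := by
      rw [integral_indicator_const _ hBm]; simp [mul_comm]
    rw [h1]
    have hi : Integrable (fun ω => (X ω - m) ^ 2) μ := by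
      have : (fun ω => (X ω - m) ^ 2) = fun ω => X ω ^ 2 - 2 * m * X ω + m ^ 2 := by
        ext ω; ring
      rw [this]
      exact (hX2int.sub (hXint.const_mul _)).add (integrable_const _)
    refine integral_mono ((integrable_const _).indicator hBm) hi fun ω => ?_
    by_cases hω : ∀ i, ω ∉ A i
    · rw [Set.indicator_of_mem (by exact hω)]
      have : X ω = 0 := Finset.sum_eq_zero fun i _ => Set.indicator_of_notMem (hω i) _
      simp [this]
    · rw [Set.indicator_of_notMem (by exact hω)]
      positivity
  have hvar : ∫ ω, (X ω - m) ^ 2 ∂μ = ∑ i, ∑ j, μ.real (A i ∩ A j) - m ^ 2 := by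
    have : (fun ω => (X ω - m) ^ 2) = fun ω => (X ω ^ 2 - 2 * m * X ω) + m ^ 2 := by
      ext ω; ring
    have hi : Integrable (fun ω => X ω ^ 2 - 2 * m * X ω) μ := hX2int.sub (hXint.const_mul _)
    rw [this, integral_add hi (integrable_const _),
      integral_sub hX2int (hXint.const_mul _), integral_const_mul, hEX, hEX2]
    simp
    ring
  rw [hvar] at hmain
  have h2 : m ^ 2 * μ.real {ω | ∀ i, ω ∉ A i} ≤ m ^ 2 * (1 / m + κ) := by
    refine hmain.trans ?_
    have : m ^ 2 * (1 / m + κ) = m + κ * m ^ 2 := by field_simp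
    rw [this]; linarith
  exact le_of_mul_le_mul_left h2 (by positivity)

/-- Upper bound for the probability that there is no isolated vertex. -/
lemma measureReal_forall_one_le_degree_le {n : ℕ} (R : RateMatrix n) {t κ : ℝ} (ht : 0 ≤ t)
    (hκ : ∀ u v, t * R.rate u v ≤ κ) (hn : 0 < n) :
    (clocksLaw R).real {E | ∀ u, 1 ≤ degree (processGraph E (ENNReal.ofReal t)) u}
      ≤ 1 / ∑ u, Real.exp (-(t * R.deg u)) + (Real.exp κ - 1) := by
  classical
  set A : Fin n → Set (Clocks n) := fun u =>
    {E | ∀ p ∈ ({u} : Finset (Fin n)) ×ˢ ({u} : Finset (Fin n))ᶜ,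
      ENNReal.ofReal t < E s(p.1, p.2)} with hA
  have hAm : ∀ u, MeasurableSet (A u) := by
    intro u
    simp only [hA, Set.ofPred_forall]
    exact Finset.measurableSet_biInter _ fun p _ =>
      measurableSet_Ioi.preimage (measurable_pi_apply (s(p.1, p.2)))
  have hinj : ∀ u v : Fin n, Set.InjOn (fun p : Fin n × Fin n => s(p.1, p.2))
      (({u} : Finset (Fin n)) ×ˢ ({u} : Finset (Fin n))ᶜ ∪
        ({v} : Finset (Fin n)) ×ˢ ({u, v} : Finset (Fin n))ᶜ : Finset (Fin n × Fin n)) := by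
    intro u v p hp q hq hpq
    rcases p with ⟨a, e⟩
    rcases q with ⟨a', e'⟩
    simp only [Finset.coe_union, Finset.coe_product, Finset.coe_singleton, Finset.coe_compl,
      Finset.coe_insert, Set.mem_union, Set.mem_prod, Set.mem_singleton_iff, Set.mem_compl_iff,
      Set.mem_insert_iff, not_or] at hp hq
    simp only [Sym2.eq_iff] at hpq
    grind
  -- The diagonal rate counts in `d_R(u)` but belongs to no edge at `u`, hence the correction.
  have hP : ∀ u, (clocksLaw R).real (A u) = Real.exp (-(t * (R.deg u - R.rate u u))) := by
    intro u
    have h1 := measureReal_forall_lt R (P := {u} ×ˢ ({u} : Finset (Fin n))ᶜ)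
      ((hinj u u).mono (by simp)) ht
    rw [hA, h1, Finset.sum_product, Finset.sum_singleton]
    have := Finset.sum_add_sum_compl {u} fun v => R.rate u v
    rw [Finset.sum_singleton] at this
    rw [RateMatrix.deg, ← this]
    congr 2; ring
  -- The two events share only the clock of `{u,v}`. Counting it once instead of twice costs a
  -- factor `exp(t R(u,v)) ≤ exp κ`.
  have hPP : ∀ u v, u ≠ v → (clocksLaw R).real (A u ∩ A v)
      ≤ Real.exp κ * ((clocksLaw R).real (A u) * (clocksLaw R).real (A v)) := by
    intro u v huv
    have hsub : A u ∩ A v ⊆ {E | ∀ p ∈ ({u} : Finset (Fin n)) ×ˢ ({u} : Finset (Fin n))ᶜ ∪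
        ({v} : Finset (Fin n)) ×ˢ ({u, v} : Finset (Fin n))ᶜ,
        ENNReal.ofReal t < E s(p.1, p.2)} := by
      rintro E ⟨h1, h2⟩ p hp
      rcases Finset.mem_union.1 hp with hp | hp
      · exact h1 p hp
      · refine h2 p ?_
        rw [Finset.mem_product] at hp ⊢
        refine ⟨hp.1, ?_⟩
        have := hp.2
        simp only [Finset.mem_compl, Finset.mem_insert, Finset.mem_singleton, not_or] at this ⊢
        exact this.2
    refine (measureReal_mono hsub).trans ?_
    rw [measureReal_forall_lt R (hinj u v) ht, hP, hP, ← Real.exp_add, ← Real.exp_add,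
      Real.exp_le_exp, Finset.sum_union, Finset.sum_product, Finset.sum_singleton,
      Finset.sum_product, Finset.sum_singleton]
    · have h1 := Finset.sum_add_sum_compl {u} fun w => R.rate u w
      have h2 := Finset.sum_add_sum_compl {u, v} fun w => R.rate v w
      rw [Finset.sum_singleton] at h1
      rw [Finset.sum_pair huv] at h2
      simp only [RateMatrix.deg]
      rw [← h1, ← h2]
      have := hκ v u
      linarith
    · rw [Finset.disjoint_left]
      intro p hp hp'
      rw [Finset.mem_product, Finset.mem_singleton] at hp hp'
      exact huv (hp.1.symm.trans hp'.1)
  have hnn : ∀ u, 0 ≤ (clocksLaw R).real (A u) := fun u => measureReal_nonneg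
  have hlow : ∑ u, Real.exp (-(t * R.deg u)) ≤ ∑ u, (clocksLaw R).real (A u) := by
    refine Finset.sum_le_sum fun u _ => ?_
    rw [hP, Real.exp_le_exp]
    have := mul_nonneg ht (R.nonneg u u)
    linarith
  have hpos : 0 < ∑ u, Real.exp (-(t * R.deg u)) :=
    Finset.sum_pos (fun u _ => Real.exp_pos _) ⟨⟨0, hn⟩, Finset.mem_univ _⟩
  have hκ0 : 0 ≤ κ := (mul_nonneg ht (R.nonneg ⟨0, hn⟩ ⟨0, hn⟩)).trans (hκ _ _)
  have key := measureReal_forall_notMem_le (clocksLaw R) hAm (κ := Real.exp κ - 1)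
    (hpos.trans_le hlow) ?_
  · refine (measureReal_mono ?_).trans (key.trans ?_)
    · intro E hE u hu
      have h1 : 1 ≤ degree (processGraph E (ENNReal.ofReal t)) u := hE u
      have h2 : ((processGraph E (ENNReal.ofReal t)).neighborSet u).Nonempty := by
        rw [← Set.ncard_pos (Set.toFinite _)]; exact h1
      obtain ⟨v, hv⟩ := h2
      have := hu (u, v) (by simp [hv.1.symm])
      exact absurd this (not_lt.2 hv.2.1)
    · gcongr
  · have hle : ∀ u v, (clocksLaw R).real (A u ∩ A v) ≤ (if u = v then (clocksLaw R).real (A u) else 0)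
        + Real.exp κ * ((clocksLaw R).real (A u) * (clocksLaw R).real (A v)) := by
      intro u v
      split_ifs with huv
      · subst huv
        rw [Set.inter_self]
        have := mul_nonneg (hnn u) (hnn u)
        have := mul_nonneg (Real.exp_pos κ).le this
        linarith
      · rw [zero_add]; exact hPP u v huv
    calc _ ≤ ∑ u, ∑ v, ((if u = v then (clocksLaw R).real (A u) else 0)
        + Real.exp κ * ((clocksLaw R).real (A u) * (clocksLaw R).real (A v))) :=
          Finset.sum_le_sum fun u _ => Finset.sum_le_sum fun v _ => hle u v
      _ = _ := by
          simp_rw [Finset.sum_add_distrib, ← Finset.mul_sum, ← Finset.sum_mul]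
          simp
          ring

/-! ### Exponential sums over the weighted degrees. -/

lemma exists_pow_le_mul_exp (a : ℕ) {ε : ℝ} (hε : 0 < ε) :
    ∃ C : ℝ, 0 < C ∧ ∀ y : ℝ, 0 ≤ y → y ^ a ≤ C * Real.exp (ε * y) := by
  refine ⟨a.factorial / ε ^ a, by positivity, fun y hy => ?_⟩
  have h := Real.pow_div_factorial_le_exp (ε * y) (by positivity) a
  rw [div_le_iff₀ (by positivity), mul_pow] at h
  rw [div_mul_eq_mul_div, le_div_iff₀ (by positivity)]
  linarith

/-- Power-mean comparison of exponential sums. -/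
lemma sum_exp_le_of_sum_exp_eq {ι : Type*} (s : Finset ι) (y : ι → ℝ) {ε : ℝ} (hε : 0 < ε)
    (hε1 : ε ≤ 1) {n : ℕ} (hn : 0 < n) (hs : s.card = n)
    (h : ∑ i ∈ s, Real.exp (-y i) = (n : ℝ) ^ ε) :
    ∑ i ∈ s, Real.exp (-((1 - ε) * y i)) ≤ (n : ℝ) ^ (2 * ε) := by
  have hn' : (0 : ℝ) < n := by exact_mod_cast hn
  have hlogn : 0 ≤ Real.log n := Real.log_natCast_nonneg n
  -- `e^(-l) = n^(ε-1)` is the mean of the `e^(-y i)`, so the weighted mean inequality is applied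
  -- where it is sharp. The sum becomes `n^(1-(1-ε)²) ≤ n^(2ε)`.
  set l := (1 - ε) * Real.log n with hl
  have hpt : ∀ i, Real.exp (-((1 - ε) * y i))
      ≤ Real.exp (-((1 - ε) * l)) * ((1 - ε) * (Real.exp l * Real.exp (-y i)) + ε) := by
    intro i
    have hc := convexOn_exp.2 (Set.mem_univ (l + -y i)) (Set.mem_univ 0) (sub_nonneg.2 hε1) hε.le
      (by ring)
    simp only [smul_eq_mul, mul_zero, add_zero, Real.exp_zero, mul_one] at hc
    have h1 : Real.exp (-((1 - ε) * y i))
        = Real.exp (-((1 - ε) * l)) * Real.exp ((1 - ε) * (l + -y i)) := by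
      rw [← Real.exp_add]; congr 1; ring
    rw [h1, ← Real.exp_add l]
    gcongr
  refine (Finset.sum_le_sum fun i _ => hpt i).trans ?_
  rw [← Finset.mul_sum, Finset.sum_add_distrib, ← Finset.mul_sum, ← Finset.mul_sum, h,
    Finset.sum_const, hs, nsmul_eq_mul]
  have h2 : Real.exp l * (n : ℝ) ^ ε = n := by
    rw [Real.rpow_def_of_pos hn', ← Real.exp_add]
    conv_rhs => rw [← Real.exp_log hn']
    congr 1; rw [hl]; ring
  rw [h2]
  have h3 : (1 - ε) * (n : ℝ) + n * ε = Real.exp (Real.log n) := by rw [Real.exp_log hn']; ring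
  rw [h3, ← Real.exp_add, Real.rpow_def_of_pos hn', Real.exp_le_exp, hl]
  nlinarith [mul_nonneg (sq_nonneg ε) hlogn]

/-- Intermediate value theorem. At `1/d` the sum is at least `e^(-b) n`, since the mean of
`d_R(u)/d` is at most `b` and `exp` lies above its tangent; at `log n / d` every term is at most
`1/n`. -/
lemma exists_time_sum_exp_eq {n : ℕ} {R : RateMatrix n} {α γ b d : ℝ} (h : IsRMAt R α γ b d)
    {ε : ℝ} (hε : 0 ≤ ε) (hn : (n : ℝ) ^ ε ≤ Real.exp (-b) * n) (hlog : 1 ≤ Real.log n) :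
    ∃ t, 1 / d ≤ t ∧ t ≤ Real.log n / d ∧ ∑ u, Real.exp (-(t * R.deg u)) = (n : ℝ) ^ ε := by
  have hd := h.d_pos
  have hn0 := h.n_pos
  set f : ℝ → ℝ := fun t => ∑ u, Real.exp (-(t * R.deg u)) with hf
  have hcont : Continuous f := by
    rw [hf]; fun_prop
  have hle : 1 / d ≤ Real.log n / d := by gcongr
  have h1 : (n : ℝ) ^ ε ≤ f (1 / d) := by
    refine hn.trans ?_
    have hpt : ∀ u, Real.exp (-b) * (1 + (b - R.deg u / d)) ≤ Real.exp (-(1 / d * R.deg u)) := by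
      intro u
      have := Real.add_one_le_exp (b - R.deg u / d)
      have e : Real.exp (-(1 / d * R.deg u)) = Real.exp (-b) * Real.exp (b - R.deg u / d) := by
        rw [← Real.exp_add]; congr 1; ring
      rw [e]
      gcongr
      linarith
    refine le_trans ?_ (Finset.sum_le_sum fun u _ => hpt u)
    rw [← Finset.mul_sum]
    gcongr
    rw [Finset.sum_add_distrib, Finset.sum_sub_distrib, ← Finset.sum_div]
    have htot : ∑ u, R.deg u ≤ b * d * n := h.total_le
    simp only [Finset.sum_const, Finset.card_univ, Fintype.card_fin, nsmul_eq_mul, mul_one]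
    have : (∑ u, R.deg u) / d ≤ n * b := by
      rw [div_le_iff₀ hd]; linarith
    linarith
  have h2 : f (Real.log n / d) ≤ (n : ℝ) ^ ε := by
    have hpt : ∀ u, Real.exp (-(Real.log n / d * R.deg u)) ≤ (n : ℝ)⁻¹ := by
      intro u
      have e : ((n : ℝ)⁻¹) = Real.exp (-Real.log n) := by rw [Real.exp_neg, Real.exp_log hn0]
      rw [e, Real.exp_le_exp, neg_le_neg_iff, div_mul_eq_mul_div, le_div_iff₀ hd]
      have := h.le_deg u
      gcongr
    calc f (Real.log n / d) ≤ ∑ _u : Fin n, (n : ℝ)⁻¹ := Finset.sum_le_sum fun u _ => hpt u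
      _ = 1 := by simp [hn0.ne']
      _ ≤ (n : ℝ) ^ ε := Real.one_le_rpow (by exact_mod_cast hn0) hε
  obtain ⟨t, ht, hft⟩ := intermediate_value_Icc' hle hcont.continuousOn ⟨h2, h1⟩
  exact ⟨t, ht.1, ht.2, hft⟩

/-! ### Separation of the small vertices. -/

section Joint

variable {n : ℕ} (R : RateMatrix n)

/-- Poisson-type bound for the probability that `u` has degree less than `m` at time `t`. -/
noncomputable def lowProb (t : ℝ) (m : ℕ) (u : Fin n) : ℝ :=
  (t * R.deg u) ^ m * Real.exp (3 - t * R.deg u)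

/-- The choice `z u = t d_R(u)`: the tilt costs at most `e²` and ignoring the pairs inside `X` at
most `e`, which explains the `3` in `lowProb`. -/
lemma measureReal_joint_lowProb_le {X S : Finset (Fin n)} (hS : S ⊆ X)
    {J : Finset (Fin n × Fin n)} (hJX : ∀ p ∈ J, p.1 ∈ X ∧ p.2 ∈ X)
    (hJ : Set.InjOn (fun p : Fin n × Fin n => s(p.1, p.2)) J)
    {t₁ : ℝ} (ht₁ : 0 ≤ t₁) {t : Fin n → ℝ} (ht : ∀ u, 0 ≤ t u)
    (htd : ∀ u ∈ S, 1 ≤ t u * R.deg u) (hX : ∀ u ∈ S, ∀ v, X.card * (R.rate u v * t u) ≤ 1)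
    (m : ℕ) :
    (clocksLaw R).real {E | (∀ p ∈ J, E s(p.1, p.2) ≤ ENNReal.ofReal t₁) ∧
        ∀ u ∈ S, degree (processGraph E (ENNReal.ofReal (t u))) u < m}
      ≤ (∏ p ∈ J, R.rate p.1 p.2 * t₁) * ∏ u ∈ S, lowProb R (t u) m u := by
  have hXc : ∀ u ∈ S, (1 : ℝ) ≤ X.card := fun u hu => by
    exact_mod_cast Finset.card_pos.2 ⟨u, hS hu⟩
  refine (measureReal_joint_le R hS hJX hJ ht₁ ht (z := fun u => t u * R.deg u)
    (fun u hu v => ?_) htd m).trans ?_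
  · have h1 := mul_nonneg (R.nonneg u v) (ht u)
    have h2 := hX u hu v
    have := le_mul_of_one_le_left h1 (hXc u hu)
    linarith
  · refine mul_le_mul_of_nonneg_left (Finset.prod_le_prod (fun u hu => ?_) fun u hu => ?_)
      (Finset.prod_nonneg fun p _ => mul_nonneg (R.nonneg _ _) ht₁)
    · have := htd u hu
      positivity
    · have htu := htd u hu
      rw [lowProb]
      gcongr
      set z := t u * R.deg u with hz
      have e1 : ∑ v ∈ X, R.rate u v * t u + ∑ v ∈ Xᶜ, R.rate u v * t u = z := by
        rw [Finset.sum_add_sum_compl, ← Finset.sum_mul, hz, mul_comm]; rfl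
      have e2 : ∑ v ∈ X, R.rate u v * t u ≤ 1 := by
        have hc := hXc u hu
        calc ∑ v ∈ X, R.rate u v * t u ≤ ∑ _v ∈ X, 1 / (X.card : ℝ) :=
              Finset.sum_le_sum fun v _ => by
                rw [le_div_iff₀ (by linarith), mul_comm]; exact hX u hu v
          _ = 1 := by
              rw [Finset.sum_const, nsmul_eq_mul]
              field_simp
      have e3 : 0 ≤ ∑ v ∈ X, R.rate u v * t u :=
        Finset.sum_nonneg fun v _ => mul_nonneg (R.nonneg _ _) (ht u)
      set Y := ∑ v ∈ Xᶜ, R.rate u v * t u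
      have e4 : 2 / z * Y ≤ 2 := by
        rw [div_mul_eq_mul_div, div_le_iff₀ (by linarith)]
        linarith
      linarith

lemma lowProb_nonneg {t : ℝ} (ht : 0 ≤ t) (m : ℕ) (u : Fin n) : 0 ≤ lowProb R t m u := by
  have := mul_nonneg ht (R.deg_nonneg u)
  unfold lowProb; positivity

end Joint

section SmallVertices

variable {n : ℕ} (R : RateMatrix n)

/-- The vertices with degree less than `m` at time `t`. -/
def LowAt (E : Clocks n) (t : ℝ) (m : ℕ) (u : Fin n) : Prop :=
  degree (processGraph E (ENNReal.ofReal t)) u < m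

/-- The constant `2 * c + 3` bounds the number of vertices in each of the three forbidden
configurations, so that one hypothesis serves them all. -/
lemma measureReal_low_pair_le {t t₁ : ℝ} (ht : 0 ≤ t) (ht₁ : 0 ≤ t₁) {m c : ℕ}
    (htd : ∀ u, 1 ≤ t * R.deg u) (hX : ∀ u v, (2 * c + 3 : ℕ) * (R.rate u v * t) ≤ 1)
    {s s' : Fin n} (hs : s ≠ s') :
    (clocksLaw R).real {E | LowAt E t m s ∧ LowAt E t m s' ∧ E s(s, s') ≤ ENNReal.ofReal t₁}
      ≤ R.rate s s' * t₁ * (lowProb R t m s * lowProb R t m s') := by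
  have key := measureReal_joint_lowProb_le R (X := {s, s'}) (S := {s, s'}) subset_rfl
    (J := {(s, s')}) (by simp) (by simp) ht₁ (t := fun _ => t) (fun _ => ht) (fun u _ => htd u)
    (fun u _ v => ?_) m
  · rw [Finset.prod_singleton, Finset.prod_pair hs] at key
    refine (measureReal_mono ?_).trans key
    rintro E ⟨h1, h2, h3⟩
    exact ⟨by simpa using h3, by simpa using ⟨h1, h2⟩⟩
  · have h0 := mul_nonneg (R.nonneg u v) ht
    refine le_trans ?_ (hX u v)
    rw [Finset.card_pair hs]
    gcongr
    omega

lemma measureReal_low_common_le {t t₁ : ℝ} (ht : 0 ≤ t) (ht₁ : 0 ≤ t₁) {m c : ℕ}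
    (htd : ∀ u, 1 ≤ t * R.deg u) (hX : ∀ u v, (2 * c + 3 : ℕ) * (R.rate u v * t) ≤ 1)
    {s s' y : Fin n} (hs : s ≠ s') (hy : y ≠ s) :
    (clocksLaw R).real {E | LowAt E t m s ∧ LowAt E t m s' ∧ E s(s, y) ≤ ENNReal.ofReal t₁ ∧
        E s(y, s') ≤ ENNReal.ofReal t₁}
      ≤ (R.rate s y * t₁) * (R.rate y s' * t₁) * (lowProb R t m s * lowProb R t m s') := by
  have hne : (s, y) ≠ (y, s') := fun h => hy (Prod.ext_iff.1 h).1.symm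
  have key := measureReal_joint_lowProb_le R (X := {y, s, s'}) (S := {s, s'}) (by simp)
    (J := {(s, y), (y, s')}) (by simp) ?_ ht₁ (t := fun _ => t) (fun _ => ht) (fun u _ => htd u)
    (fun u _ v => ?_) m
  · rw [Finset.prod_pair hne, Finset.prod_pair hs] at key
    refine (measureReal_mono ?_).trans key
    rintro E ⟨h1, h2, h3, h4⟩
    exact ⟨by simpa using ⟨h3, h4⟩, by simpa using ⟨h1, h2⟩⟩
  · intro p hp q hq hpq
    simp only [Finset.coe_insert, Finset.coe_singleton, Set.mem_insert_iff,
      Set.mem_singleton_iff] at hp hq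
    simp only [Sym2.eq_iff] at hpq
    rcases p with ⟨a, e⟩
    rcases q with ⟨a', e'⟩
    simp only [Prod.mk.injEq] at hp hq hpq ⊢
    grind
  · have h0 := mul_nonneg (R.nonneg u v) ht
    refine le_trans ?_ (hX u v)
    have : ({y, s, s'} : Finset (Fin n)).card ≤ 3 := Finset.card_le_three
    gcongr
    omega

/-- The conditions on `x`, `y`, `s` make the `2c` clocks distinct, so the bound is a product over
the paths. -/
lemma measureReal_low_paths_le {t t₁ : ℝ} (ht : 0 ≤ t) (ht₁ : 0 ≤ t₁) {m c : ℕ}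
    (htd : ∀ u, 1 ≤ t * R.deg u) (hX : ∀ u v, (2 * c + 3 : ℕ) * (R.rate u v * t) ≤ 1)
    {x : Fin n} {y s : Fin c → Fin n} (hy : Function.Injective y) (hs : Function.Injective s)
    (hyx : ∀ i, y i ≠ x) (hsx : ∀ i, s i ≠ x) (hys : ∀ i j, y i ≠ s j) :
    (clocksLaw R).real {E | ∀ i, LowAt E t m (s i) ∧ E s(x, y i) ≤ ENNReal.ofReal t₁ ∧
        E s(y i, s i) ≤ ENNReal.ofReal t₁}
      ≤ ∏ i, (R.rate x (y i) * t₁) * ((R.rate (y i) (s i) * t₁) * lowProb R t m (s i)) := by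
  classical
  set J₁ : Finset (Fin n × Fin n) := Finset.univ.image fun i => (x, y i) with hJ₁
  set J₂ : Finset (Fin n × Fin n) := Finset.univ.image fun i => (y i, s i) with hJ₂
  have hdisj : Disjoint J₁ J₂ := by
    rw [Finset.disjoint_left]
    intro p hp hp'
    obtain ⟨i, -, rfl⟩ := Finset.mem_image.1 hp
    obtain ⟨j, -, hj⟩ := Finset.mem_image.1 hp'
    exact hyx j (Prod.ext_iff.1 hj).1
  have key := measureReal_joint_lowProb_le R
    (X := insert x (Finset.univ.image y ∪ Finset.univ.image s))
    (S := Finset.univ.image s)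
    (Finset.subset_union_right.trans (Finset.subset_insert _ _))
    (J := J₁ ∪ J₂) ?_ ?_ ht₁ (t := fun _ => t) (fun _ => ht) (fun u _ => htd u)
    (fun u _ v => ?_) m
  · rw [Finset.prod_union hdisj, hJ₁, hJ₂, Finset.prod_image, Finset.prod_image,
      Finset.prod_image] at key
    · rw [← Finset.prod_mul_distrib, ← Finset.prod_mul_distrib] at key
      refine (measureReal_mono ?_).trans (key.trans_eq
        (Finset.prod_congr rfl fun i _ => by rw [mul_assoc]))
      intro E hE
      refine ⟨fun p hp => ?_, fun u hu => ?_⟩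
      · rcases Finset.mem_union.1 hp with hp | hp
        · obtain ⟨i, -, rfl⟩ := Finset.mem_image.1 hp
          exact (hE i).2.1
        · obtain ⟨i, -, rfl⟩ := Finset.mem_image.1 hp
          exact (hE i).2.2
      · obtain ⟨i, -, rfl⟩ := Finset.mem_image.1 hu
        exact (hE i).1
    · exact hs.injOn
    · exact fun i _ j _ h => hy (Prod.ext_iff.1 h).1
    · exact fun i _ j _ h => hy (Prod.ext_iff.1 h).2
  · intro p hp
    rcases Finset.mem_union.1 hp with hp | hp
    · obtain ⟨i, -, rfl⟩ := Finset.mem_image.1 hp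
      simp
    · obtain ⟨i, -, rfl⟩ := Finset.mem_image.1 hp
      simp
  · intro p hp q hq hpq
    simp only [Sym2.eq_iff] at hpq
    rcases Finset.mem_union.1 hp with hp | hp <;> rcases Finset.mem_union.1 hq with hq | hq <;>
      obtain ⟨i, -, rfl⟩ := Finset.mem_image.1 hp <;>
      obtain ⟨j, -, rfl⟩ := Finset.mem_image.1 hq <;>
      rcases hpq with ⟨h1, h2⟩ | ⟨h1, h2⟩
    · exact Prod.ext h1 h2
    · exact absurd h1.symm (hyx j)
    · exact absurd h1.symm (hyx j)
    · exact absurd h1.symm (hsx j)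
    · exact absurd h1 (hyx i)
    · exact absurd h2 (hsx i)
    · exact Prod.ext h1 h2
    · exact absurd h1 (hys i j)
  · have h0 := mul_nonneg (R.nonneg u v) ht
    refine le_trans ?_ (hX u v)
    have h1 := Finset.card_insert_le x (Finset.univ.image y ∪ Finset.univ.image s)
    have h2 := Finset.card_union_le (Finset.univ.image y) (Finset.univ.image s)
    have h3 : (Finset.univ.image y).card ≤ c := Finset.card_image_le.trans_eq (Finset.card_fin c)
    have h4 : (Finset.univ.image s).card ≤ c := Finset.card_image_le.trans_eq (Finset.card_fin c)
    gcongr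
    omega

/-- The event that small vertices are not well separated. -/
def SmallBad (t t₁ : ℝ) (m c : ℕ) : Set (Clocks n) :=
  {E | ∃ s s', s ≠ s' ∧ LowAt E t m s ∧ LowAt E t m s' ∧ E s(s, s') ≤ ENNReal.ofReal t₁} ∪
  {E | ∃ s s' y, (s ≠ s' ∧ y ≠ s) ∧ LowAt E t m s ∧ LowAt E t m s' ∧
    E s(s, y) ≤ ENNReal.ofReal t₁ ∧ E s(y, s') ≤ ENNReal.ofReal t₁} ∪
  {E | ∃ (x : Fin n) (y s : Fin c → Fin n), (Function.Injective y ∧ Function.Injective s ∧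
    (∀ i, y i ≠ x) ∧ (∀ i, s i ≠ x) ∧ ∀ i j, y i ≠ s j) ∧
    ∀ i, LowAt E t m (s i) ∧ E s(x, y i) ≤ ENNReal.ofReal t₁ ∧ E s(y i, s i) ≤ ENNReal.ofReal t₁}

/-- `G` bounds the total weight of small vertices, each with an edge attached, and every further
edge that closes a configuration costs at most `ρ`. A path from a given `x` to a small vertex thus
costs `ρ G`; `c` disjoint ones cost its `c`-th power, with `n` choices of `x`. -/
lemma measureReal_smallBad_le {t t₁ ρ G : ℝ} (ht : 0 ≤ t) (ht₁ : 0 ≤ t₁) {m c : ℕ}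
    (htd : ∀ u, 1 ≤ t * R.deg u) (hX : ∀ u v, (2 * c + 3 : ℕ) * (R.rate u v * t) ≤ 1)
    (ht₁d : ∀ u, 1 ≤ t₁ * R.deg u) (hρ0 : 0 ≤ ρ) (hρ : ∀ u v, R.rate u v * t₁ ≤ ρ)
    (hG : ∑ u, t₁ * R.deg u * lowProb R t m u ≤ G) :
    (clocksLaw R).real (SmallBad t t₁ m c) ≤ 2 * (ρ * G ^ 2) + n * (ρ * G) ^ c := by
  classical
  set g := lowProb R t m with hg
  have hg0 : ∀ u, 0 ≤ g u := lowProb_nonneg R ht m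
  have hg1 : ∀ u, g u ≤ t₁ * R.deg u * g u := fun u => le_mul_of_one_le_left (hg0 u) (ht₁d u)
  have hgG : ∑ u, g u ≤ G := (Finset.sum_le_sum fun u _ => hg1 u).trans hG
  have hgs0 : 0 ≤ ∑ u, g u := Finset.sum_nonneg fun u _ => hg0 u
  have hG0 : 0 ≤ G := hgs0.trans hgG
  have hr0 : ∀ u v, 0 ≤ R.rate u v * t₁ := fun u v => mul_nonneg (R.nonneg u v) ht₁
  have hrow : ∀ u, ∑ v, R.rate u v * t₁ = t₁ * R.deg u := fun u => by
    rw [← Finset.sum_mul, mul_comm]; rfl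
  have h1 : (clocksLaw R).real {E | ∃ s s', s ≠ s' ∧ LowAt E t m s ∧ LowAt E t m s' ∧
      E s(s, s') ≤ ENNReal.ofReal t₁} ≤ ρ * G ^ 2 := by
    have hsub : {E : Clocks n | ∃ s s', s ≠ s' ∧ LowAt E t m s ∧ LowAt E t m s' ∧
        E s(s, s') ≤ ENNReal.ofReal t₁} ⊆ ⋃ p ∈ (Finset.univ.filter fun p : Fin n × Fin n =>
          p.1 ≠ p.2), {E | LowAt E t m p.1 ∧ LowAt E t m p.2 ∧
            E s(p.1, p.2) ≤ ENNReal.ofReal t₁} := by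
      rintro E ⟨s, s', hs, hE⟩
      simp only [Set.mem_iUnion]
      exact ⟨(s, s'), by simpa using hs, hE⟩
    calc _ ≤ _ := measureReal_mono hsub (measure_ne_top _ _)
      _ ≤ _ := measureReal_biUnion_finset_le _ _
      _ ≤ ∑ p ∈ (Finset.univ.filter fun p : Fin n × Fin n => p.1 ≠ p.2), ρ * (g p.1 * g p.2) := by
          refine Finset.sum_le_sum fun p hp => ?_
          refine (measureReal_low_pair_le R ht ht₁ htd hX (Finset.mem_filter.1 hp).2).trans ?_
          have := hρ p.1 p.2
          have := mul_nonneg (hg0 p.1) (hg0 p.2)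
          gcongr
      _ ≤ ∑ p : Fin n × Fin n, ρ * (g p.1 * g p.2) :=
          Finset.sum_le_sum_of_subset_of_nonneg (Finset.subset_univ _) fun p _ _ =>
            mul_nonneg hρ0 (mul_nonneg (hg0 _) (hg0 _))
      _ = ρ * (∑ u, g u) ^ 2 := by
          rw [← Finset.mul_sum, Fintype.sum_prod_type, sq, Finset.sum_mul_sum]
      _ ≤ _ := by gcongr
  have h2 : (clocksLaw R).real {E | ∃ s s' y, (s ≠ s' ∧ y ≠ s) ∧ LowAt E t m s ∧
      LowAt E t m s' ∧ E s(s, y) ≤ ENNReal.ofReal t₁ ∧ E s(y, s') ≤ ENNReal.ofReal t₁}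
      ≤ ρ * G ^ 2 := by
    have hsub : {E : Clocks n | ∃ s s' y, (s ≠ s' ∧ y ≠ s) ∧ LowAt E t m s ∧
        LowAt E t m s' ∧ E s(s, y) ≤ ENNReal.ofReal t₁ ∧ E s(y, s') ≤ ENNReal.ofReal t₁} ⊆
        ⋃ p ∈ (Finset.univ.filter fun p : Fin n × Fin n × Fin n =>
          p.1 ≠ p.2.1 ∧ p.2.2 ≠ p.1), {E | LowAt E t m p.1 ∧ LowAt E t m p.2.1 ∧
            E s(p.1, p.2.2) ≤ ENNReal.ofReal t₁ ∧ E s(p.2.2, p.2.1) ≤ ENNReal.ofReal t₁} := by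
      rintro E ⟨s, s', y, hs, hE⟩
      simp only [Set.mem_iUnion]
      exact ⟨(s, s', y), by simpa using hs, hE⟩
    calc _ ≤ _ := measureReal_mono hsub (measure_ne_top _ _)
      _ ≤ _ := measureReal_biUnion_finset_le _ _
      _ ≤ ∑ p ∈ (Finset.univ.filter fun p : Fin n × Fin n × Fin n =>
          p.1 ≠ p.2.1 ∧ p.2.2 ≠ p.1),
            ρ * (g p.1 * (g p.2.1 * (R.rate p.1 p.2.2 * t₁))) := by
          refine Finset.sum_le_sum fun p hp => ?_
          obtain ⟨e1, e2⟩ := (Finset.mem_filter.1 hp).2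
          refine (measureReal_low_common_le R ht ht₁ htd hX e1 e2).trans ?_
          have a1 := hρ p.2.2 p.2.1
          have a2 := mul_nonneg (hg0 p.1) (hg0 p.2.1)
          have a3 := hr0 p.1 p.2.2
          calc _ ≤ R.rate p.1 p.2.2 * t₁ * ρ * (g p.1 * g p.2.1) := by gcongr
            _ = _ := by ring
      _ ≤ ∑ p : Fin n × Fin n × Fin n, ρ * (g p.1 * (g p.2.1 * (R.rate p.1 p.2.2 * t₁))) :=
          Finset.sum_le_sum_of_subset_of_nonneg (Finset.subset_univ _) fun p _ _ =>
            mul_nonneg hρ0 (mul_nonneg (hg0 _) (mul_nonneg (hg0 _) (hr0 _ _)))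
      _ = ρ * ((∑ u, t₁ * R.deg u * g u) * ∑ u, g u) := by
          rw [← Finset.mul_sum, Fintype.sum_prod_type]
          simp_rw [Fintype.sum_prod_type, ← Finset.mul_sum, hrow]
          rw [Finset.sum_mul_sum]
          congr 1
          refine Finset.sum_congr rfl fun u _ => ?_
          rw [Finset.mul_sum]
          exact Finset.sum_congr rfl fun v _ => by ring
      _ ≤ ρ * (G * G) := by gcongr
      _ = _ := by ring
  have h3 : (clocksLaw R).real {E | ∃ (x : Fin n) (y s : Fin c → Fin n), (Function.Injective y ∧
      Function.Injective s ∧ (∀ i, y i ≠ x) ∧ (∀ i, s i ≠ x) ∧ ∀ i j, y i ≠ s j) ∧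
      ∀ i, LowAt E t m (s i) ∧ E s(x, y i) ≤ ENNReal.ofReal t₁ ∧ E s(y i, s i) ≤ ENNReal.ofReal t₁}
      ≤ n * (ρ * G) ^ c := by
    set good : Fin n × (Fin c → Fin n × Fin n) → Prop := fun q =>
      Function.Injective (fun i => (q.2 i).1) ∧ Function.Injective (fun i => (q.2 i).2) ∧
      (∀ i, (q.2 i).1 ≠ q.1) ∧ (∀ i, (q.2 i).2 ≠ q.1) ∧ ∀ i j, (q.2 i).1 ≠ (q.2 j).2 with hgood
    set f : Fin n → Fin n × Fin n → ℝ := fun x p =>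
      (R.rate x p.1 * t₁) * ((R.rate p.1 p.2 * t₁) * g p.2) with hf
    have hf0 : ∀ x p, 0 ≤ f x p := fun x p =>
      mul_nonneg (hr0 _ _) (mul_nonneg (hr0 _ _) (hg0 _))
    have hsub : {E : Clocks n | ∃ (x : Fin n) (y s : Fin c → Fin n), (Function.Injective y ∧
        Function.Injective s ∧ (∀ i, y i ≠ x) ∧ (∀ i, s i ≠ x) ∧ ∀ i j, y i ≠ s j) ∧
        ∀ i, LowAt E t m (s i) ∧ E s(x, y i) ≤ ENNReal.ofReal t₁ ∧
          E s(y i, s i) ≤ ENNReal.ofReal t₁} ⊆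
        ⋃ q ∈ Finset.univ.filter good, {E | ∀ i, LowAt E t m (q.2 i).2 ∧
          E s(q.1, (q.2 i).1) ≤ ENNReal.ofReal t₁ ∧
          E s((q.2 i).1, (q.2 i).2) ≤ ENNReal.ofReal t₁} := by
      rintro E ⟨x, y, s, hxy, hE⟩
      simp only [Set.mem_iUnion]
      exact ⟨(x, fun i => (y i, s i)), Finset.mem_filter.2 ⟨Finset.mem_univ _, hxy⟩, hE⟩
    calc _ ≤ _ := measureReal_mono hsub (measure_ne_top _ _)
      _ ≤ _ := measureReal_biUnion_finset_le _ _
      _ ≤ ∑ q ∈ Finset.univ.filter good, ∏ i, f q.1 (q.2 i) := by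
          refine Finset.sum_le_sum fun q hq => ?_
          obtain ⟨e1, e2, e3, e4, e5⟩ := (Finset.mem_filter.1 hq).2
          exact measureReal_low_paths_le R ht ht₁ htd hX e1 e2 e3 e4 e5
      _ ≤ ∑ q : Fin n × (Fin c → Fin n × Fin n), ∏ i, f q.1 (q.2 i) :=
          Finset.sum_le_sum_of_subset_of_nonneg (Finset.subset_univ _) fun q _ _ =>
            Finset.prod_nonneg fun i _ => hf0 _ _
      -- Once distinctness is dropped, the `c` paths are summed independently.
      _ = ∑ x, (∑ p, f x p) ^ c := by
          rw [Fintype.sum_prod_type]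
          exact Finset.sum_congr rfl fun x _ => (Fintype.sum_pow (f x) c).symm
      _ ≤ ∑ _x : Fin n, (ρ * G) ^ c := by
          refine Finset.sum_le_sum fun x _ => ?_
          have : ∑ p, f x p ≤ ρ * G := by
            calc ∑ p, f x p ≤ ∑ p : Fin n × Fin n, ρ * ((R.rate p.2 p.1 * t₁) * g p.2) := by
                  refine Finset.sum_le_sum fun p _ => ?_
                  have a1 := hρ x p.1
                  have a2 := mul_nonneg (hr0 p.1 p.2) (hg0 p.2)
                  rw [R.symm p.2 p.1]
                  exact mul_le_mul_of_nonneg_right a1 a2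
              _ = ρ * ∑ u, t₁ * R.deg u * g u := by
                  rw [← Finset.mul_sum, Fintype.sum_prod_type_right]
                  congr 1
                  refine Finset.sum_congr rfl fun u _ => ?_
                  dsimp only
                  rw [← Finset.sum_mul, hrow]
              _ ≤ _ := by gcongr
          have h0 : 0 ≤ ∑ p, f x p := Finset.sum_nonneg fun p _ => hf0 x p
          gcongr
      _ = _ := by simp
  have hu1 := measureReal_union_le (μ := clocksLaw R)
    {E | ∃ s s', s ≠ s' ∧ LowAt E t m s ∧ LowAt E t m s' ∧ E s(s, s') ≤ ENNReal.ofReal t₁}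
    {E | ∃ s s' y, (s ≠ s' ∧ y ≠ s) ∧ LowAt E t m s ∧ LowAt E t m s' ∧
      E s(s, y) ≤ ENNReal.ofReal t₁ ∧ E s(y, s') ≤ ENNReal.ofReal t₁}
  refine (measureReal_union_le _ _).trans ?_
  linarith

end SmallVertices

lemma measureReal_degree_lt_le_lowProb {n : ℕ} (R : RateMatrix n) {t : ℝ} (ht : 0 ≤ t) {u : Fin n}
    (htd : 1 ≤ t * R.deg u) (hX : ∀ v, R.rate u v * t ≤ 1) (m : ℕ) :
    (clocksLaw R).real {E | LowAt E t m u} ≤ lowProb R t m u := by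
  have key := measureReal_joint_lowProb_le R (X := {u}) (S := {u}) subset_rfl (J := ∅) (by simp)
    (by simp) le_rfl (t := fun _ => t) (fun _ => ht) (by simpa using htd) (by simpa using hX) m
  rw [Finset.prod_empty, one_mul, Finset.prod_singleton] at key
  refine (measureReal_mono fun E hE => ?_).trans key
  exact ⟨by simp, by simpa using! hE⟩

/-- As `t ≥ 1/d`, the later time `2 log n / d` is at most `2 t log n`. The powers of `t d_R(u)` are
then absorbed by `exp(ε t d_R(u))`, and the power-mean comparison applies. -/
lemma sum_deg_mul_lowProb_le {n : ℕ} {R : RateMatrix n} {α γ b d : ℝ} (h : IsRMAt R α γ b d)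
    {ε t C : ℝ} {m : ℕ} (hε : 0 < ε) (hε1 : ε ≤ 1) (htd : 1 / d ≤ t) (_hlog : 0 ≤ Real.log n)
    (hsum : ∑ u, Real.exp (-(t * R.deg u)) = (n : ℝ) ^ ε)
    (hC0 : 0 < C) (hC : ∀ y : ℝ, 0 ≤ y → y ^ (m + 1) ≤ C * Real.exp (ε * y)) :
    ∑ u, 2 * Real.log n / d * R.deg u * lowProb R t m u
      ≤ 2 * Real.log n * (Real.exp 3 * C) * (n : ℝ) ^ (2 * ε) := by
  have hd := h.d_pos
  have ht : 0 < t := lt_of_lt_of_le (by positivity) htd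
  have hpt : ∀ u, 2 * Real.log n / d * R.deg u * lowProb R t m u
      ≤ 2 * Real.log n * (Real.exp 3 * C) * Real.exp (-((1 - ε) * (t * R.deg u))) := by
    intro u
    have hdeg := h.deg_pos u
    have h1 : 2 * Real.log n / d ≤ 2 * Real.log n * t := by
      calc 2 * Real.log n / d = 2 * Real.log n * (1 / d) := by ring
        _ ≤ _ := by gcongr
    have hy : 0 ≤ t * R.deg u := by positivity
    have h2 := hC _ hy
    have hlp := lowProb_nonneg R ht.le m u
    calc _ ≤ 2 * Real.log n * t * R.deg u * lowProb R t m u := by gcongr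
      _ = 2 * Real.log n * Real.exp 3 * ((t * R.deg u) ^ (m + 1) * Real.exp (-(t * R.deg u))) := by
          rw [lowProb, sub_eq_add_neg, Real.exp_add]; ring
      _ ≤ 2 * Real.log n * Real.exp 3 *
          (C * Real.exp (ε * (t * R.deg u)) * Real.exp (-(t * R.deg u))) := by gcongr
      _ = _ := by
          rw [mul_assoc C, ← Real.exp_add]
          have : ε * (t * R.deg u) + -(t * R.deg u) = -((1 - ε) * (t * R.deg u)) := by ring
          rw [this]; ring
  refine (Finset.sum_le_sum fun u _ => hpt u).trans ?_
  rw [← Finset.mul_sum]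
  gcongr
  exact sum_exp_le_of_sum_exp_eq Finset.univ _ hε hε1 (by have := h.two_le; omega)
    (Finset.card_fin n) hsum

/-- There are deterministic times such that whp the hitting time of minimum degree `k` lies between
them, while the vertices of small degree at the earlier time are well separated at the later one. -/
theorem exists_times_smallBad {R : (n : ℕ) → RateMatrix n} {α γ b : ℝ} {d : ℕ → ℝ}
    (hR : IsRM R α γ b d) : ∃ c : ℕ, ∀ k m : ℕ, ∃ t t₁ : ℕ → ℝ,
      (∀ᶠ n in atTop, 0 < t n ∧ 0 < t₁ n) ∧
      Tendsto (fun n => (clocksLaw (R n)).real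
        {E | ∀ u, 1 ≤ degree (processGraph E (ENNReal.ofReal (t n))) u}) atTop (𝓝 0) ∧
      Tendsto (fun n => (clocksLaw (R n)).real {E | ∃ u, LowAt E (t₁ n) k u}) atTop (𝓝 0) ∧
      Tendsto (fun n => (clocksLaw (R n)).real (SmallBad (t n) (t₁ n) m c)) atTop (𝓝 0) := by
  set γ' := min γ 1 with hγ'
  have hγ'0 : 0 < γ' := lt_min hR.gamma_pos one_pos
  have hγ'1 : γ' ≤ 1 := min_le_right _ _
  have hγ'γ : γ' ≤ γ := min_le_left _ _
  -- Below `ρ G ≤ n^(-γ'/2)`, so `(ρ G)^c ≤ n^(-2)` beats the `n` choices of the starting vertex.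
  obtain ⟨c, hc⟩ := exists_nat_ge (4 / γ')
  rw [div_le_iff₀ hγ'0] at hc
  refine ⟨c, fun k m => ?_⟩
  -- `ρ G²` is `n^(-γ+4ε)` up to `(log n)³`; with `4ε = γ'/4` this leaves `n^(-γ'/4)` for the
  -- logarithms and `n^(-γ'/2)` for the bound.
  set ε := γ' / 16 with hε
  have hε0 : 0 < ε := by positivity
  have hε1 : ε ≤ 1 := by linarith
  obtain ⟨C, hC0, hC⟩ := exists_pow_le_mul_exp (m + 1) hε0
  obtain ⟨C', hC'0, hC'⟩ := exists_pow_le_mul_exp k (ε := 1 / 4) (by norm_num)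
  set A := Real.exp 3 * C + 1 with hA
  have hA1 : 1 ≤ A := by
    have := mul_pos (Real.exp_pos 3) hC0
    linarith
  have hcast : Tendsto (fun n : ℕ => (n : ℝ)) atTop atTop := tendsto_natCast_atTop_atTop
  have hneg : ∀ p : ℝ, 0 < p → Tendsto (fun n : ℕ => (n : ℝ) ^ (-p)) atTop (𝓝 0) := fun p hp =>
    (tendsto_rpow_neg_atTop hp).comp hcast
  have ev1 : ∀ᶠ n : ℕ in atTop, 1 ≤ Real.log n :=
    (Real.tendsto_log_atTop.comp hcast).eventually_ge_atTop 1
  have ev2 : ∀ᶠ n : ℕ in atTop, (n : ℝ) ^ ε ≤ Real.exp (-b) * n := by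
    filter_upwards [(hneg (1 - ε) (by linarith)).eventually_le_const (Real.exp_pos (-b)),
      eventually_gt_atTop 0] with n hn hn0
    have hn0' : (0 : ℝ) < n := by exact_mod_cast hn0
    calc (n : ℝ) ^ ε = (n : ℝ) ^ (-(1 - ε)) * n := by
          conv_rhs => rw [← Real.rpow_add_one hn0'.ne']
          congr 1; ring
      _ ≤ _ := by gcongr
  -- Stated as an implication so that a time can be chosen for every `n`; its value is irrelevant
  -- for the finitely many bad `n`.
  have hex : ∀ n, ∃ t, IsRMAt (R n) α γ b (d n) → 1 ≤ Real.log n →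
      (n : ℝ) ^ ε ≤ Real.exp (-b) * n → 1 / d n ≤ t ∧ t ≤ Real.log n / d n ∧
        ∑ u, Real.exp (-(t * (R n).deg u)) = (n : ℝ) ^ ε := by
    intro n
    by_cases hn : IsRMAt (R n) α γ b (d n) ∧ 1 ≤ Real.log n ∧ (n : ℝ) ^ ε ≤ Real.exp (-b) * n
    · obtain ⟨t, ht⟩ := exists_time_sum_exp_eq hn.1 hε0.le hn.2.2 hn.2.1
      exact ⟨t, fun _ _ _ => ht⟩
    · exact ⟨0, fun h1 h2 h3 => absurd ⟨h1, h2, h3⟩ hn⟩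
  choose t ht using hex
  -- Now `t₁ d_R(u) ≥ 2 log n`, so a vertex has degree below `k` with probability `O(n^(-3/2))`,
  -- which survives a sum over all vertices.
  set t₁ : ℕ → ℝ := fun n => 2 * Real.log n / d n with ht₁
  have ev3 : ∀ᶠ n : ℕ in atTop, (2 * c + 3 : ℕ) * Real.log n * (n : ℝ) ^ (-γ) ≤ 1 :=
    (tendsto_log_mul_rpow_neg hR.gamma_pos).eventually_le_const one_pos
  have hmain : ∀ᶠ n : ℕ in atTop, IsRMAt (R n) α γ b (d n) ∧ 1 ≤ Real.log n ∧
      (1 / d n ≤ t n ∧ t n ≤ Real.log n / d n ∧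
        ∑ u, Real.exp (-(t n * (R n).deg u)) = (n : ℝ) ^ ε) ∧
      (2 * c + 3 : ℕ) * Real.log n * (n : ℝ) ^ (-γ) ≤ 1 := by
    filter_upwards [hR.eventually_isRMAt, ev1, ev2, ev3] with n h0 h1 h2 h3
    exact ⟨h0, h1, ht n h0 h1 h2, h3⟩
  have hcons : ∀ n, IsRMAt (R n) α γ b (d n) → 1 ≤ Real.log n → 1 / d n ≤ t n →
      t n ≤ Real.log n / d n → 0 < t n ∧ 0 < t₁ n ∧ (∀ u, 1 ≤ t n * (R n).deg u) ∧
      (∀ u, 2 * Real.log n ≤ t₁ n * (R n).deg u) ∧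
      (∀ u v, (R n).rate u v * t n ≤ Real.log n * (n : ℝ) ^ (-γ)) ∧
      ∀ u v, (R n).rate u v * t₁ n ≤ 2 * Real.log n * (n : ℝ) ^ (-γ) := by
    intro n h hlog htn htn'
    have hd := h.d_pos
    have htpos : 0 < t n := lt_of_lt_of_le (by positivity) htn
    have ht₁pos : 0 < t₁ n := by
      simp only [ht₁]
      have : 0 < Real.log n := by linarith
      positivity
    refine ⟨htpos, ht₁pos, fun u => ?_, fun u => ?_, fun u v => ?_, fun u v => ?_⟩
    · calc 1 = 1 / d n * d n := by field_simp
        _ ≤ t n * (R n).deg u := by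
            have := h.le_deg u
            gcongr
    · calc 2 * Real.log n = t₁ n * d n := by simp only [ht₁]; field_simp
        _ ≤ _ := by
            have := h.le_deg u
            gcongr
    · calc (R n).rate u v * t n ≤ (d n * (n : ℝ) ^ (-γ)) * (Real.log n / d n) := by
            have := h.rate_le u v
            gcongr
        _ = _ := by field_simp
    · calc (R n).rate u v * t₁ n ≤ (d n * (n : ℝ) ^ (-γ)) * t₁ n := by
            have := h.rate_le u v
            gcongr
        _ = _ := by simp only [ht₁]; field_simp
  refine ⟨t, t₁, ?_, ?_, ?_, ?_⟩
  · filter_upwards [hmain] with n ⟨h, hlog, ⟨h1, h2, _⟩, _⟩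
    obtain ⟨a1, a2, -⟩ := hcons n h hlog h1 h2
    exact ⟨a1, a2⟩
  · have hlim : Tendsto (fun n : ℕ => (n : ℝ) ^ (-ε) +
        (Real.exp (1 * Real.log n * (n : ℝ) ^ (-γ)) - 1)) atTop (𝓝 0) := by
      have h1 := (Real.continuous_exp.tendsto 0).comp
        (tendsto_log_mul_rpow_neg (c := 1) hR.gamma_pos)
      rw [Real.exp_zero] at h1
      have := (hneg ε hε0).add (h1.sub_const 1)
      simpa using this
    refine tendsto_of_tendsto_of_tendsto_of_le_of_le' tendsto_const_nhds hlim
      (Eventually.of_forall fun n => measureReal_nonneg) ?_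
    filter_upwards [hmain] with n ⟨h, hlog, ⟨h1, h2, h3⟩, _⟩
    obtain ⟨a1, a2, a3, a4, a5, a6⟩ := hcons n h hlog h1 h2
    refine (measureReal_forall_one_le_degree_le (R n) (κ := Real.log n * (n : ℝ) ^ (-γ)) a1.le
      (fun u v => by rw [mul_comm]; exact a5 u v) (by have := h.two_le; omega)).trans ?_
    rw [h3, one_mul, Real.rpow_neg h.n_pos.le ε, one_div]
  · have hlim : Tendsto (fun n : ℕ => Real.exp 3 * C' * (n : ℝ) ^ (-(1 / 2) : ℝ)) atTop (𝓝 0) := by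
      have := (hneg (1 / 2) (by norm_num)).const_mul (Real.exp 3 * C')
      rwa [mul_zero] at this
    refine tendsto_of_tendsto_of_tendsto_of_le_of_le' tendsto_const_nhds hlim
      (Eventually.of_forall fun n => measureReal_nonneg) ?_
    filter_upwards [hmain] with n ⟨h, hlog, ⟨h1, h2, h3⟩, h4⟩
    obtain ⟨a1, a2, a3, a4, a5, a6⟩ := hcons n h hlog h1 h2
    have hn0 := h.n_pos
    have hpt : ∀ u, (clocksLaw (R n)).real {E | LowAt E (t₁ n) k u}
        ≤ Real.exp 3 * C' * (n : ℝ) ^ (-(3 / 2) : ℝ) := by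
      intro u
      refine (measureReal_degree_lt_le_lowProb (R n) a2.le (by linarith [a4 u]) (fun v => ?_)
        k).trans ?_
      · refine (a6 u v).trans (le_trans ?_ h4)
        have : (2 : ℝ) ≤ (2 * c + 3 : ℕ) := by push_cast; linarith [Nat.cast_nonneg (α := ℝ) c]
        gcongr
      · rw [lowProb]
        set y := t₁ n * (R n).deg u
        have hy : 2 * Real.log n ≤ y := a4 u
        have hy0 : 0 ≤ y := by linarith
        calc y ^ k * Real.exp (3 - y) ≤ C' * Real.exp (1 / 4 * y) * Real.exp (3 - y) := by
              gcongr; exact hC' y hy0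
          _ = C' * (Real.exp (1 / 4 * y) * Real.exp (3 - y)) := by ring
          _ = C' * (Real.exp 3 * Real.exp (-(3 / 4 * y))) := by
              rw [← Real.exp_add, ← Real.exp_add]
              have : 1 / 4 * y + (3 - y) = 3 + -(3 / 4 * y) := by ring
              rw [this]
          _ ≤ C' * (Real.exp 3 * (n : ℝ) ^ (-(3 / 2) : ℝ)) := by
              gcongr
              rw [Real.rpow_def_of_pos hn0, Real.exp_le_exp]
              linarith
          _ = _ := by ring
    have hsub : {E : Clocks n | ∃ u, LowAt E (t₁ n) k u}
        ⊆ ⋃ u ∈ (Finset.univ : Finset (Fin n)), {E | LowAt E (t₁ n) k u} := by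
      rintro E ⟨u, hu⟩
      simp only [Set.mem_iUnion]
      exact ⟨u, Finset.mem_univ _, hu⟩
    calc _ ≤ _ := measureReal_mono hsub (measure_ne_top _ _)
      _ ≤ _ := measureReal_biUnion_finset_le _ _
      _ ≤ ∑ _u : Fin n, Real.exp 3 * C' * (n : ℝ) ^ (-(3 / 2) : ℝ) :=
          Finset.sum_le_sum fun u _ => hpt u
      _ = Real.exp 3 * C' * ((n : ℝ) ^ (-(3 / 2) : ℝ) * n) := by
          rw [Finset.sum_const, Finset.card_univ, Fintype.card_fin, nsmul_eq_mul]; ring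
      _ = _ := by
          rw [← Real.rpow_add_one hn0.ne']
          norm_num
  · have hlim : Tendsto (fun n : ℕ => 2 * (n : ℝ) ^ (-(γ' / 2)) + (n : ℝ) ^ (-1 : ℝ))
        atTop (𝓝 0) := by
      have := ((hneg (γ' / 2) (by positivity)).const_mul 2).add (hneg 1 one_pos)
      simpa using this
    have ev4 : ∀ᶠ n : ℕ in atTop,
        8 * A ^ 2 * (1 * Real.log n * (n : ℝ) ^ (-(γ' / 12))) ^ 3 ≤ 1 := by
      have := ((tendsto_log_mul_rpow_neg (c := 1) (γ := γ' / 12) (by positivity)).pow 3).const_mul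
        (8 * A ^ 2)
      simp only [ne_eq, OfNat.ofNat_ne_zero, not_false_eq_true, zero_pow, mul_zero] at this
      exact this.eventually_le_const one_pos
    refine tendsto_of_tendsto_of_tendsto_of_le_of_le' tendsto_const_nhds hlim
      (Eventually.of_forall fun n => measureReal_nonneg) ?_
    filter_upwards [hmain, ev4] with n ⟨h, hlog, ⟨h1, h2, h3⟩, h4⟩ h5
    obtain ⟨a1, a2, a3, a4, a5, a6⟩ := hcons n h hlog h1 h2
    have hn0 := h.n_pos
    have hn1 : (1 : ℝ) ≤ n := by
      have := h.two_le
      exact_mod_cast (by omega : 1 ≤ n)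
    have hlog0 : 0 ≤ Real.log n := by linarith
    set ρ := 2 * Real.log n * (n : ℝ) ^ (-γ) with hρ
    set G := 2 * Real.log n * A * (n : ℝ) ^ (2 * ε) with hG
    have hρ0 : 0 ≤ ρ := by positivity
    have hGsum : ∑ u, t₁ n * (R n).deg u * lowProb (R n) (t n) m u ≤ G := by
      refine (sum_deg_mul_lowProb_le h hε0 hε1 h1 hlog0 h3 hC0 hC).trans ?_
      rw [hG, hA]
      gcongr
      linarith
    have hG1 : 1 ≤ G := by
      have hp : 1 ≤ (n : ℝ) ^ (2 * ε) := Real.one_le_rpow hn1 (by positivity)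
      have h6 : 1 ≤ 2 * Real.log n * A := by nlinarith
      rw [hG]
      exact one_le_mul_of_one_le_of_one_le h6 hp
    have hρG2 : ρ * G ^ 2 ≤ (n : ℝ) ^ (-(γ' / 2)) := by
      have e1 : (n : ℝ) ^ (-γ) * ((n : ℝ) ^ (2 * ε)) ^ 2
          ≤ ((n : ℝ) ^ (-(γ' / 12))) ^ 3 * (n : ℝ) ^ (-(γ' / 2)) := by
        rw [← Real.rpow_mul_natCast hn0.le, ← Real.rpow_mul_natCast hn0.le, ← Real.rpow_add hn0,
          ← Real.rpow_add hn0]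
        refine Real.rpow_le_rpow_of_exponent_le hn1 ?_
        push_cast
        linarith
      calc ρ * G ^ 2 = 8 * A ^ 2 * Real.log n ^ 3 * ((n : ℝ) ^ (-γ) * ((n : ℝ) ^ (2 * ε)) ^ 2) := by
            rw [hρ, hG]; ring
        _ ≤ 8 * A ^ 2 * Real.log n ^ 3 *
            (((n : ℝ) ^ (-(γ' / 12))) ^ 3 * (n : ℝ) ^ (-(γ' / 2))) := by gcongr
        _ = (8 * A ^ 2 * (1 * Real.log n * (n : ℝ) ^ (-(γ' / 12))) ^ 3) *
            (n : ℝ) ^ (-(γ' / 2)) := by ring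
        _ ≤ 1 * (n : ℝ) ^ (-(γ' / 2)) := by gcongr
        _ = _ := one_mul _
    have hρG : ρ * G ≤ (n : ℝ) ^ (-(γ' / 2)) := by
      refine le_trans ?_ hρG2
      gcongr
      exact le_self_pow₀ hG1 two_ne_zero
    refine (measureReal_smallBad_le (R n) a1.le a2.le a3 (fun u v => ?_) (fun u => ?_) hρ0 a6
      hGsum).trans ?_
    · calc _ ≤ ((2 * c + 3 : ℕ) : ℝ) * (Real.log n * (n : ℝ) ^ (-γ)) := by
            exact mul_le_mul_of_nonneg_left (a5 u v) (Nat.cast_nonneg _)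
        _ ≤ 1 := by rw [← mul_assoc]; exact h4
    · linarith [a4 u]
    · have hpow : (ρ * G) ^ c ≤ (n : ℝ) ^ (-2 : ℝ) := by
        calc (ρ * G) ^ c ≤ ((n : ℝ) ^ (-(γ' / 2))) ^ c := by gcongr
          _ = (n : ℝ) ^ (-(γ' / 2) * c) := (Real.rpow_mul_natCast hn0.le _ _).symm
          _ ≤ _ := Real.rpow_le_rpow_of_exponent_le hn1 (by linarith)
      have h7 : (n : ℝ) * (ρ * G) ^ c ≤ (n : ℝ) ^ (-1 : ℝ) := by
        calc (n : ℝ) * (ρ * G) ^ c ≤ n * (n : ℝ) ^ (-2 : ℝ) := by gcongr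
          _ = (n : ℝ) ^ (-2 : ℝ) * n := mul_comm _ _
          _ = _ := by rw [← Real.rpow_add_one hn0.ne']; norm_num
      linarith

/-! ### Assembling the expansion statement. -/

lemma whp_of_tendsto_measureReal {R : (n : ℕ) → RateMatrix n} {p : (n : ℕ) → Clocks n → Prop}
    {B : (n : ℕ) → Set (Clocks n)} (hB : Tendsto (fun n => (clocksLaw (R n)).real (B n)) atTop (𝓝 0))
    (h : ∀ᶠ n in atTop, ∀ E, E ∉ B n → p n E) : Whp R p := by
  have h0 : Tendsto (fun n => clocksLaw (R n) (B n)) atTop (𝓝 0) := by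
    have := ENNReal.tendsto_ofReal hB
    simpa [ofReal_measureReal] using this
  refine tendsto_of_tendsto_of_tendsto_of_le_of_le' tendsto_const_nhds h0
    (Eventually.of_forall fun n => zero_le) ?_
  filter_upwards [h] with n hn
  refine measure_mono fun E hE => ?_
  by_contra hEB
  exact hE (hn E hEB)

/-- Expansion of small sets in the sparse graph. -/
theorem exists_expansion {R : (n : ℕ) → RateMatrix n} {α γ b : ℝ} {d : ℕ → ℝ}
    (hR : IsRM R α γ b d) {k : ℕ} (hk : 1 ≤ k) : ∃ (D : ℕ) (β : ℝ), k ≤ D ∧ 0 < β ∧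
      Whp R fun n E => ∀ A : Finset (Fin n), (A.card : ℝ) < β * n →
        k * A.card ≤ (nbhd (sparseGraph E D k) (A : Set (Fin n))).ncard := by
  obtain ⟨c, hc⟩ := exists_times_smallBad hR
  obtain ⟨D₂, hD₂⟩ := exists_tendsto_largeBad hR (K := k + 2) (by omega)
  -- The number of neighbours required by the counting argument; the last `k` ensures `k ≤ D`.
  set D := D₂ + 1 + k * c + k with hD
  obtain ⟨β, hβ0, hβ1, hlarge⟩ := hD₂ D
  obtain ⟨t, t₁, hpos, hiso, hmin, hsmall⟩ := hc k D
  -- The sets `W` that occur have at most `(k + 2)|A|` elements and must stay below `β n`.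
  refine ⟨D, β / (k + 2), by omega, by positivity, ?_⟩
  refine whp_of_tendsto_measureReal (B := fun n => (LargeBad (R n) (k + 2) D D₂ β ∪
      {E | ∀ u, 1 ≤ degree (processGraph E (ENNReal.ofReal (t n))) u}) ∪
      ({E | ∃ u, LowAt E (t₁ n) k u} ∪ SmallBad (t n) (t₁ n) D c)) ?_ ?_
  · have hsum := (hlarge.add hiso).add (hmin.add hsmall)
    simp only [add_zero] at hsum
    refine tendsto_of_tendsto_of_tendsto_of_le_of_le tendsto_const_nhds hsum
      (fun n => measureReal_nonneg) fun n => ?_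
    exact (measureReal_union_le _ _).trans
      (add_le_add (measureReal_union_le _ _) (measureReal_union_le _ _))
  · filter_upwards [hR.eventually_isRMAt, hpos] with n hn ⟨ht0, ht₁0⟩ E hE A hA
    simp only [Set.mem_union, not_or] at hE
    obtain ⟨⟨hE1, hE2⟩, hE3, hE4⟩ := hE
    have hn0 := hn.n_pos
    simp only [Set.mem_ofPred_eq, not_forall, not_le] at hE2
    obtain ⟨u₀, hu₀⟩ := hE2
    simp only [Set.mem_ofPred_eq, not_exists, LowAt, not_lt] at hE3
    have hT0 : (0 : ℝ≥0∞) < ENNReal.ofReal (t₁ n) := ENNReal.ofReal_pos.2 ht₁0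
    -- The vertex `u₀` is isolated at time `t n`, and `k ≥ 1`.
    have hle : ENNReal.ofReal (t n) ≤ minDegreeTime E k :=
      le_minDegreeTime E (hu₀.trans_le hk)
    have hle' : minDegreeTime E k ≤ ENNReal.ofReal (t₁ n) := minDegreeTime_le E hT0 hE3
    have hdegk := le_degree_minDegreeTime E hT0 hE3
    set τ := minDegreeTime E k with hτ
    have hlow : ∀ u, degree (processGraph E τ) u < D → LowAt E (t n) D u := fun u hu =>
      (degree_mono (processGraph_mono E hle) u).trans_lt hu
    have hadjt : ∀ u v, (sparseGraph E D k).Adj u v → E s(u, v) ≤ ENNReal.ofReal (t₁ n) :=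
      fun u v huv => huv.1.2.1.trans hle'
    refine mul_card_le_ncard_nbhd (sparseGraph E D k) (c := c) (D₂ := D₂)
      (fun u => degree (processGraph E τ) u < D) ?_ ?_ ?_ ?_ A ?_
    · intro u
      by_cases hu : degree (processGraph E τ) u < D
      · exact (hdegk u).trans (Set.ncard_le_ncard
          (fun v hv => sparseGraph_adj_of_degree_lt E hu hv) (Set.toFinite _))
      · rw [not_lt] at hu
        obtain ⟨N, hN, hNadj⟩ := exists_sparseGraph_neighbors E hT0 hu
          (hu.trans (degree_mono (processGraph_mono E hle') u))
        have h1 : (N : Set (Fin n)).ncard ≤ degree (sparseGraph E D k) u :=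
          Set.ncard_le_ncard (fun v hv => (hNadj v hv).1) (Set.toFinite _)
        rw [Set.ncard_coe_finset] at h1
        omega
    · intro s s' hs hs' hne hadj
      exact hE4 (Or.inl (Or.inl ⟨s, s', hne, hlow s hs, hlow s' hs', hadjt _ _ hadj⟩))
    · intro s s' y hs hs' hne hsy hys'
      exact hE4 (Or.inl (Or.inr ⟨s, s', y, ⟨hne, hsy.ne'⟩, hlow s hs, hlow s' hs', hadjt _ _ hsy,
        hadjt _ _ hys'⟩))
    · intro x y s hy hs hx hysm hssm hall
      refine hE4 (Or.inr ⟨x, y, s, ⟨hy, hs, fun i => (hall i).1.ne', fun i h => ?_, fun i j h => ?_⟩,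
        fun i => ⟨hlow _ (hssm i), hadjt _ _ (hall i).1, hadjt _ _ (hall i).2⟩⟩)
      · exact hx (h ▸ hssm i)
      · exact hysm i (h ▸ hssm j)
    · intro L W hLW hLne hLsm hWL hLA
      by_contra hcon
      refine hE1 ⟨L, W, hLW, hLne, hWL, ?_, fun u hu hdeg => ?_⟩
      · have h1 : (W.card : ℝ) ≤ (k + 2) * L.card := by exact_mod_cast hWL
        have h2 : (L.card : ℝ) ≤ A.card := by exact_mod_cast hLA
        calc (W.card : ℝ) ≤ (k + 2) * A.card := h1.trans (by gcongr)
          _ ≤ (k + 2) * (β / (k + 2) * n) := by gcongr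
          _ = β * n := by field_simp
      · by_contra hhit
        rw [not_le] at hhit
        have hWc : (0 : ℝ) < W.card := by exact_mod_cast (hLne.mono hLW).card_pos
        have hW1 : (W.card : ℝ) / n < 1 := by
          rw [div_lt_one hn0]
          have h1 : (W.card : ℝ) ≤ (k + 2) * L.card := by exact_mod_cast hWL
          have h2 : (L.card : ℝ) ≤ A.card := by exact_mod_cast hLA
          calc (W.card : ℝ) ≤ (k + 2) * A.card := h1.trans (by gcongr)
            _ ≤ (k + 2) * (β / (k + 2) * n) := by gcongr
            _ = β * n := by field_simp
            _ < 1 * n := by gcongr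
            _ = n := one_mul _
        -- Hitting times only range over positive times, so the strict inequality `|W| < n` is
        -- needed; it comes from `β < 1`.
        have hlt : 0 < largeTime (R n) (k + 2) W u := by
          have := hn.deg_pos u
          have : 0 < -Real.log ((W.card : ℝ) / n) := by
            linarith [Real.log_neg (by positivity : 0 < (W.card : ℝ) / n) hW1]
          unfold largeTime
          positivity
        obtain ⟨N, hN, hNadj⟩ := exists_sparseGraph_neighbors (k := k) E (ENNReal.ofReal_pos.2 hlt)
          (not_lt.1 (hLsm u hu)) hdeg
        refine hcon ⟨u, hu, N, by omega, fun v hv => (hNadj v hv).1, lt_of_le_of_lt ?_ hhit⟩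
        refine Finset.card_le_card fun v hv => ?_
        obtain ⟨hvW, hvN⟩ := Finset.mem_filter.1 hv
        exact Finset.mem_filter.2 ⟨hvW, (hNadj v hvN).1.ne', (hNadj v hvN).2⟩

/-! ### The light tail. -/

/-- By independence two clocks have a product law, and by Fubini the finite part of the diagonal is
null as finite values are not atoms. Clocks equal to `⊤` may coincide. -/
lemma ae_noTies {n : ℕ} (R : RateMatrix n) : ∀ᵐ E ∂clocksLaw R, NoTies E := by
  unfold NoTies
  simp only [ae_all_iff]
  intro e e' hne
  have hind := (iIndepFun_clocks R).indepFun hne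
  rw [indepFun_iff_map_prod_eq_prod_map_map (measurable_pi_apply e).aemeasurable
    (measurable_pi_apply e').aemeasurable, map_clocks, map_clocks] at hind
  have hB : MeasurableSet {p : ℝ≥0∞ × ℝ≥0∞ | p.1 < ⊤ ∧ p.1 = p.2} :=
    (measurableSet_Iio.preimage measurable_fst).inter
      (measurableSet_eq_fun measurable_fst measurable_snd)
  have h0 : ((clockLaw (R.pairRate e)).prod (clockLaw (R.pairRate e')))
      {p : ℝ≥0∞ × ℝ≥0∞ | p.1 < ⊤ ∧ p.1 = p.2} = 0 := by
    rw [Measure.measure_prod_null hB]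
    refine Eventually.of_forall fun x => ?_
    by_cases hx : x < ⊤
    · refine measure_mono_null (fun y hy => ?_) (clockLaw_singleton (R.pairRate e') hx.ne)
      exact hy.2.symm
    · have : Prod.mk x ⁻¹' {p : ℝ≥0∞ × ℝ≥0∞ | p.1 < ⊤ ∧ p.1 = p.2} = ∅ := by
        ext y
        simp [hx]
      simp [this]
  rw [← hind, Measure.map_apply ((measurable_pi_apply e).prodMk (measurable_pi_apply e')) hB] at h0
  rw [ae_iff]
  refine measure_mono_null (fun E hE => ?_) h0
  simp only [Set.mem_ofPred_eq, Classical.not_imp, ne_eq, not_not] at hE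
  exact hE

open Classical in
-- Markov's inequality for the number of events. The events are replaced by measurable hulls, so no
-- measurability is assumed.
lemma measureReal_card_ge_le {Ω ι : Type*} [MeasurableSpace Ω] [Fintype ι] (μ : Measure Ω)
    [IsProbabilityMeasure μ] (A : ι → Set Ω) {a : ℝ} (ha : 0 < a) :
    μ.real {ω | a ≤ ((Finset.univ.filter fun i => ω ∈ A i).card : ℝ)} ≤ (∑ i, μ.real (A i)) / a := by
  set f : Ω → ℝ≥0∞ := fun ω => ∑ i, (toMeasurable μ (A i)).indicator (fun _ => 1) ω with hf
  have hfm : Measurable f := Finset.measurable_sum _ fun i _ =>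
    measurable_const.indicator (measurableSet_toMeasurable μ _)
  have hint : ∫⁻ ω, f ω ∂μ = ENNReal.ofReal (∑ i, μ.real (A i)) := by
    rw [hf, lintegral_finsetSum _ fun i _ =>
      measurable_const.indicator (measurableSet_toMeasurable μ _),
      ENNReal.ofReal_sum_of_nonneg fun i _ => measureReal_nonneg]
    refine Finset.sum_congr rfl fun i _ => ?_
    rw [lintegral_indicator_const (measurableSet_toMeasurable μ _), one_mul, measure_toMeasurable,
      ofReal_measureReal]
  have hsub : {ω | a ≤ ((Finset.univ.filter fun i => ω ∈ A i).card : ℝ)}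
      ⊆ {ω | ENNReal.ofReal a ≤ f ω} := by
    intro ω hω
    simp only [Set.mem_ofPred_eq] at hω ⊢
    calc ENNReal.ofReal a ≤ ENNReal.ofReal ((Finset.univ.filter fun i => ω ∈ A i).card : ℝ) :=
          ENNReal.ofReal_le_ofReal hω
      _ = ∑ i, if ω ∈ A i then (1 : ℝ≥0∞) else 0 := by
          rw [ENNReal.ofReal_natCast, Finset.card_filter]; push_cast; rfl
      _ ≤ f ω := by
          refine Finset.sum_le_sum fun i _ => ?_
          split_ifs with hi
          · rw [Set.indicator_of_mem (subset_toMeasurable μ _ hi)]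
          · exact zero_le
  have hnn : 0 ≤ (∑ i, μ.real (A i)) / a :=
    div_nonneg (Finset.sum_nonneg fun i _ => measureReal_nonneg) ha.le
  refine ENNReal.toReal_le_of_le_ofReal hnn ((measure_mono hsub).trans ?_)
  have h1 := mul_meas_ge_le_lintegral (μ := μ) hfm (ENNReal.ofReal a)
  rw [hint] at h1
  rw [ENNReal.ofReal_div_of_pos ha,
    ENNReal.le_div_iff_mul_le (Or.inl (by simpa using ha)) (Or.inl ENNReal.ofReal_ne_top), mul_comm]
  exact h1

section Sparse

variable {n : ℕ}

open Classical in
/-- The sparse graph has at most `D n` edges. -/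
lemma sum_degree_sparseGraph_le {E : Clocks n} (hE : NoTies E) {D : ℕ} (hD : 1 ≤ D) (k : ℕ) :
    ∑ u, degree (sparseGraph E D k) u ≤ 2 * D * n := by
  have hch : ∀ u, (Finset.univ.filter (· ∈ chosen E D u)).card ≤ D := by
    intro u
    rw [← Set.ncard_coe_finset]
    simpa using ncard_chosen_le hE hD u
  have h1 : ∀ u, degree (sparseGraph E D k) u ≤ (Finset.univ.filter (· ∈ chosen E D u)).card
      + (Finset.univ.filter fun v => u ∈ chosen E D v).card := by
    intro u
    refine le_trans ?_ (Finset.card_union_le _ _)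
    rw [← Set.ncard_coe_finset]
    refine Set.ncard_le_ncard (fun v hv => ?_) (Set.toFinite _)
    rcases mem_chosen_of_adj hv with h | h
    · simp [h]
    · simp [h]
  have h2 : ∑ u, (Finset.univ.filter fun v => u ∈ chosen E D v).card
      = ∑ v, (Finset.univ.filter (· ∈ chosen E D v)).card := by
    simp only [Finset.card_filter]
    exact Finset.sum_comm
  have h3 : ∑ u : Fin n, (Finset.univ.filter (· ∈ chosen E D u)).card ≤ n * D := by
    calc _ ≤ ∑ _u : Fin n, D := Finset.sum_le_sum fun u _ => hch u
      _ = _ := by simp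
  calc _ ≤ _ := Finset.sum_le_sum fun u _ => h1 u
    _ = _ := Finset.sum_add_distrib
    _ ≤ _ := by rw [h2]; linarith

open Classical in
lemma card_mul_le_sum {f : Fin n → ℝ} (hf : ∀ u, 0 ≤ f u) (a : ℝ) :
    ((Finset.univ.filter fun u => a ≤ f u).card : ℝ) * a ≤ ∑ u, f u := by
  calc _ = ∑ _u ∈ Finset.univ.filter fun u => a ≤ f u, a := by simp
    _ ≤ ∑ u ∈ Finset.univ.filter fun u => a ≤ f u, f u :=
        Finset.sum_le_sum fun u hu => (Finset.mem_filter.1 hu).2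
    _ ≤ _ := Finset.sum_le_sum_of_subset_of_nonneg (Finset.subset_univ _) fun u _ _ => hf u

/-- Markov's inequality for each criterion: the degrees in `H` sum to at most `2Dn`, the weighted
degrees to at most `b d n`. -/
lemma ncard_highDegree_mul_le {R : RateMatrix n} {α γ b d : ℝ} (h : IsRMAt R α γ b d)
    {E : Clocks n} (hE : NoTies E) {D : ℕ} (hD : 1 ≤ D) (k : ℕ) {θ : ℝ} (hθ : 0 < θ) :
    ((highDegree R d θ (sparseGraph E D k)).ncard : ℝ) * θ ≤ (2 * D + b) * n := by
  classical
  set H := sparseGraph E D k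
  set S₁ := Finset.univ.filter fun u => θ ≤ (degree H u : ℝ) with hS₁
  set S₂ := Finset.univ.filter fun u => θ * d ≤ R.deg u with hS₂
  have h1 : (S₁.card : ℝ) * θ ≤ 2 * D * n := by
    refine (card_mul_le_sum (fun u => Nat.cast_nonneg (degree H u)) θ).trans ?_
    exact_mod_cast sum_degree_sparseGraph_le hE hD k
  have h2 : (S₂.card : ℝ) * θ ≤ b * n := by
    have h3 : (S₂.card : ℝ) * (θ * d) ≤ b * d * n :=
      (card_mul_le_sum (fun u => R.deg_nonneg u) (θ * d)).trans h.total_le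
    refine le_of_mul_le_mul_right (a := d) ?_ h.d_pos
    linarith
  have h4 : (highDegree R d θ H).ncard ≤ S₁.card + S₂.card := by
    refine le_trans ?_ (Finset.card_union_le _ _)
    rw [← Set.ncard_coe_finset]
    refine Set.ncard_le_ncard (fun u hu => ?_) (Set.toFinite _)
    rcases hu with hu | hu
    · simp [hS₁, hu]
    · simp [hS₂, hu]
  have h4' : ((highDegree R d θ H).ncard : ℝ) ≤ S₁.card + S₂.card := by exact_mod_cast h4
  calc _ ≤ ((S₁.card : ℝ) + S₂.card) * θ := by gcongr
    _ ≤ _ := by linarith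

/-- The closed neighbourhood of `S` in the sparse graph consists of `S`, the vertices chosen by `S`,
late vertices, exceptional vertices and vertices hitting `S` early. -/
lemma ncard_closedNbhd_le {E : Clocks n} (hE : NoTies E) {D : ℕ} (hD : 1 ≤ D) (k : ℕ)
    {t : Fin n → ℝ} (ht : ∀ v, 0 < t v) (S X : Finset (Fin n)) {late : Finset (Fin n)}
    (hlate : ∀ v, LowAt E (t v) D v → v ∈ late) :
    (closedNbhd (sparseGraph E D k) (S : Set (Fin n))).ncard
      ≤ (1 + D) * S.card + late.card + X.card + ∑ v ∈ Xᶜ, hits E S (t v) v := by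
  classical
  set C := S.biUnion fun u => Finset.univ.filter (· ∈ chosen E D u) with hC
  set T := Xᶜ.filter fun v => 1 ≤ hits E S (t v) v with hT
  have hsub : closedNbhd (sparseGraph E D k) (S : Set (Fin n)) ⊆
      ((S ∪ C ∪ late ∪ X ∪ T : Finset (Fin n)) : Set (Fin n)) := by
    intro v hv
    rw [Finset.mem_coe]
    simp only [Finset.mem_union]
    rcases hv with hv | ⟨hvS, u, hu, hadj⟩
    · exact Or.inl (Or.inl (Or.inl (Or.inl hv)))
    -- If `v` chose `u ∈ S` and is not late, its choices were made by `t v`, so this edge is a hit.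
    -- Otherwise `u` chose `v`.
    · rcases mem_chosen_of_adj hadj with h | h
      · by_cases h1 : LowAt E (t v) D v
        · exact Or.inl (Or.inl (Or.inr (hlate v h1)))
        · by_cases h2 : v ∈ X
          · exact Or.inl (Or.inr h2)
          · right
            have h3 : degreeTime E D v ≤ ENNReal.ofReal (t v) :=
              sInf_le ⟨ENNReal.ofReal_pos.2 (ht v), not_lt.1 h1⟩
            refine Finset.mem_filter.2 ⟨Finset.mem_compl.2 h2, ?_⟩
            refine Finset.card_pos.2 ⟨u, Finset.mem_filter.2 ⟨hu, h.1.symm, h.2.2.trans h3⟩⟩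
      · refine Or.inl (Or.inl (Or.inl (Or.inr ?_)))
        exact Finset.mem_biUnion.2 ⟨u, hu, by simpa using h⟩
  have hCc : C.card ≤ S.card * D := by
    refine Finset.card_biUnion_le.trans ?_
    rw [← smul_eq_mul, ← Finset.sum_const]
    refine Finset.sum_le_sum fun u _ => ?_
    rw [← Set.ncard_coe_finset]
    simpa using ncard_chosen_le hE hD u
  have hTc : T.card ≤ ∑ v ∈ Xᶜ, hits E S (t v) v := by
    rw [Finset.card_eq_sum_ones]
    calc _ ≤ ∑ v ∈ T, hits E S (t v) v :=
          Finset.sum_le_sum fun v hv => (Finset.mem_filter.1 hv).2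
      _ ≤ _ := Finset.sum_le_sum_of_subset (Finset.filter_subset _ _)
  have h1 := Set.ncard_le_ncard hsub (Set.toFinite _)
  rw [Set.ncard_coe_finset] at h1
  have h2 := Finset.card_union_le (S ∪ C ∪ late ∪ X) T
  have h3 := Finset.card_union_le (S ∪ C ∪ late) X
  have h4 := Finset.card_union_le (S ∪ C) late
  have h5 := Finset.card_union_le S C
  have h6 : (1 + D) * S.card = S.card + S.card * D := by ring
  omega

end Sparse

lemma Whp.of_eventually_le {R : (n : ℕ) → RateMatrix n} {p : (n : ℕ) → Clocks n → Prop}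
    (h : ∀ η : ℝ, 0 < η → ∀ᶠ n in atTop, (clocksLaw (R n)).real {E | ¬ p n E} ≤ η) : Whp R p := by
  refine whp_of_tendsto_measureReal (B := fun n => {E | ¬ p n E}) ?_
    (Eventually.of_forall fun n E hE => not_not.1 hE)
  refine tendsto_order.2 ⟨fun a ha => Eventually.of_forall fun n => ha.trans_le measureReal_nonneg,
    fun a ha => ?_⟩
  filter_upwards [h (a / 2) (by linarith)] with n hn
  linarith

/-- Some set is hit often by the vertices sending a weight of at most `x ^ δ` into it. -/
def HitBad {n : ℕ} (R : RateMatrix n) (T δ x ε : ℝ) : Set (Clocks n) :=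
  {E | ∃ W : Finset (Fin n), ε * n / 4 ≤
    ∑ u ∈ (Finset.univ.filter fun u => x ^ δ < R.hitProb W u)ᶜ, (hits E W (T / R.deg u) u : ℝ)}

/-- Under the tilt `x^(-δ/2)` the mean contributes at most `e^n` and the tail `e^(-2n)`, so each set
costs `2 e^(-n)`. As `2 < e`, a union bound over all `2^n` sets is affordable. -/
lemma measureReal_hitBad_le {n : ℕ} {R : RateMatrix n} {α γ b d : ℝ} (h : IsRMAt R α γ b d)
    {T δ x ε : ℝ} (hT : 0 < T) (hδ : 0 < δ) (hx : 0 < x) (hx1 : x ≤ 1)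
    (hTx : T * x ^ (δ / 2) ≤ 1) (hlog : 2 ≤ ε * δ / 16 * -Real.log x) :
    (clocksLaw R).real (HitBad R T δ x ε) ≤ 2 * (2 * Real.exp (-1)) ^ n := by
  have hn := h.n_pos
  have key : ∀ W : Finset (Fin n), (clocksLaw R).real {E | ε * n / 4 ≤
      ∑ u ∈ (Finset.univ.filter fun u => x ^ δ < R.hitProb W u)ᶜ, (hits E W (T / R.deg u) u : ℝ)}
      ≤ 2 * Real.exp (-1) ^ n := by
    intro W
    set L := (Finset.univ.filter fun u => x ^ δ < R.hitProb W u)ᶜ with hL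
    have hz : 1 ≤ x ^ (-(δ / 2)) := Real.one_le_rpow_of_pos_of_le_one_of_nonpos hx hx1 (by linarith)
    refine (measureReal_sum_hits_ge R L W (t := fun u => T / R.deg u)
      (fun u => div_nonneg hT.le (R.deg_nonneg u)) hz (ε * n / 4)).trans ?_
    have hsum : ∑ u ∈ L, ∑ v ∈ W, R.rate u v * (T / R.deg u) ≤ n * (T * x ^ δ) := by
      calc _ ≤ ∑ _u ∈ L, T * x ^ δ := by
            refine Finset.sum_le_sum fun u hu => ?_
            have hu' : R.hitProb W u ≤ x ^ δ := by simpa [hL] using hu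
            rw [← Finset.sum_mul]
            calc _ = T * R.hitProb W u := by rw [RateMatrix.hitProb]; ring
              _ ≤ _ := by gcongr
        _ = L.card * (T * x ^ δ) := by simp
        _ ≤ _ := by
            have : (L.card : ℝ) ≤ n := by
              exact_mod_cast (Finset.card_le_univ L).trans_eq (Fintype.card_fin n)
            gcongr
    have h1 : x ^ (-(δ / 2)) * ∑ u ∈ L, ∑ v ∈ W, R.rate u v * (T / R.deg u) ≤ n := by
      calc _ ≤ x ^ (-(δ / 2)) * (n * (T * x ^ δ)) := by gcongr
        _ = n * (T * (x ^ (-(δ / 2)) * x ^ δ)) := by ring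
        _ = n * (T * x ^ (δ / 2)) := by rw [← Real.rpow_add hx]; congr 3; ring
        _ ≤ n * 1 := by gcongr
        _ = n := mul_one _
    have h2 : (x ^ (-(δ / 2))) ^ (-(ε * n / 4 / 2)) ≤ Real.exp (-(2 * n)) := by
      rw [← Real.rpow_mul hx.le, Real.rpow_def_of_pos hx, Real.exp_le_exp]
      have := mul_le_mul_of_nonneg_right hlog hn.le
      linarith
    calc _ ≤ 2 * (Real.exp (-(2 * n)) * Real.exp n) := by gcongr
      _ = 2 * Real.exp (-1) ^ n := by
          rw [← Real.exp_add, ← Real.exp_nat_mul]; congr 2; ring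
  have hU : HitBad R T δ x ε = ⋃ W : Finset (Fin n), {E | ε * n / 4 ≤
      ∑ u ∈ (Finset.univ.filter fun u => x ^ δ < R.hitProb W u)ᶜ,
        (hits E W (T / R.deg u) u : ℝ)} := by
    ext E; simp [HitBad]
  rw [hU]
  refine (measureReal_iUnion_fintype_le _).trans ((Finset.sum_le_sum fun W _ => key W).trans ?_)
  simp only [Finset.sum_const, Finset.card_univ, Fintype.card_finset, Fintype.card_fin,
    nsmul_eq_mul, Nat.cast_pow, Nat.cast_ofNat]
  rw [mul_pow]
  apply le_of_eq; ring

open Classical in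
-- A fixed `x` suffices: once `θ x ≥ 2D + b`, the set `S_θ` has at most `x n` elements. It, its
-- choices and its exceptional vertices take `ε n / 2`; late vertices and hits take `ε n / 4` each.
lemma ncard_closedNbhd_highDegree_le {n : ℕ} {R : RateMatrix n} {α γ b d : ℝ}
    (h : IsRMAt R α γ b d) {D : ℕ} (hD : 1 ≤ D) (k : ℕ) {T δ x ε θ : ℝ} (hT : 0 < T)
    (hδ : 0 < δ) (hx : 0 < x) (hx1 : x ≤ 1)
    (hexc : ∀ W : Finset (Fin n), W.Nonempty → (W.card : ℝ) ≤ x * n →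
      ((Finset.univ.filter fun u => ((W.card : ℝ) / n) ^ δ < R.hitProb W u).card : ℝ)
          ≤ ((W.card : ℝ) / n) ^ δ * W.card)
    (hDx : (2 + D) * x ≤ ε / 2) (hθ : 0 < θ) (hθx : 2 * D + b ≤ θ * x) {E : Clocks n}
    (hE : NoTies E)
    (hlate : ((Finset.univ.filter fun v => LowAt E (T / R.deg v) D v).card : ℝ) < ε * n / 4)
    (hhit : E ∉ HitBad R T δ x ε) :
    ((closedNbhd (sparseGraph E D k) (highDegree R d θ (sparseGraph E D k))).ncard : ℝ)
      ≤ ε * n := by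
  have hn := h.n_pos
  set S' := highDegree R d θ (sparseGraph E D k) with hS'
  set S : Finset (Fin n) := (Set.toFinite S').toFinset with hS
  have hSS : (S : Set (Fin n)) = S' := (Set.toFinite S').coe_toFinset
  have hcard : (S.card : ℝ) ≤ x * n := by
    have h1 := ncard_highDegree_mul_le (θ := θ) h hE hD k hθ
    rw [← hS', ← hSS, Set.ncard_coe_finset] at h1
    refine le_of_mul_le_mul_right (a := θ) ?_ hθ
    calc _ ≤ (2 * D + b) * n := h1
      _ ≤ θ * x * n := by gcongr
      _ = _ := by ring
  rcases S.eq_empty_or_nonempty with h0 | hne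
  · have : closedNbhd (sparseGraph E D k) S' = ∅ := by
      rw [← hSS, h0]
      simp [closedNbhd, nbhd]
    rw [this]
    have : 0 ≤ ε := by
      have : 0 ≤ (2 + D) * x := by positivity
      linarith
    simp only [Set.ncard_empty, Nat.cast_zero]
    positivity
  set X := Finset.univ.filter fun u => x ^ δ < R.hitProb S u with hX
  have hXc : (X.card : ℝ) ≤ x * n := by
    have hSx : (S.card : ℝ) / n ≤ x := (div_le_iff₀ hn).2 hcard
    have hxd : ((S.card : ℝ) / n) ^ δ ≤ x ^ δ := Real.rpow_le_rpow (by positivity) hSx hδ.le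
    have hsub : X ⊆ Finset.univ.filter fun u => ((S.card : ℝ) / n) ^ δ < R.hitProb S u := by
      intro u hu
      exact Finset.mem_filter.2 ⟨Finset.mem_univ _, hxd.trans_lt (Finset.mem_filter.1 hu).2⟩
    calc (X.card : ℝ) ≤ _ := by exact_mod_cast Finset.card_le_card hsub
      _ ≤ _ := hexc S hne hcard
      _ ≤ 1 * (x * n) := by
          gcongr
          exact hxd.trans (Real.rpow_le_one hx.le hx1 hδ.le)
      _ = _ := one_mul _
  have hh : ∑ u ∈ Xᶜ, (hits E S (T / R.deg u) u : ℝ) < ε * n / 4 := by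
    by_contra hcon
    exact hhit ⟨S, not_lt.1 hcon⟩
  have hmain := ncard_closedNbhd_le hE hD k (t := fun v => T / R.deg v)
    (fun v => div_pos hT (h.deg_pos v)) S X
    (late := Finset.univ.filter fun v => LowAt E (T / R.deg v) D v)
    (fun v hv => Finset.mem_filter.2 ⟨Finset.mem_univ _, hv⟩)
  rw [hSS] at hmain
  have hmain' : ((closedNbhd (sparseGraph E D k) S').ncard : ℝ) ≤ (1 + D) * S.card
      + (Finset.univ.filter fun v => LowAt E (T / R.deg v) D v).card + X.card
      + ∑ v ∈ Xᶜ, (hits E S (T / R.deg v) v : ℝ) := by exact_mod_cast hmain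
  have h3 : (1 + D) * (S.card : ℝ) ≤ (1 + D) * (x * n) := by gcongr
  have h4 := mul_le_mul_of_nonneg_right hDx hn.le
  linarith

open Classical in
-- Scaling the time by `1 / d_R(v)` gives all vertices the same bound `T^D e^(3-T)`, independent of
-- `n`.
lemma measureReal_card_low_ge_le {n : ℕ} {R : RateMatrix n} {α γ b d : ℝ} (h : IsRMAt R α γ b d)
    {T ε : ℝ} (hT : 1 ≤ T) (hε : 0 < ε) (hTn : T * (n : ℝ) ^ (-γ) ≤ 1) (D : ℕ) :
    (clocksLaw R).real {E | ε * n / 4 ≤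
        ((Finset.univ.filter fun v => LowAt E (T / R.deg v) D v).card : ℝ)}
      ≤ 4 * (T ^ D * Real.exp (3 - T)) / ε := by
  have hn := h.n_pos
  refine (measureReal_card_ge_le (clocksLaw R) (fun v => {E | LowAt E (T / R.deg v) D v})
    (a := ε * n / 4) (by positivity)).trans ?_
  have hsum : ∑ v, (clocksLaw R).real {E | LowAt E (T / R.deg v) D v}
      ≤ n * (T ^ D * Real.exp (3 - T)) := by
    calc _ ≤ ∑ _v : Fin n, T ^ D * Real.exp (3 - T) := by
          refine Finset.sum_le_sum fun v _ => ?_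
          have hdv := h.deg_pos v
          have e : T / R.deg v * R.deg v = T := by field_simp
          refine (measureReal_degree_lt_le_lowProb R (t := T / R.deg v) (by positivity)
            (by rw [e]; exact hT) (fun w => ?_) D).trans_eq (by rw [lowProb, e])
          calc R.rate v w * (T / R.deg v) ≤ d * (n : ℝ) ^ (-γ) * (T / R.deg v) := by
                gcongr; exact h.rate_le v w
            _ = d / R.deg v * (T * (n : ℝ) ^ (-γ)) := by ring
            _ ≤ 1 * 1 := by
                have := h.d_pos
                gcongr
                exact (div_le_one hdv).2 (h.le_deg v)
            _ = 1 := one_mul 1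
      _ = _ := by simp
  calc _ ≤ n * (T ^ D * Real.exp (3 - T)) / (ε * n / 4) := by gcongr
    _ = _ := by field_simp

/-- The light tail property of the sparse graph. -/
theorem whp_ncard_closedNbhd_highDegree_le {R : (n : ℕ) → RateMatrix n} {α γ b : ℝ} {d : ℕ → ℝ}
    (hR : IsRM R α γ b d) {D : ℕ} (hD : 1 ≤ D) (k : ℕ) {θ : ℕ → ℝ} (hθ : Tendsto θ atTop atTop)
    {ε : ℝ} (hε : 0 < ε) : Whp R fun n E =>
      ((closedNbhd (sparseGraph E D k)
        (highDegree (R n) (d n) (θ n) (sparseGraph E D k))).ncard : ℝ) ≤ ε * n := by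
  classical
  refine Whp.of_eventually_le fun η hη => ?_
  obtain ⟨δ, β, hδ, hβ, hβ1, hexc⟩ :=
    exists_card_exceptional_le hR.alpha_nonneg hR.alpha_lt hR.gamma_pos hR.b_pos
  -- `T` is fixed first to make late vertices rare, then `x` small in terms of `T`, and only then
  -- `n` large.
  obtain ⟨T, hT1, hT⟩ : ∃ T : ℝ, 1 ≤ T ∧ 4 * (T ^ D * Real.exp (3 - T)) / ε ≤ η / 2 := by
    have h1 : Tendsto (fun T : ℝ => 4 * Real.exp 3 / ε * (T ^ D * Real.exp (-T))) atTop (𝓝 0) := by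
      simpa using (Real.tendsto_pow_mul_exp_neg_atTop_nhds_zero D).const_mul (4 * Real.exp 3 / ε)
    obtain ⟨T, h2, h3⟩ := ((h1.eventually (ge_mem_nhds (half_pos hη))).and
      (eventually_ge_atTop 1)).exists
    refine ⟨T, h3, h2.trans_eq' ?_⟩
    rw [sub_eq_add_neg, Real.exp_add]; ring
  have hT0 : 0 < T := by linarith
  obtain ⟨x, hx, hxβ, hTx, hlog, hDx⟩ : ∃ x : ℝ, 0 < x ∧ x ≤ β ∧ T * x ^ (δ / 2) ≤ 1 ∧
      2 ≤ ε * δ / 16 * -Real.log x ∧ (2 + D) * x ≤ ε / 2 := by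
    refine ⟨min (min β ((1 / T) ^ (2 / δ))) (min (Real.exp (-(32 / (ε * δ)))) (ε / (2 * (2 + D)))),
      by positivity, (min_le_left _ _).trans (min_le_left _ _), ?_, ?_, ?_⟩
    · calc _ ≤ T * ((1 / T) ^ (2 / δ)) ^ (δ / 2) := by
            gcongr
            exact (min_le_left _ _).trans (min_le_right _ _)
        _ = 1 := by
            rw [← Real.rpow_mul (by positivity), div_mul_div_comm, mul_comm 2 δ,
              div_self (by positivity), Real.rpow_one, mul_one_div_cancel hT0.ne']
    · have h1 := Real.log_le_log (by positivity) ((min_le_right (min β ((1 / T) ^ (2 / δ))) _).trans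
        (min_le_left (Real.exp (-(32 / (ε * δ)))) (ε / (2 * (2 + (D : ℝ))))))
      rw [Real.log_exp] at h1
      calc (2 : ℝ) = ε * δ / 16 * (32 / (ε * δ)) := by field_simp; norm_num
        _ ≤ _ := by gcongr; linarith
    · calc _ ≤ (2 + (D : ℝ)) * (ε / (2 * (2 + D))) := by
            gcongr
            exact (min_le_right _ _).trans (min_le_right _ _)
        _ = _ := by field_simp
  have hlim : Tendsto (fun n : ℕ => 2 * (2 * Real.exp (-1)) ^ n) atTop (𝓝 0) := by
    have h1 : 2 * Real.exp (-1) < 1 := by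
      rw [Real.exp_neg, ← div_eq_mul_inv, div_lt_one (Real.exp_pos 1)]
      linarith [Real.exp_one_gt_d9]
    simpa using (tendsto_pow_atTop_nhds_zero_of_lt_one (by positivity) h1).const_mul 2
  have hTn : ∀ᶠ n : ℕ in atTop, T * (n : ℝ) ^ (-γ) ≤ 1 := by
    have := ((tendsto_rpow_neg_atTop hR.gamma_pos).comp
      tendsto_natCast_atTop_atTop).const_mul T
    rw [mul_zero] at this
    exact this.eventually (ge_mem_nhds one_pos)
  filter_upwards [hR.eventually_isRMAt, hlim.eventually (ge_mem_nhds (half_pos hη)), hTn,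
    hθ.eventually_ge_atTop ((2 * D + b) / x)] with n h hlim hTn hθn
  have hb := hR.b_pos
  have hθ0 : 0 < θ n := lt_of_lt_of_le (by positivity) hθn
  have hθx : 2 * D + b ≤ θ n * x := (div_le_iff₀ hx).1 hθn
  have hn := h.n_pos
  have hsub : {E | ¬ ((closedNbhd (sparseGraph E D k)
        (highDegree (R n) (d n) (θ n) (sparseGraph E D k))).ncard : ℝ) ≤ ε * n} ⊆
      ({E | ¬ NoTies E} ∪ {E | ε * n / 4 ≤
        ((Finset.univ.filter fun v => LowAt E (T / (R n).deg v) D v).card : ℝ)}) ∪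
        HitBad (R n) T δ x ε := by
    intro E hE
    by_contra hcon
    simp only [Set.mem_union, Set.mem_ofPred_eq, not_or, not_not, not_le] at hcon
    obtain ⟨⟨h1, h2⟩, h3⟩ := hcon
    refine hE (ncard_closedNbhd_highDegree_le h hD k hT0 hδ hx (hxβ.trans hβ1) (fun W hW hWx => ?_)
      hDx hθ0 hθx h1 h2 h3)
    exact hexc n (R n) (d n) h W hW (hWx.trans (by gcongr))
  have h0 : (clocksLaw (R n)).real {E | ¬ NoTies E} = 0 := by
    rw [measureReal_def, ae_iff.1 (ae_noTies (R n))]; rfl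
  have h1 := measureReal_card_low_ge_le h hT1 hε hTn D
  have h2 := measureReal_hitBad_le h (ε := ε) hT0 hδ hx (hxβ.trans hβ1) hTx hlog
  refine (measureReal_mono hsub).trans ((measureReal_union_le _ _).trans ?_)
  have h3 := measureReal_union_le (μ := clocksLaw (R n)) {E | ¬ NoTies E} {E | ε * n / 4 ≤
        ((Finset.univ.filter fun v => LowAt E (T / (R n).deg v) D v).card : ℝ)}
  linarith

end RateProcess

/-! ### The lemma. -/

theorem lemma2p1 (R : (n : ℕ) → RateProcess.RateMatrix n) (hR : RateProcess.RM R)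
    (k : ℕ) (hk : 1 ≤ k) :
    ∃ (D₀ : ℕ) (β : ℝ), k ≤ D₀ ∧ 0 < β ∧ ∀ D : ℕ, D₀ ≤ D →
      (∀ (α γ b : ℝ) (d : ℕ → ℝ), RateProcess.IsRM R α γ b d →
        ∀ θ : ℕ → ℝ, Tendsto θ atTop atTop → ∀ ε : ℝ, 0 < ε →
          RateProcess.Whp R fun n E =>
            ((RateProcess.closedNbhd (RateProcess.sparseGraph E D k)
              (RateProcess.highDegree (R n) (d n) (θ n)
                (RateProcess.sparseGraph E D k))).ncard : ℝ) ≤ ε * n) ∧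
      RateProcess.Whp R fun n E =>
        ∀ A : Finset (Fin n), (A.card : ℝ) < β * n →
          k * A.card ≤
            (RateProcess.nbhd (RateProcess.sparseGraph E D k) (A : Set (Fin n))).ncard := by
  obtain ⟨α, γ, b, d, hRM⟩ := hR
  obtain ⟨D₀, β, hkD, hβ, hexp⟩ := RateProcess.exists_expansion hRM hk
  refine ⟨D₀, β, hkD, hβ, fun D hD => ⟨fun α' γ' b' d' hRM' θ hθ ε hε =>
    RateProcess.whp_ncard_closedNbhd_highDegree_le hRM' (hk.trans (hkD.trans hD)) k hθ hε, ?_⟩⟩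
  -- `H` grows with `D` while `τ_k` does not depend on it, so expansion for `D₀` passes to every
  -- larger `D` with the same `β`.
  refine tendsto_of_tendsto_of_tendsto_of_le_of_le tendsto_const_nhds hexp (fun n => zero_le)
    fun n => measure_mono fun E hE hE' => hE fun A hA => (hE' A hA).trans ?_
  exact Set.ncard_le_ncard
    (RateProcess.nbhd_mono (RateProcess.sparseGraph_mono E hD k) A) (Set.toFinite _)
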